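/- Fix masses $m_1,m_2,m_3>0$ and a nonzero vector $J_0\in\mathbb R^3$. An oriented triangle is a pair $(q,n)$, where $q=(q_1,q_2,q_3)\in(\mathbb R^3)^3$ satisfies $\sum_a m_aq_a=0$ and $n\in\mathbb R^3$ is a unit vector orthogonal to $q_1,q_2,q_3$. Let $\tilde Q$ be the space of oriented triangles, $\tilde Q^*\subset\tilde Q$ the subset $q\neq0$ (no triple collision), $I=\sum_a m_a\|q_a\|^2$, and $\tilde S^5=\{I=1\}\subset\tilde Q$. Let $G=SO(3)$ act by rotating $q$ and $n$ simultaneously, and let $G(J_0)\subset G$ be the subgroup of rotations about the axis $J_0$. Put $S=\tilde S^5/G$, $S_{J_0}=\tilde S^5/G(J_0)$ and $Q_{J_0}=\tilde Q/G(J_0)$ (the reduced configuration space). Then $\tilde Q^*$ and $\tilde S^5$ are embedded submanifolds of $(\mathbb R^3)^3\times\mathbb R^3$ of dimensions $6$ and $5$, and $S$, $S_{J_0}$, $Q_{J_0}$ minus the triple collision, and $\tilde S^5\times_G S^2$ (where $S^2\subset\mathbb R^3$ is the unit sphere) are smooth quotient manifolds of dimensions $2,4,5,4$. With these structures: (1)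 The inclusion $\tilde S^5\subset\tilde Q^*$ induces a homeomorphism from $S$ onto the space $\tilde Q^*/(G\times\mathbb R^+)$ of similarity classes of oriented triangles, and $S$ is diffeomorphic to the two-sphere. (2) $\tilde S^5\to S$ is the nontrivial principal $SO(3)$-bundle over the two-sphere: it is a smooth principal $SO(3)$-bundle, it is not trivial (even topologically), and there is an $SO(3)$-equivariant diffeomorphism of $\tilde S^5$ onto the bundle of oriented orthonormal frames of $\gamma\oplus\epsilon\to\mathbb{CP}^1$, where $\gamma$ is the tautological complex line bundle and $\epsilon$ the trivial real line bundle. (3) $S_{J_0}\to S$ is the associated two-sphere bundle: the map $[s]\mapsto[s,J_0/\|J_0\|]$ is a diffeomorphism over $S$ from $S_{J_0}$ onto $\tilde S^5\times_G S^2$, where $S^2=G/G(J_0)$. It is a smooth fiber bundle with fiber $S^2$, and it is not trivial (even topologically). (4) $Q_{J_0}$ minus the triple collision is diffeomorphic to $S_{J_0}\times(0,\infty)$, by a diffeomorphism whose second component is $I$ and whose first component sends the class of $(cq,n)$, for $(q,n)\in\tilde S^5$ and $c>0$, to the class of $(q,n)$. -/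

import Mathlib

open scoped Manifold ContDiff Topology

noncomputable section

namespace ThreeBody

/-! ### Euclidean space and the rotation group -/

/-- Euclidean space `ℝⁿ`. -/
abbrev E (n : ℕ) : Type := EuclideanSpace ℝ (Fin n)

/-- The rotation group `G = SO(3)`, with the topology of a space of matrices. -/
abbrev SO3 : Type := Matrix.specialOrthogonalGroup (Fin 3) ℝ

/-- `SO(3)` acts on `ℝ³` by matrix-vector multiplication. -/
instance : MulAction SO3 (E 3) where
  smul g x := WithLp.toLp 2 (g.1.mulVec x.ofLp)
  one_smul x := by
    change WithLp.toLp 2 ((1 : Matrix (Fin 3) (Fin 3) ℝ).mulVec x.ofLp) = x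
    rw [Matrix.one_mulVec]
  mul_smul g h x := by
    change WithLp.toLp 2 ((g.1 * h.1).mulVec x.ofLp) =
      WithLp.toLp 2 (g.1.mulVec (h.1.mulVec x.ofLp))
    rw [Matrix.mulVec_mulVec]

theorem rot_def (g : SO3) (x : E 3) : g • x = WithLp.toLp 2 (g.1.mulVec x.ofLp) := rfl

theorem rot_zero (g : SO3) : g • (0 : E 3) = 0 := by
  rw [rot_def]; simp

theorem rot_add (g : SO3) (x y : E 3) : g • (x + y) = g • x + g • y := by
  simp [rot_def]

theorem rot_smul (g : SO3) (c : ℝ) (x : E 3) : g • (c • x) = c • (g • x) := by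
  simp [rot_def, Matrix.mulVec_smul]

theorem rot_sum (g : SO3) (f : Fin 3 → E 3) : g • (∑ a, f a) = ∑ a, g • f a := by
  simp [Fin.sum_univ_three]

theorem rot_inner (g : SO3) (x y : E 3) : inner ℝ (g • x) (g • y) = inner ℝ x y := by
  have hg : g.1.transpose * g.1 = 1 := g.2.1.1
  simp only [rot_def, EuclideanSpace.inner_eq_star_dotProduct, star_trivial]
  rw [Matrix.dotProduct_mulVec, ← Matrix.mulVec_transpose, Matrix.mulVec_mulVec, hg,
    Matrix.one_mulVec]

theorem rot_norm (g : SO3) (x : E 3) : ‖g • x‖ = ‖x‖ := by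
  rw [@norm_eq_sqrt_real_inner _ _ _ (g • x), rot_inner, ← norm_eq_sqrt_real_inner]

/-- The unit sphere `S² ⊂ ℝ³`. -/
abbrev S2 : Type := Metric.sphere (0 : E 3) 1

instance : MulAction SO3 S2 where
  smul g x := ⟨g • x.1, by
    have := x.2
    simp only [mem_sphere_iff_norm, sub_zero] at this ⊢
    rw [rot_norm, this]⟩
  one_smul x := Subtype.ext (one_smul SO3 x.1)
  mul_smul g h x := Subtype.ext (mul_smul g h x.1)

/-- The subgroup `G(J₀) ⊂ SO(3)` of rotations that fix `J₀`; for `J₀ ≠ 0` these are the rotations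
about the axis `J₀`. -/
abbrev axisRot (J₀ : E 3) : Subgroup SO3 := MulAction.stabilizer SO3 J₀

/-- The unit vector `J₀ / ‖J₀‖`. -/
def axis (J₀ : E 3) (hJ : J₀ ≠ 0) : S2 :=
  ⟨‖J₀‖⁻¹ • J₀, by
    have : ‖J₀‖ ≠ 0 := norm_ne_zero_iff.mpr hJ
    simp [norm_smul, this]⟩

/-! ### Oriented triangles -/

/-- The space of pairs (triple of vectors of `ℝ³`, vector of `ℝ³`), in which oriented triangles
live. -/
abbrev Ambient : Type := (Fin 3 → E 3) × E 3

/-- `(q, n)` is an oriented triangle for the masses `m`: the center of mass of `q` is at the origin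
and `n` is a unit vector normal to the span of the vertices `q a`. -/
def IsOrientedTriangle (m : Fin 3 → ℝ) (p : Ambient) : Prop :=
  ∑ a, m a • p.1 a = 0 ∧ ‖p.2‖ = 1 ∧ ∀ v ∈ Submodule.span ℝ (Set.range p.1), inner ℝ v p.2 = 0

theorem normal_iff (q : Fin 3 → E 3) (n : E 3) :
    (∀ v ∈ Submodule.span ℝ (Set.range q), inner ℝ v n = 0) ↔ ∀ a, inner ℝ (q a) n = 0 := by
  constructor
  · intro h a
    exact h _ (Submodule.subset_span ⟨a, rfl⟩)
  · intro h v hv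
    induction hv using Submodule.span_induction with
    | mem x hx => obtain ⟨a, rfl⟩ := hx; exact h a
    | zero => simp
    | add x y _ _ hx hy => rw [inner_add_left, hx, hy, add_zero]
    | smul c x _ hx => rw [inner_smul_left, hx, mul_zero]

/-- The space `Q̃` of oriented triangles. -/
abbrev OTri (m : Fin 3 → ℝ) : Type := {p : Ambient // IsOrientedTriangle m p}

/-- The polar moment of inertia `I = ∑ mₐ ‖qₐ‖²`. -/
def inertia {m : Fin 3 → ℝ} (x : OTri m) : ℝ := ∑ a, m a * ‖x.1.1 a‖ ^ 2

theorem IsOrientedTriangle.rot {m : Fin 3 → ℝ} {p : Ambient} (hp : IsOrientedTriangle m p)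
    (g : SO3) : IsOrientedTriangle m (g • p) := by
  obtain ⟨h1, h2, h3⟩ := hp
  rw [normal_iff] at h3
  refine ⟨?_, ?_, ?_⟩
  · have : ∑ a, m a • (g • p).1 a = g • ∑ a, m a • p.1 a := by
      rw [rot_sum]
      exact Finset.sum_congr rfl fun a _ => (rot_smul g (m a) (p.1 a)).symm
    rw [this, h1, rot_zero]
  · exact (rot_norm g p.2).trans h2
  · rw [normal_iff]
    exact fun a => (rot_inner g (p.1 a) p.2).trans (h3 a)

theorem IsOrientedTriangle.scale {m : Fin 3 → ℝ} {p : Ambient} (hp : IsOrientedTriangle m p)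
    (c : ℝ) : IsOrientedTriangle m (c • p.1, p.2) := by
  obtain ⟨h1, h2, h3⟩ := hp
  rw [normal_iff] at h3
  refine ⟨?_, h2, ?_⟩
  · simp only [Pi.smul_apply]
    rw [Finset.sum_congr rfl fun a _ => smul_comm (m a) c (p.1 a), ← Finset.smul_sum, h1, smul_zero]
  · rw [normal_iff]
    intro a
    simp [inner_smul_left, h3 a]

/-- Rotations act on oriented triangles: `g (q, n) = (g q₁, g q₂, g q₃, g n)`. -/
instance (m : Fin 3 → ℝ) : MulAction SO3 (OTri m) where
  smul g x := ⟨g • x.1, x.2.rot g⟩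
  one_smul x := Subtype.ext (one_smul SO3 x.1)
  mul_smul g h x := Subtype.ext (mul_smul g h x.1)

/-- Dilations act on oriented triangles: `(q, n) ↦ (c q, n)`. -/
def dilate {m : Fin 3 → ℝ} (c : ℝ) (x : OTri m) : OTri m := ⟨(c • x.1.1, x.1.2), x.2.scale c⟩

theorem inertia_rot {m : Fin 3 → ℝ} (g : SO3) (x : OTri m) : inertia (g • x) = inertia x := by
  unfold inertia
  refine Finset.sum_congr rfl fun a _ => ?_
  have : (g • x).1.1 a = g • x.1.1 a := rfl
  rw [this, rot_norm]

theorem inertia_dilate {m : Fin 3 → ℝ} (c : ℝ) (x : OTri m) :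
    inertia (dilate c x) = c ^ 2 * inertia x := by
  unfold inertia dilate
  rw [Finset.mul_sum]
  refine Finset.sum_congr rfl fun a _ => ?_
  simp only [Pi.smul_apply, norm_smul, mul_pow, Real.norm_eq_abs, sq_abs]
  ring

/-- `Q̃* `: the oriented triangles other than the triple collisions `(0, n)`. -/
abbrev OTriStar (m : Fin 3 → ℝ) : Type := {x : OTri m // x.1.1 ≠ 0}

/-- `S̃⁵`: the oriented triangles with `I = 1`. -/
abbrev S5 (m : Fin 3 → ℝ) : Type := {x : OTri m // inertia x = 1}

theorem rot_ne_zero {m : Fin 3 → ℝ} (g : SO3) {x : OTri m} (hx : x.1.1 ≠ 0) :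
    (g • x).1.1 ≠ 0 := by
  intro h
  apply hx
  funext a
  have h1 : g • x.1.1 a = 0 := congrFun h a
  have h2 := rot_norm g (x.1.1 a)
  rw [h1, norm_zero] at h2
  exact norm_eq_zero.mp h2.symm

theorem S5.ne_zero {m : Fin 3 → ℝ} (s : S5 m) : s.1.1.1 ≠ 0 := by
  intro h
  have h1 := s.2
  simp [inertia, h] at h1

instance (m : Fin 3 → ℝ) : MulAction SO3 (OTriStar m) where
  smul g x := ⟨g • x.1, rot_ne_zero g x.2⟩
  one_smul x := Subtype.ext (one_smul SO3 x.1)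
  mul_smul g h x := Subtype.ext (mul_smul g h x.1)

instance (m : Fin 3 → ℝ) : MulAction SO3 (S5 m) where
  smul g x := ⟨g • x.1, (inertia_rot g x.1).trans x.2⟩
  one_smul x := Subtype.ext (one_smul SO3 x.1)
  mul_smul g h x := Subtype.ext (mul_smul g h x.1)

/-- The inclusion `S̃⁵ ⊂ Q̃*`. -/
def S5.toStar {m : Fin 3 → ℝ} (s : S5 m) : OTriStar m := ⟨s.1, s.ne_zero⟩

/-! ### The quotient spaces

All of them carry the quotient topology. -/

/-- `S = S̃⁵ / SO(3)`. -/
abbrev Shape (m : Fin 3 → ℝ) : Type := MulAction.orbitRel.Quotient SO3 (S5 m)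

/-- `S_{J₀} = S̃⁵ / G(J₀)`. -/
abbrev SJ (m : Fin 3 → ℝ) (J₀ : E 3) : Type := MulAction.orbitRel.Quotient (axisRot J₀) (S5 m)

/-- The reduced configuration space `Q_{J₀} = Q̃ / G(J₀)`. -/
abbrev QJ (m : Fin 3 → ℝ) (J₀ : E 3) : Type := MulAction.orbitRel.Quotient (axisRot J₀) (OTri m)

/-- The projection `S̃⁵ → S`. -/
def toShape {m : Fin 3 → ℝ} (s : S5 m) : Shape m := Quotient.mk _ s

/-- The projection `S̃⁵ → S_{J₀}`. -/
def toSJ {m : Fin 3 → ℝ} (J₀ : E 3) (s : S5 m) : SJ m J₀ := Quotient.mk _ s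

/-- The projection `π_{J₀} : Q̃ → Q_{J₀}`. -/
def toQJ {m : Fin 3 → ℝ} (J₀ : E 3) (x : OTri m) : QJ m J₀ := Quotient.mk _ x

/-- The projection `S_{J₀} → S`. -/
def SJ.toShape {m : Fin 3 → ℝ} {J₀ : E 3} : SJ m J₀ → Shape m :=
  Quotient.lift ThreeBody.toShape (by
    rintro a b ⟨g, rfl⟩
    exact Quotient.sound ⟨g.1, rfl⟩)

/-- The image of the triple collisions in the reduced configuration space. -/
def tripleCollision (m : Fin 3 → ℝ) (J₀ : E 3) : Set (QJ m J₀) :=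
  toQJ J₀ '' {x | x.1.1 = 0}

/-- The reduced configuration space minus the triple collision. -/
abbrev QJStar (m : Fin 3 → ℝ) (J₀ : E 3) : Type := ((tripleCollision m J₀)ᶜ : Set (QJ m J₀))

/-- The restriction `Q̃* → Q_{J₀} ∖ {triple collision}` of `π_{J₀}`. -/
def toQJStar {m : Fin 3 → ℝ} (J₀ : E 3) (x : OTriStar m) : QJStar m J₀ :=
  ⟨toQJ J₀ x.1, by
    rintro ⟨y, hy, hyx⟩
    obtain ⟨g, hg⟩ := Quotient.exact hyx
    have hg' : g.1 • x.1 = y := hg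
    exact rot_ne_zero g.1 x.2 (by rw [hg']; exact hy)⟩

/-- Two oriented triangles (not triple collisions) are similar if they differ by a rotation and a
dilation. -/
def similarity (m : Fin 3 → ℝ) : Setoid (OTriStar m) where
  r x y := ∃ (g : SO3) (c : ℝ), 0 < c ∧ y.1 = dilate c (g • x.1)
  iseqv := by
    have key : ∀ (g : SO3) (c : ℝ) (x : OTri m), g • dilate c x = dilate c (g • x) := by
      intro g c x
      refine Subtype.ext (Prod.ext ?_ rfl)
      funext a
      exact rot_smul g c (x.1.1 a)
    have key2 : ∀ (c d : ℝ) (x : OTri m), dilate c (dilate d x) = dilate (c * d) x := by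
      intro c d x
      refine Subtype.ext (Prod.ext ?_ rfl)
      exact (mul_smul c d x.1.1).symm
    have key1 : ∀ x : OTri m, dilate 1 x = x := by
      intro x
      refine Subtype.ext (Prod.ext ?_ rfl)
      exact one_smul ℝ x.1.1
    refine ⟨fun x => ⟨1, 1, one_pos, ?_⟩, ?_, ?_⟩
    · rw [one_smul, key1]
    · rintro x y ⟨g, c, hc, h⟩
      refine ⟨g⁻¹, c⁻¹, inv_pos.mpr hc, ?_⟩
      rw [h, key, key2, inv_mul_cancel₀ hc.ne', key1, inv_smul_smul]
    · rintro x y z ⟨g, c, hc, h⟩ ⟨g', c', hc', h'⟩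
      refine ⟨g' * g, c' * c, mul_pos hc' hc, ?_⟩
      rw [h', h, key, key2, mul_smul]

/-- The space `Q̃* / (SO(3) × ℝ⁺)` of similarity classes of oriented triangles. -/
abbrev SimilarityClass (m : Fin 3 → ℝ) : Type := Quotient (similarity m)

/-- The bundle `S̃⁵ ×_G S²` over `S` associated to `S̃⁵ → S`: the quotient of `S̃⁵ × S²` by
the diagonal action of `G = SO(3)`. Here `S² = G / G(J₀)`, through `g ↦ g J₀ / ‖J₀‖`. -/
abbrev Assoc (m : Fin 3 → ℝ) : Type := MulAction.orbitRel.Quotient SO3 (S5 m × S2)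

/-- The projection `S̃⁵ × S² → S̃⁵ ×_G S²`. -/
def toAssoc {m : Fin 3 → ℝ} (p : S5 m × S2) : Assoc m := Quotient.mk _ p

/-- The bundle projection `S̃⁵ ×_G S² → S`. -/
def Assoc.toShape {m : Fin 3 → ℝ} : Assoc m → Shape m :=
  Quotient.lift (fun p : S5 m × S2 => ThreeBody.toShape p.1) (by
    rintro a b ⟨g, rfl⟩
    exact Quotient.sound ⟨g, rfl⟩)

/-! ### Smooth bundles -/

section Bundles

variable {EP HP P EB HB B EF HF F : Type}
  [NormedAddCommGroup EP] [NormedSpace ℝ EP] [TopologicalSpace HP]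
  [NormedAddCommGroup EB] [NormedSpace ℝ EB] [TopologicalSpace HB]
  [NormedAddCommGroup EF] [NormedSpace ℝ EF] [TopologicalSpace HF]
  [TopologicalSpace P] [TopologicalSpace B] [TopologicalSpace F]

/-- The local trivialization `e` is a diffeomorphism. -/
def IsSmoothTrivialization (IP : ModelWithCorners ℝ EP HP) (IB : ModelWithCorners ℝ EB HB)
    (IF : ModelWithCorners ℝ EF HF) [ChartedSpace HP P] [ChartedSpace HB B] [ChartedSpace HF F]
    {π : P → B} (e : Bundle.Trivialization F π) : Prop :=
  ContMDiffOn IP (IB.prod IF) ∞ e e.source ∧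
    ContMDiffOn (IB.prod IF) IP ∞ e.toOpenPartialHomeomorph.symm e.target

/-- `π : P → B` is a smooth locally trivial fiber bundle with fiber `F`. -/
def IsSmoothFiberBundle (IP : ModelWithCorners ℝ EP HP) (IB : ModelWithCorners ℝ EB HB)
    (IF : ModelWithCorners ℝ EF HF) [ChartedSpace HP P] [ChartedSpace HB B] (F : Type)
    [TopologicalSpace F] [ChartedSpace HF F] (π : P → B) : Prop :=
  ∀ b : B, ∃ e : Bundle.Trivialization F π, b ∈ e.baseSet ∧ IsSmoothTrivialization IP IB IF e

/-- `π : P → B` is a smooth principal bundle for the Lie group `F`, which acts from the left. -/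
def IsSmoothPrincipalBundle (IP : ModelWithCorners ℝ EP HP) (IB : ModelWithCorners ℝ EB HB)
    (IF : ModelWithCorners ℝ EF HF) [ChartedSpace HP P] [ChartedSpace HB B] (F : Type)
    [TopologicalSpace F] [ChartedSpace HF F] [Group F] [MulAction F P] (π : P → B) : Prop :=
  ContMDiffSMul IF IP ∞ F P ∧
    ∀ b : B, ∃ e : Bundle.Trivialization F π, b ∈ e.baseSet ∧ IsSmoothTrivialization IP IB IF e ∧
      ∀ p ∈ e.source, ∀ g : F, g • p ∈ e.source ∧ e (g • p) = ((e p).1, g * (e p).2)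

/-- `π : P → B` is trivial as a fiber bundle with fiber `F`, even if only continuity is asked. -/
def IsTrivialFiberBundle (F : Type) [TopologicalSpace F] (π : P → B) : Prop :=
  ∃ φ : P ≃ₜ B × F, ∀ p, (φ p).1 = π p

/-- `π : P → B` is trivial as a principal `F`-bundle, even if only continuity is asked. -/
def IsTrivialPrincipalBundle (F : Type) [TopologicalSpace F] [Group F] [MulAction F P]
    (π : P → B) : Prop :=
  ∃ φ : P ≃ₜ B × F, ∀ p, (φ p).1 = π p ∧ ∀ g : F, φ (g • p) = (π p, g * (φ p).2)

end Bundles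

/-! ### The standard nontrivial bundle -/

/-- Triples of vectors of `ℂ² ⊕ ℝ`. -/
abbrev Triples : Type := Fin 3 → (Fin 2 → ℂ) × ℝ

/-- The total space of the bundle of oriented orthonormal frames of `γ ⊕ ε → ℂP¹`, where `γ` is the
tautological complex line bundle and `ε` the trivial real line bundle. Over the line `ℂ v`, `v` a
unit vector of `ℂ²`, the fiber of `γ ⊕ ε` is `ℂ v ⊕ ℝ ⊂ ℂ² ⊕ ℝ`, with the oriented orthonormal basis
`(v, 0), (i v, 0), (0, 1)`; so the oriented orthonormal frames are the triples whose coordinates in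
this basis are the rows of a matrix in `SO(3)`. Such a triple determines the line `ℂ v`. -/
def frameBundle : Set Triples :=
  {e | ∃ (v : Fin 2 → ℂ) (A : SO3), ∑ k, ‖v k‖ ^ 2 = 1 ∧
    ∀ i, e i = (((A.1 i 0 : ℂ) + (A.1 i 1 : ℂ) * Complex.I) • v, A.1 i 2)}

end ThreeBody

end

/-!
# The shape sphere of oriented triangles and the bundles over it

Mass-normalized Jacobi vectors `x`, `y` turn an oriented triangle with `I = 1` into a unit vector
`n` and two vectors orthogonal to `n` with `‖x‖² + ‖y‖² = 1`. In the plane that `n` orients, `x`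
and `y` are complex numbers up to a common phase, and the Hopf map
`(‖x‖² - ‖y‖², 2 x · y, 2 n · (x × y))` is a complete invariant of the rotations. It identifies
the quotient `S` with the unit sphere of `ℝ³`, with a continuous inverse because the map has
continuous local sections (`shapeHomeo`).

Where a given Jacobi vector does not vanish, this vector and `n` determine a rotation that depends
equivariantly on the triangle. This trivializes `S̃⁵ → S` over the two discs that cover `S`
(`trivS5`), and likewise the associated bundle (`trivAssoc`). The charts of `S̃⁵` and of
`S̃⁵ ×_G S²` are pulled back along these trivializations. The other spaces inherit their charts
from homeomorphisms: `S_J` from `S̃⁵ ×_G S²` (`thetaHomeo`), and the spaces of triangles of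
arbitrary size from products with the value of `I` (`starHomeo`, `phiHomeo`). That these
structures are the ones that the theorem asks for is a matter of one-sided local inverses. A
smooth map to a vector space with smooth local retractions is an immersion
(`isImmersion_of_retractions`), and a smooth map with smooth local sections through every point is
a submersion (`isSubmersion_of_sections`). For `SO(3)` itself, the charts are the translates of
the Cayley transform.

The bundle of frames of `γ ⊕ ε` appears when `x` and `y` are complexified to `x + i n × x` and
`y + i n × y`: their coordinates, together with those of `n`, form three vectors of `ℂ² ⊕ ℝ`,
which are an oriented orthonormal frame of a fiber of `γ ⊕ ε` (`frameMap`, `range_frameMap`).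

A trivialization of the principal bundle is a continuous equivariant map `S̃⁵ → SO(3)`. The
triangles in a fixed plane provide sections over two discs of shapes, and these differ by a full
turn along the common boundary circle. So such a map would extend the full turn, as a loop in
`SO(3)`, over the disc; but its lift to the unit quaternions is not closed (`not_exists_disc`,
`not_exists_equivariant`). A trivialization of the sphere bundle gives three disjoint sections.
Three distinct points of a sphere are not collinear, so that they determine a frame, and the
principal bundle would be trivial as well (`not_isTrivialFiberBundle`).
-/

noncomputable section

namespace ThreeBody

open Manifold Set Topology

/-! ### Immersions and submersions from local inverses -/

section LocalDiffeo

variable {V W : Type} [NormedAddCommGroup V] [NormedSpace ℝ V] [CompleteSpace V]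
  [NormedAddCommGroup W] [NormedSpace ℝ W]

/-- The inverse function theorem, with an inverse that is smooth on a whole open set. -/
theorem exists_localDiffeo {f : V → W} {U : Set V} (hU : IsOpen U) (hf : ContDiffOn ℝ ∞ f U)
    {a : V} (ha : a ∈ U) {f' : V ≃L[ℝ] W} (hf' : HasFDerivAt f (f' : V →L[ℝ] W) a) :
    ∃ Φ : OpenPartialHomeomorph V W, a ∈ Φ.source ∧ Φ.source ⊆ U ∧ (∀ x, Φ x = f x) ∧
      ContDiffOn ℝ ∞ Φ.symm Φ.target := by
  have hfa : ContDiffAt ℝ ∞ f a := hf.contDiffAt (hU.mem_nhds ha)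
  set Φ₀ := hfa.toOpenPartialHomeomorph f hf' (by simp)
  set S : Set V := U ∩ fderiv ℝ f ⁻¹' (range ((↑) : (V ≃L[ℝ] W) → V →L[ℝ] W))
  have hS : IsOpen S :=
    (hf.continuousOn_fderiv_of_isOpen hU (by simp)).isOpen_inter_preimage hU
      ContinuousLinearEquiv.isOpen
  have haS : a ∈ S := ⟨ha, f', hf'.fderiv.symm⟩
  have hsrc : (Φ₀.restrOpen S hS).source = Φ₀.source ∩ S := Φ₀.restrOpen_source S hS
  refine ⟨Φ₀.restrOpen S hS, ?_, ?_, fun x => rfl, ?_⟩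
  · rw [hsrc]
    exact ⟨hfa.mem_toOpenPartialHomeomorph_source hf' (by simp), haS⟩
  · rw [hsrc]
    exact fun x hx => hx.2.1
  · intro y hy
    have hx := (Φ₀.restrOpen S hS).map_target hy
    rw [hsrc] at hx
    obtain ⟨hx1, hx2, A, hA⟩ := hx
    have hd : ContDiffAt ℝ ∞ f ((Φ₀.restrOpen S hS).symm y) := hf.contDiffAt (hU.mem_nhds hx2)
    refine (OpenPartialHomeomorph.contDiffAt_symm (f₀' := A) _ hy ?_ hd).contDiffWithinAt
    have := (hd.differentiableAt (by simp)).hasFDerivAt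
    rw [← hA] at this
    exact this

end LocalDiffeo

section Immersion

variable {n : ℕ} {M : Type} [TopologicalSpace M] [ChartedSpace (E n) M] [IsManifold (𝓡 n) ∞ M]
  {V : Type} [NormedAddCommGroup V] [NormedSpace ℝ V] [FiniteDimensional ℝ V]

/-- A map to a vector space is locally retracted if, near each point, it has a smooth left inverse
that is defined on the ambient space. -/
def HasSmoothRetractions {EM HM : Type} [NormedAddCommGroup EM] [NormedSpace ℝ EM]
    [TopologicalSpace HM] (I : ModelWithCorners ℝ EM HM) {M : Type} [TopologicalSpace M]
    [ChartedSpace HM M] (f : M → V) : Prop :=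
  ∀ x, ∃ r : V → M, ContMDiffAt 𝓘(ℝ, V) I ∞ r (f x) ∧ ∀ᶠ y in 𝓝 x, r (f y) = y

omit [FiniteDimensional ℝ V] in
/-- A continuous map to `M` is smooth as soon as its composition with a locally retracted map is. -/
theorem HasSmoothRetractions.contMDiffAt {EM HM : Type} [NormedAddCommGroup EM] [NormedSpace ℝ EM]
    [TopologicalSpace HM] {I : ModelWithCorners ℝ EM HM} {M : Type} [TopologicalSpace M]
    [ChartedSpace HM M] {f : M → V} (hf : HasSmoothRetractions I f)
    {EN HN : Type} [NormedAddCommGroup EN] [NormedSpace ℝ EN]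
    [TopologicalSpace HN] {J : ModelWithCorners ℝ EN HN} {N : Type} [TopologicalSpace N]
    [ChartedSpace HN N] {h : N → M} {y : N} (hc : ContinuousAt h y)
    (hs : ContMDiffAt J 𝓘(ℝ, V) ∞ (fun z => f (h z)) y) : ContMDiffAt J I ∞ h y := by
  obtain ⟨r, hr, he⟩ := hf (h y)
  refine (ContMDiffAt.comp y (g := r) (f := fun z => f (h z)) hr hs).congr_of_eventuallyEq ?_
  filter_upwards [hc.eventually he] with z hz
  exact hz.symm

/-- A smooth map with local smooth retractions is an immersion: its derivative has a left inverse,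
and the inverse function theorem, applied to its sum with a complement of the image, provides the
slice charts. -/
theorem isImmersion_of_retractions {f : M → V} (hf : ContMDiff (𝓡 n) 𝓘(ℝ, V) ∞ f)
    (hr : HasSmoothRetractions (𝓡 n) f) : IsImmersion (𝓡 n) 𝓘(ℝ, V) ∞ f := by
  refine ⟨E (Module.finrank ℝ V - n), inferInstance, inferInstance, fun x => ?_⟩
  obtain ⟨r, hr, he⟩ := hr x
  set φ := chartAt (E n) x
  have hx : x ∈ φ.source := mem_chart_source _ x
  have hφ : φ ∈ IsManifold.maximalAtlas (𝓡 n) ∞ M := IsManifold.chart_mem_maximalAtlas x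
  set j : E n → V := f ∘ φ.symm
  have hj : ContDiffOn ℝ ∞ j φ.target :=
    contMDiffOn_iff_contDiffOn.mp (hf.comp_contMDiffOn (contMDiffOn_symm_of_mem_maximalAtlas hφ))
  have hu : φ x ∈ φ.target := φ.map_source hx
  have hjx : j (φ x) = f x := by simp [j, φ.left_inv hx]
  have hrx : r (f x) = x := he.self_of_nhds
  have hs : ContDiffAt ℝ ∞ (φ ∘ r) (j (φ x)) := by
    rw [hjx]
    refine contMDiffAt_iff_contDiffAt.mp (ContMDiffAt.comp _ ?_ hr)
    rw [hrx]
    exact contMDiffAt_of_mem_maximalAtlas hφ hx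
  have hj' : HasFDerivAt j (fderiv ℝ j (φ x)) (φ x) :=
    ((hj.contDiffAt (φ.open_target.mem_nhds hu)).differentiableAt (by simp)).hasFDerivAt
  have hs' := (hs.differentiableAt (by simp)).hasFDerivAt
  have hid : (φ ∘ r) ∘ j =ᶠ[𝓝 (φ x)] id := by
    have h1 : Filter.Tendsto φ.symm (𝓝 (φ x)) (𝓝 x) := by
      have := φ.continuousAt_symm hu
      rwa [ContinuousAt, φ.left_inv hx] at this
    filter_upwards [h1.eventually he, φ.open_target.mem_nhds hu] with u hu1 hu2
    simp only [Function.comp_apply, j, hu1, id, φ.right_inv hu2]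
  have hcomp : (fderiv ℝ (φ ∘ r) (j (φ x))).comp (fderiv ℝ j (φ x)) = .id ℝ (E n) :=
    ((hs'.comp _ hj').congr_of_eventuallyEq hid.symm).unique (hasFDerivAt_id (φ x))
  have hinj : Function.Injective (fderiv ℝ j (φ x)) := by
    intro u v huv
    have h1 := congrArg (fun T : E n →L[ℝ] E n => T u) hcomp
    have h2 := congrArg (fun T : E n →L[ℝ] E n => T v) hcomp
    simp only [ContinuousLinearMap.comp_apply, ContinuousLinearMap.id_apply] at h1 h2
    rw [← h1, ← h2, huv]
  set j' := fderiv ℝ j (φ x)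
  obtain ⟨K, hK⟩ := Submodule.exists_isCompl (LinearMap.range (j' : E n →ₗ[ℝ] V))
  -- the slice map `(u, k) ↦ j u + k`
  set G : E n × K → V := fun p => j p.1 + p.2
  have hG' : HasFDerivAt G (j'.coprod K.subtypeL) (φ x, 0) := by
    have h1 : HasFDerivAt (fun p : E n × K => j p.1) (j'.comp (.fst ℝ _ _)) (φ x, 0) :=
      HasFDerivAt.comp (g := j) (f := Prod.fst) (φ x, (0 : K)) hj' hasFDerivAt_fst
    have h2 : HasFDerivAt (fun p : E n × K => (p.2 : V)) (K.subtypeL.comp (.snd ℝ _ _)) (φ x, 0) :=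
      (K.subtypeL.comp (.snd ℝ (E n) K)).hasFDerivAt
    refine (h1.add h2).congr_fderiv ?_
    ext p <;> simp
  have hbij : Function.Bijective (j'.coprod K.subtypeL) := by
    constructor
    · rw [injective_iff_map_eq_zero]
      rintro ⟨u, k⟩ h
      simp only [ContinuousLinearMap.coprod_apply, Submodule.subtypeL_apply] at h
      have hk : (k : V) ∈ LinearMap.range (j' : E n →ₗ[ℝ] V) :=
        ⟨-u, by
          simp only [map_neg, ContinuousLinearMap.coe_coe]
          exact (eq_neg_of_add_eq_zero_right h).symm⟩
      have hk0 : (k : V) = 0 := Submodule.disjoint_def.mp hK.disjoint _ hk k.2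
      rw [hk0, add_zero] at h
      have : u = 0 := hinj (by rw [h, map_zero])
      exact Prod.ext this (Subtype.ext hk0)
    · intro v
      have : v ∈ LinearMap.range (j' : E n →ₗ[ℝ] V) ⊔ K := by rw [hK.sup_eq_top]; trivial
      obtain ⟨_, ⟨u, rfl⟩, k, hk, h⟩ := Submodule.mem_sup.mp this
      exact ⟨(u, ⟨k, hk⟩), by simpa using h⟩
  set A : (E n × K) ≃L[ℝ] V :=
    (LinearEquiv.ofBijective ((j'.coprod K.subtypeL : E n × K →L[ℝ] V) : E n × K →ₗ[ℝ] V)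
      hbij).toContinuousLinearEquiv
  have hA : (A : E n × K →L[ℝ] V) = j'.coprod K.subtypeL := by ext p <;> rfl
  have hGs : ContDiffOn ℝ ∞ G (φ.target ×ˢ univ) := by
    refine ContDiffOn.add (hj.comp contDiffOn_fst fun p hp => hp.1) ?_
    exact (K.subtypeL.contDiff.comp contDiff_snd).contDiffOn
  obtain ⟨Φ, hΦ1, hΦ2, hΦ3, hΦ4⟩ := exists_localDiffeo (φ.open_target.prod isOpen_univ) hGs
    (a := (φ x, 0)) ⟨hu, trivial⟩ (f' := A) (by rw [hA]; exact hG')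
  have hdim : Module.finrank ℝ K = Module.finrank ℝ (E (Module.finrank ℝ V - n)) := by
    have := A.toLinearEquiv.finrank_eq
    rw [Module.finrank_prod, finrank_euclideanSpace, Fintype.card_fin] at this
    rw [finrank_euclideanSpace, Fintype.card_fin]
    omega
  set κ : K ≃L[ℝ] E (Module.finrank ℝ V - n) := ContinuousLinearEquiv.ofFinrankEq hdim
  set ψ : OpenPartialHomeomorph V V := Φ.symm ≫ₕ A.toHomeomorph.toOpenPartialHomeomorph
  have hψ : ψ ∈ IsManifold.maximalAtlas 𝓘(ℝ, V) ∞ V := by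
    refine ψ.mem_maximalAtlas_of_contMDiffOn ?_ ?_
    · rw [contMDiffOn_iff_contDiffOn]
      refine A.contDiff.comp_contDiffOn (hΦ4.mono ?_)
      simp [ψ]
    · rw [contMDiffOn_iff_contDiffOn]
      have h1 : ContDiffOn ℝ ∞ Φ Φ.source :=
        (hGs.mono hΦ2).congr fun p _ => hΦ3 p
      refine h1.comp (A.symm.contDiff.contDiffOn) ?_
      intro v hv
      simpa [ψ] using hv
  set Z : Set (E n) := {u | (u, (0 : K)) ∈ Φ.source}
  have hZ : IsOpen Z := Φ.open_source.preimage (by fun_prop)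
  set S : Set M := φ.source ∩ φ ⁻¹' Z
  have hS : IsOpen S := φ.isOpen_inter_preimage hZ
  refine IsImmersionAtOfComplement.mk_of_continuousAt hf.continuous.continuousAt
    (((ContinuousLinearEquiv.refl ℝ (E n)).prodCongr κ.symm).trans A) (φ.restr S) ψ ?_ ?_
    (restr_mem_maximalAtlas (contDiffGroupoid ∞ (𝓡 n)) hφ hS) hψ ?_
  · rw [φ.restr_source, hS.interior_eq]
    exact ⟨hx, hx, hΦ1⟩
  · have := Φ.map_source hΦ1
    rw [hΦ3] at this
    simpa [ψ, G, hjx] using this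
  · intro u hu'
    have hu1 : u ∈ φ.target ∧ φ.symm u ∈ S := by
      simpa [φ.restr_target, hS.interior_eq] using hu'
    have hu2 : (u, (0 : K)) ∈ Φ.source := by
      have := hu1.2.2
      rwa [mem_preimage, φ.right_inv hu1.1] at this
    have h1 : f (φ.symm u) = Φ (u, 0) := by rw [hΦ3]; simp [G, j]
    simp only [ψ, Function.comp_apply]
    simp [h1, Φ.left_inv hu2]

end Immersion

section Submersion

variable {EM HM : Type} [NormedAddCommGroup EM] [NormedSpace ℝ EM] [FiniteDimensional ℝ EM]
  [TopologicalSpace HM] {I : ModelWithCorners ℝ EM HM} [I.Boundaryless]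
  {EN HN : Type} [NormedAddCommGroup EN] [NormedSpace ℝ EN] [FiniteDimensional ℝ EN]
  [TopologicalSpace HN] {J : ModelWithCorners ℝ EN HN} [J.Boundaryless]
  {M : Type} [TopologicalSpace M] [ChartedSpace HM M] [IsManifold I ∞ M]
  {N : Type} [TopologicalSpace N] [ChartedSpace HN N] [IsManifold J ∞ N]

omit [FiniteDimensional ℝ EM] in
theorem contMDiff_toHomeomorph : ContMDiff I 𝓘(ℝ, EM) ∞ I.toHomeomorph := I.contMDiff

omit [FiniteDimensional ℝ EM] in
theorem contMDiff_toHomeomorph_symm : ContMDiff 𝓘(ℝ, EM) I ∞ I.toHomeomorph.symm := by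
  have h := I.contMDiffOn_symm (n := ∞)
  rw [I.range_eq_univ, contMDiffOn_univ] at h
  exact h

variable (I) in
/-- The chart at `x`, as a map to the model vector space. -/
def vectorChart (x : M) : OpenPartialHomeomorph M EM :=
  chartAt HM x ≫ₕ I.toHomeomorph.toOpenPartialHomeomorph

omit [FiniteDimensional ℝ EM] [IsManifold I ∞ M] in
theorem mem_vectorChart_source (x : M) : x ∈ (vectorChart I x).source := by
  simp [vectorChart]

omit [FiniteDimensional ℝ EM] in
theorem contMDiffOn_vectorChart (x : M) :
    ContMDiffOn I 𝓘(ℝ, EM) ∞ (vectorChart I x) (vectorChart I x).source :=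
  contMDiff_toHomeomorph.comp_contMDiffOn ((contMDiffOn_chart (I := I) (n := ∞) (x := x)).mono
    (by simp [vectorChart]))

omit [FiniteDimensional ℝ EM] in
theorem contMDiffOn_vectorChart_symm (x : M) :
    ContMDiffOn 𝓘(ℝ, EM) I ∞ (vectorChart I x).symm (vectorChart I x).target := by
  refine (contMDiffOn_chart_symm (I := I) (n := ∞) (x := x)).comp
    (contMDiff_toHomeomorph_symm.contMDiffOn) ?_
  intro u hu
  simpa [vectorChart] using hu

/-- A smooth map with smooth local sections through every point is a submersion. -/
theorem isSubmersion_of_sections {f : M → N} (hf : ContMDiff I J ∞ f)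
    (hsec : ∀ x, ∃ σ : N → M, σ (f x) = x ∧ ContMDiffAt J I ∞ σ (f x) ∧
      ∀ᶠ y in 𝓝 (f x), f (σ y) = y) : IsSubmersion I J ∞ f := by
  refine ⟨E (Module.finrank ℝ EM - Module.finrank ℝ EN), inferInstance, inferInstance,
    fun x => ?_⟩
  set c := vectorChart I x
  set d := vectorChart J (f x)
  have hx : x ∈ c.source := mem_vectorChart_source x
  have hfx : f x ∈ d.source := mem_vectorChart_source (f x)
  have hc := contMDiffOn_vectorChart (I := I) x
  have hc' := contMDiffOn_vectorChart_symm (I := I) x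
  have hd := contMDiffOn_vectorChart (I := J) (f x)
  have hd' := contMDiffOn_vectorChart_symm (I := J) (f x)
  set U : Set EM := c.target ∩ c.symm ⁻¹' (f ⁻¹' d.source)
  have hU : IsOpen U := c.symm.isOpen_inter_preimage (d.open_source.preimage hf.continuous)
  set h : EM → EN := d ∘ f ∘ c.symm
  have hh : ContDiffOn ℝ ∞ h U := by
    rw [← contMDiffOn_iff_contDiffOn]
    refine hd.comp (hf.comp_contMDiffOn (hc'.mono fun u hu => hu.1)) fun u hu => hu.2
  have hcx : c x ∈ U := ⟨c.map_source hx, by simpa [c.left_inv hx] using hfx⟩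
  have hh' := ((hh.contDiffAt (hU.mem_nhds hcx)).differentiableAt (by simp)).hasFDerivAt
  have hhx : h (c x) = d (f x) := by simp [h, c.left_inv hx]
  obtain ⟨σ, hσx, hσ, hσf⟩ := hsec x
  -- the section in charts is a right inverse of `h`, so that the derivative of `h` is onto
  have hs : DifferentiableAt ℝ (c ∘ σ ∘ d.symm) (h (c x)) := by
    refine ContDiffAt.differentiableAt (n := ∞) (contMDiffAt_iff_contDiffAt.mp ?_) (by simp)
    rw [hhx]
    have e1 : d.symm (d (f x)) = f x := d.left_inv hfx
    refine ContMDiffAt.comp (I' := I) _ (g := c) (f := σ ∘ d.symm) ?_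
      (ContMDiffAt.comp (I' := J) _ ?_
        (hd'.contMDiffAt (d.open_target.mem_nhds (d.map_source hfx))))
    · rw [Function.comp_apply, e1, hσx]
      exact hc.contMDiffAt (c.open_source.mem_nhds hx)
    · rw [e1]
      exact hσ
  have hsx : (c ∘ σ ∘ d.symm) (h (c x)) = c x := by
    simp [hhx, d.left_inv hfx, hσx]
  have hid : h ∘ (c ∘ σ ∘ d.symm) =ᶠ[𝓝 (h (c x))] id := by
    rw [hhx]
    have t1 : Filter.Tendsto d.symm (𝓝 (d (f x))) (𝓝 (f x)) := by
      have := d.continuousAt_symm (d.map_source hfx)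
      rwa [ContinuousAt, d.left_inv hfx] at this
    have t2 : Filter.Tendsto (σ ∘ d.symm) (𝓝 (d (f x))) (𝓝 x) := by
      have := hσ.continuousAt.tendsto
      rw [hσx] at this
      exact this.comp t1
    filter_upwards [t1.eventually hσf, t2.eventually (c.open_source.mem_nhds hx),
      d.open_target.mem_nhds (d.map_source hfx)] with v v1 v2 v3
    simp only [h, Function.comp_apply, id] at v1 v2 ⊢
    rw [c.left_inv v2, v1, d.right_inv v3]
  have hcomp : (fderiv ℝ h (c x)).comp (fderiv ℝ (c ∘ σ ∘ d.symm) (h (c x))) = .id ℝ EN := by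
    have h1 : HasFDerivAt h (fderiv ℝ h (c x)) ((c ∘ σ ∘ d.symm) (h (c x))) := by
      rw [hsx]; exact hh'
    exact ((h1.comp _ hs.hasFDerivAt).congr_of_eventuallyEq hid.symm).unique
      (hasFDerivAt_id (h (c x)))
  set h' := fderiv ℝ h (c x)
  have hsurj : Function.Surjective h' := fun v =>
    ⟨fderiv ℝ (c ∘ σ ∘ d.symm) (h (c x)) v, by
      have h1 := congrArg (fun T : EN →L[ℝ] EN => T v) hcomp
      simpa using h1⟩
  set K := LinearMap.ker (h' : EM →ₗ[ℝ] EN)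
  obtain ⟨K', hK⟩ := Submodule.exists_isCompl K
  set P : EM →L[ℝ] K := (K.projectionOnto K' hK).toContinuousLinearMap
  have hbij : Function.Bijective (h'.prod P) := by
    constructor
    · rw [injective_iff_map_eq_zero]
      intro u hu
      have h1 : h' u = 0 := congrArg Prod.fst hu
      have h2 : K.projectionOnto K' hK u = 0 := congrArg Prod.snd hu
      have h3 := Submodule.projectionOnto_apply_left hK ⟨u, h1⟩
      rw [h2] at h3
      exact (congrArg Subtype.val h3).symm
    · rintro ⟨v, k⟩
      obtain ⟨u, rfl⟩ := hsurj v
      refine ⟨u - K.projectionOnto K' hK u + k, ?_⟩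
      have h1 : h' (K.projectionOnto K' hK u : EM) = 0 := (K.projectionOnto K' hK u).2
      have h2 : h' (k : EM) = 0 := k.2
      refine Prod.ext ?_ ?_
      · change h' (u - K.projectionOnto K' hK u + k) = h' u
        rw [map_add, map_sub, h1, h2, sub_zero, add_zero]
      · change K.projectionOnto K' hK _ = k
        rw [map_add, map_sub, Submodule.projectionOnto_apply_left,
          Submodule.projectionOnto_apply_left, sub_self, zero_add]
  set A : EM ≃L[ℝ] (EN × K) :=
    (LinearEquiv.ofBijective ((h'.prod P : EM →L[ℝ] EN × K) : EM →ₗ[ℝ] EN × K)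
      hbij).toContinuousLinearEquiv
  have hA : (A : EM →L[ℝ] EN × K) = h'.prod P := by ext p <;> rfl
  set G : EM → EN × K := fun u => (h u, P u)
  have hGs : ContDiffOn ℝ ∞ G U := hh.prodMk P.contDiff.contDiffOn
  have hG' : HasFDerivAt G (A : EM →L[ℝ] EN × K) (c x) := by
    rw [hA]
    exact hh'.prodMk P.hasFDerivAt
  obtain ⟨Φ, hΦ1, hΦ2, hΦ3, hΦ4⟩ := exists_localDiffeo hU hGs hcx hG'
  have hdim : Module.finrank ℝ K =
      Module.finrank ℝ (E (Module.finrank ℝ EM - Module.finrank ℝ EN)) := by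
    have := A.toLinearEquiv.finrank_eq
    rw [Module.finrank_prod] at this
    rw [finrank_euclideanSpace, Fintype.card_fin]
    omega
  set κ : K ≃L[ℝ] E (Module.finrank ℝ EM - Module.finrank ℝ EN) :=
    ContinuousLinearEquiv.ofFinrankEq hdim
  set ψ : OpenPartialHomeomorph M HM := c ≫ₕ Φ ≫ₕ
    (A.symm.toHomeomorph.trans I.toHomeomorph.symm).toOpenPartialHomeomorph
  have hψ : ψ ∈ IsManifold.maximalAtlas I ∞ M := by
    refine ψ.mem_maximalAtlas_of_contMDiffOn ?_ ?_
    · have h1 : ContMDiffOn 𝓘(ℝ, EM) 𝓘(ℝ, EM) ∞ (A.symm ∘ Φ) Φ.source := by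
        rw [contMDiffOn_iff_contDiffOn]
        exact A.symm.contDiff.comp_contDiffOn ((hGs.mono hΦ2).congr fun p _ => hΦ3 p)
      refine contMDiff_toHomeomorph_symm.comp_contMDiffOn
        (h1.comp (hc.mono fun y hy => ?_) fun y hy => ?_)
      · simp only [ψ, mfld_simps] at hy
        exact hy.1
      · simp only [ψ, mfld_simps] at hy
        exact hy.2
    · have h1 : ContMDiffOn 𝓘(ℝ, EM) 𝓘(ℝ, EM) ∞ (Φ.symm ∘ A) (A ⁻¹' Φ.target) := by
        rw [contMDiffOn_iff_contDiffOn]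
        exact hΦ4.comp A.contDiff.contDiffOn fun u hu => hu
      refine hc'.comp (h1.comp contMDiff_toHomeomorph.contMDiffOn fun y hy => ?_) fun y hy => ?_
      · simp only [ψ, mfld_simps] at hy
        exact hy.1
      · simp only [ψ, mfld_simps] at hy
        exact hy.2
  refine IsSubmersionAtOfComplement.mk_of_continuousAt hf.continuous.continuousAt
    (A.trans ((ContinuousLinearEquiv.refl ℝ EN).prodCongr κ)) ψ (chartAt HN (f x)) ?_
    (mem_chart_source _ _) hψ (IsManifold.chart_mem_maximalAtlas _) ?_
  · simp only [ψ, mfld_simps]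
    exact ⟨hx, hΦ1⟩
  · intro u hu
    simp only [ψ, mfld_simps] at hu
    obtain ⟨-, hu1, hu2⟩ := hu
    have e1 : I.toHomeomorph (I.symm u) = u := I.toHomeomorph.right_inv u
    change A (I.toHomeomorph (I.symm u)) ∈ Φ.target at hu1
    rw [e1] at hu1
    have key : h (Φ.symm (A u)) = (A u).1 := by
      have h1 := Φ.right_inv hu1
      rw [hΦ3] at h1
      exact congrArg Prod.fst h1
    have e2 : ψ.symm (I.symm u) = c.symm (Φ.symm (A u)) := by
      change c.symm (Φ.symm (A (I.toHomeomorph (I.symm u)))) = _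
      rw [e1]
    simp only [Function.comp_apply, OpenPartialHomeomorph.extend_coe,
      OpenPartialHomeomorph.extend_coe_symm, e2]
    exact key

end Submersion

/-! ### Manifold structures transported by local homeomorphisms -/

section Pull

variable {EN HN : Type} [NormedAddCommGroup EN] [NormedSpace ℝ EN]
  [TopologicalSpace HN] {J : ModelWithCorners ℝ EN HN} [J.Boundaryless]
  {M N : Type} [TopologicalSpace M] [TopologicalSpace N] [ChartedSpace HN N]
  {n : ℕ} {ι : Type}

/-- The identification of the model space of `N` with `ℝⁿ` that a linear isomorphism gives. -/
def modelToVector (J : ModelWithCorners ℝ EN HN) [J.Boundaryless] (Λ : EN ≃L[ℝ] E n) : HN ≃ₜ E n :=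
  J.toHomeomorph.trans Λ.toHomeomorph

/-- The composition of a local homeomorphism to `N` with a chart of `N`, which a linear isomorphism
identifies with a map to `ℝⁿ`. -/
def pullChart (J : ModelWithCorners ℝ EN HN) [J.Boundaryless] (Λ : EN ≃L[ℝ] E n)
    (e : OpenPartialHomeomorph M N) (c : OpenPartialHomeomorph N HN) :
    OpenPartialHomeomorph M (E n) :=
  e ≫ₕ c ≫ₕ (modelToVector J Λ).toOpenPartialHomeomorph

/-- The charts on `M` obtained from a family of local homeomorphisms from `M` to a manifold `N`,
whose domains cover `M`. -/
abbrev pullCharted (J : ModelWithCorners ℝ EN HN) [J.Boundaryless] (Λ : EN ≃L[ℝ] E n)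
    (e : ι → OpenPartialHomeomorph M N) (i : M → ι) (hi : ∀ x, x ∈ (e (i x)).source) :
    ChartedSpace (E n) M where
  atlas := {φ | ∃ j, ∃ c ∈ atlas HN N, φ = pullChart J Λ (e j) c}
  chartAt x := pullChart J Λ (e (i x)) (chartAt HN (e (i x) x))
  mem_chart_source x := by simp [pullChart, hi x]
  chart_mem_atlas x := ⟨i x, _, chart_mem_atlas _ _, rfl⟩

variable [IsManifold J ∞ N] (Λ : EN ≃L[ℝ] E n) (e : ι → OpenPartialHomeomorph M N) (i : M → ι)
  (hi : ∀ x, x ∈ (e (i x)).source)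

omit [TopologicalSpace M] [TopologicalSpace N] [ChartedSpace HN N] [IsManifold J ∞ N] in
theorem contMDiff_modelToVector :
    ContMDiff J (𝓡 n) ∞ (modelToVector J Λ) :=
  ContMDiff.comp (I' := 𝓘(ℝ, EN)) (g := Λ) (f := J.toHomeomorph) Λ.contDiff.contMDiff
    contMDiff_toHomeomorph

omit [TopologicalSpace M] [TopologicalSpace N] [ChartedSpace HN N] [IsManifold J ∞ N] in
theorem contMDiff_modelToVector_symm :
    ContMDiff (𝓡 n) J ∞ (modelToVector J Λ).symm :=
  ContMDiff.comp (I' := 𝓘(ℝ, EN)) (g := J.toHomeomorph.symm) (f := Λ.symm)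
    contMDiff_toHomeomorph_symm Λ.symm.contDiff.contMDiff

/-- Charts pulled back along local homeomorphisms to `N` are compatible if the transition maps
between these local homeomorphisms are smooth. -/
theorem pullCharted_isManifold
    (hcompat : ∀ j k, ContMDiffOn J J ∞ ((e j).symm ≫ₕ e k) ((e j).symm ≫ₕ e k).source) :
    @IsManifold ℝ _ (E n) _ _ (E n) _ (𝓡 n) ∞ M _ (pullCharted J Λ e i hi) := by
  let _ := pullCharted J Λ e i hi
  refine isManifold_of_contDiffOn (𝓡 n) ∞ M ?_
  rintro _ _ ⟨j, c, hc, rfl⟩ ⟨k, d, hd, rfl⟩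
  have hc' := IsManifold.subset_maximalAtlas (I := J) (n := ∞) hc
  have hd' := IsManifold.subset_maximalAtlas (I := J) (n := ∞) hd
  rw [← contMDiffOn_iff_contDiffOn]
  have h1 := contMDiffOn_symm_of_mem_maximalAtlas hc'
  have h2 := contMDiffOn_of_mem_maximalAtlas hd'
  have h3 := contMDiff_modelToVector (J := J) Λ
  have h4 := contMDiff_modelToVector_symm (J := J) Λ
  refine h3.comp_contMDiffOn ((h2.comp ((hcompat j k).comp (h1.comp h4.contMDiffOn ?_) ?_) ?_))
  all_goals
    intro u hu
    simp only [pullChart, mfld_simps] at hu ⊢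
    tauto

/-- The local homeomorphisms by which the structure of `M` is defined are diffeomorphisms. -/
theorem pullCharted_contMDiffOn
    (hcompat : ∀ j k, ContMDiffOn J J ∞ ((e j).symm ≫ₕ e k) ((e j).symm ≫ₕ e k).source) (j : ι) :
    let _ := pullCharted J Λ e i hi
    ContMDiffOn (𝓡 n) J ∞ (e j) (e j).source ∧
      ContMDiffOn J (𝓡 n) ∞ (e j).symm (e j).target := by
  let _ := pullCharted J Λ e i hi
  have := pullCharted_isManifold Λ e i hi hcompat
  have h3 := contMDiff_modelToVector (J := J) Λ
  have h4 := contMDiff_modelToVector_symm (J := J) Λ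
  have key : ∀ z : N, pullChart J Λ (e j) (chartAt HN z) ∈ IsManifold.maximalAtlas (𝓡 n) ∞ M :=
    fun z => IsManifold.subset_maximalAtlas ⟨j, _, chart_mem_atlas _ _, rfl⟩
  constructor
  · intro x hx
    set c := chartAt HN (e j x)
    have hxc : x ∈ (pullChart J Λ (e j) c).source := by simp [pullChart, hx, c]
    have h1 := contMDiffAt_of_mem_maximalAtlas (key (e j x)) hxc
    have hcx : c (e j x) ∈ c.target := c.map_source (mem_chart_source _ _)
    have h2 : ContMDiffAt J J ∞ c.symm ((modelToVector J Λ).symm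
        (pullChart J Λ (e j) c x)) := by
      simp only [pullChart, mfld_simps]
      rw [Homeomorph.symm_apply_apply]
      exact contMDiffAt_symm_of_mem_maximalAtlas (IsManifold.chart_mem_maximalAtlas _) hcx
    refine (((h2.comp _ h4.contMDiffAt).comp x h1).congr_of_eventuallyEq ?_).contMDiffWithinAt
    filter_upwards [(pullChart J Λ (e j) c).open_source.mem_nhds hxc] with y hy
    simp only [pullChart, mfld_simps] at hy ⊢
    rw [Homeomorph.symm_apply_apply, c.left_inv hy.2]
  · intro z hz
    set c := chartAt HN z
    have hzc : z ∈ c.source := mem_chart_source _ _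
    have hL : (modelToVector J Λ) (c z) ∈ (pullChart J Λ (e j) c).target := by
      simp only [pullChart, mfld_simps]
      rw [Homeomorph.symm_apply_apply]
      exact ⟨c.map_source hzc, by rwa [c.left_inv hzc]⟩
    have h1 := contMDiffAt_symm_of_mem_maximalAtlas (key z) hL
    have h2 : ContMDiffAt J J ∞ c z :=
      contMDiffAt_of_mem_maximalAtlas (IsManifold.chart_mem_maximalAtlas _) hzc
    have h5 := (ContMDiffAt.comp z (f := (modelToVector J Λ) ∘ c) h1
      (h3.contMDiffAt.comp z h2))
    refine (h5.congr_of_eventuallyEq ?_).contMDiffWithinAt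
    filter_upwards [c.open_source.mem_nhds hzc] with y hy
    simp only [pullChart, mfld_simps]
    rw [Homeomorph.symm_apply_apply, c.left_inv hy]

omit [J.Boundaryless] [IsManifold J ∞ N] in
/-- The compatibility of the transition map is automatic for a single homeomorphism. -/
theorem homeomorph_compat (h : M ≃ₜ N) : ∀ _j _k : Unit, ContMDiffOn J J ∞
    (h.toOpenPartialHomeomorph.symm ≫ₕ h.toOpenPartialHomeomorph)
    (h.toOpenPartialHomeomorph.symm ≫ₕ h.toOpenPartialHomeomorph).source := by
  intro _ _
  refine contMDiffOn_id.congr fun x _ => ?_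
  simp

/-- The charts on `M` transported by a homeomorphism to a manifold `N`. -/
abbrev homeoCharted (J : ModelWithCorners ℝ EN HN) [J.Boundaryless] (Λ : EN ≃L[ℝ] E n)
    (h : M ≃ₜ N) : ChartedSpace (E n) M :=
  pullCharted J Λ (fun _ : Unit => h.toOpenPartialHomeomorph) (fun _ => ()) fun _ => trivial

theorem homeoCharted_isManifold (h : M ≃ₜ N) :
    @IsManifold ℝ _ (E n) _ _ (E n) _ (𝓡 n) ∞ M _ (homeoCharted J Λ h) :=
  pullCharted_isManifold Λ _ _ _ (homeomorph_compat h)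

/-- The homeomorphism by which the structure of `M` is defined is a diffeomorphism. -/
def homeoCharted_diffeomorph (h : M ≃ₜ N) :
    @Diffeomorph ℝ _ (E n) _ _ EN _ _ (E n) _ HN _ (𝓡 n) J M _ (homeoCharted J Λ h) N _ _ ∞ :=
  letI := homeoCharted J Λ h
  { toEquiv := h.toEquiv
    contMDiff_toFun := by
      have := (pullCharted_contMDiffOn Λ (fun _ : Unit => h.toOpenPartialHomeomorph) (fun _ => ())
        (fun _ => trivial) (homeomorph_compat (J := J) h) ()).1
      rw [h.toOpenPartialHomeomorph_source, contMDiffOn_univ] at this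
      exact this
    contMDiff_invFun := by
      have := (pullCharted_contMDiffOn Λ (fun _ : Unit => h.toOpenPartialHomeomorph) (fun _ => ())
        (fun _ => trivial) (homeomorph_compat (J := J) h) ()).2
      rw [h.toOpenPartialHomeomorph_target, contMDiffOn_univ] at this
      exact this }

end Pull

/-! ### The rotation group as a Lie group -/

/-- The space of `3 × 3` arrays of real numbers. -/
abbrev Mat3 : Type := Fin 3 → Fin 3 → ℝ

/-- The entries of a rotation. -/
def entries (g : SO3) : Mat3 := fun i j => g.1 i j

theorem entries_injective : Function.Injective entries := fun _ _ hgh =>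
  Subtype.ext (Matrix.ext fun i j => congrFun (congrFun hgh i) j)

theorem isEmbedding_entries : IsEmbedding entries := IsEmbedding.subtypeVal

theorem entries_mul (g h : SO3) (i j : Fin 3) :
    entries (g * h) i j = ∑ k, entries g i k * entries h k j := rfl

theorem entries_inv (g : SO3) (i j : Fin 3) : entries g⁻¹ i j = entries g j i := rfl

theorem entries_one (i j : Fin 3) : entries 1 i j = if i = j then 1 else 0 := by
  simp [entries, Matrix.one_apply]

theorem entries_cols (g : SO3) (i j : Fin 3) :
    ∑ k, entries g k i * entries g k j = if i = j then 1 else 0 := by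
  rw [← entries_one, ← inv_mul_cancel g, entries_mul]
  simp only [entries_inv]

theorem entries_rows (g : SO3) (i j : Fin 3) :
    ∑ k, entries g i k * entries g j k = if i = j then 1 else 0 := by
  rw [← entries_one, ← mul_inv_cancel g, entries_mul]
  simp only [entries_inv]

/-- A rotation matrix is its own cofactor matrix. -/
theorem entries_adjugate (g : SO3) : g.1.adjugate = g.1.transpose := by
  have h1 : g.1 * g.1.adjugate = 1 := by
    rw [Matrix.mul_adjugate, (Matrix.mem_specialOrthogonalGroup_iff.mp g.2).2, one_smul]
  have h2 : g.1.transpose * g.1 = 1 := g.2.1.1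
  calc g.1.adjugate = g.1.transpose * g.1 * g.1.adjugate := by rw [h2, one_mul]
    _ = g.1.transpose := by rw [mul_assoc, h1, mul_one]

theorem entries_cofactor (g : SO3) :
    entries g 0 0 = entries g 1 1 * entries g 2 2 - entries g 1 2 * entries g 2 1 ∧
    entries g 0 1 = entries g 1 2 * entries g 2 0 - entries g 1 0 * entries g 2 2 ∧
    entries g 0 2 = entries g 1 0 * entries g 2 1 - entries g 1 1 * entries g 2 0 ∧
    entries g 1 0 = entries g 0 2 * entries g 2 1 - entries g 0 1 * entries g 2 2 ∧
    entries g 1 1 = entries g 0 0 * entries g 2 2 - entries g 0 2 * entries g 2 0 ∧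
    entries g 1 2 = entries g 0 1 * entries g 2 0 - entries g 0 0 * entries g 2 1 ∧
    entries g 2 0 = entries g 0 1 * entries g 1 2 - entries g 0 2 * entries g 1 1 ∧
    entries g 2 1 = entries g 0 2 * entries g 1 0 - entries g 0 0 * entries g 1 2 ∧
    entries g 2 2 = entries g 0 0 * entries g 1 1 - entries g 0 1 * entries g 1 0 := by
  have h := fun i j => congrFun (congrFun (entries_adjugate g) i) j
  simp only [Matrix.adjugate_fin_three, Matrix.transpose_apply] at h
  have h00 := h 0 0; have h01 := h 0 1; have h02 := h 0 2
  have h10 := h 1 0; have h11 := h 1 1; have h12 := h 1 2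
  have h20 := h 2 0; have h21 := h 2 1; have h22 := h 2 2
  simp at h00 h01 h02 h10 h11 h12 h20 h21 h22
  simp only [entries]
  refine ⟨?_, ?_, ?_, ?_, ?_, ?_, ?_, ?_, ?_⟩ <;> linarith

/-- The rotation with given entries. -/
def SO3.ofEntries (A : Mat3) (h : ∀ i j, ∑ k, A k i * A k j = if i = j then 1 else 0)
    (hd : A 0 0 * (A 1 1 * A 2 2 - A 1 2 * A 2 1) - A 0 1 * (A 1 0 * A 2 2 - A 1 2 * A 2 0)
      + A 0 2 * (A 1 0 * A 2 1 - A 1 1 * A 2 0) = 1) : SO3 :=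
  ⟨Matrix.of A, Matrix.mem_specialOrthogonalGroup_iff.mpr ⟨by
    rw [Matrix.mem_orthogonalGroup_iff']
    ext i j
    rw [Matrix.one_apply, ← h i j]
    rfl, by
    rw [Matrix.det_fin_three, ← hd]
    simp only [Matrix.of_apply]
    ring⟩⟩

@[simp] theorem entries_ofEntries (A : Mat3) (h hd) : entries (SO3.ofEntries A h hd) = A := rfl

/-- The trace. -/
def tr (A : Mat3) : ℝ := A 0 0 + A 1 1 + A 2 2

/-- The Cayley coordinates `tan(θ/2) u` of the rotation with axis `u` and angle `θ`. -/
def cayley (A : Mat3) : E 3 :=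
  !₂[(A 2 1 - A 1 2) / (1 + tr A), (A 0 2 - A 2 0) / (1 + tr A), (A 1 0 - A 0 1) / (1 + tr A)]

/-- The entries of the rotation with given Cayley coordinates. -/
def rodriguesEntries (r : E 3) : Mat3 := fun i j =>
  (1 + (r 0 ^ 2 + r 1 ^ 2 + r 2 ^ 2))⁻¹ *
  (!![1 + r 0 ^ 2 - r 1 ^ 2 - r 2 ^ 2, 2 * (r 0 * r 1 - r 2), 2 * (r 0 * r 2 + r 1);
    2 * (r 0 * r 1 + r 2), 1 - r 0 ^ 2 + r 1 ^ 2 - r 2 ^ 2, 2 * (r 1 * r 2 - r 0);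
    2 * (r 0 * r 2 - r 1), 2 * (r 1 * r 2 + r 0), 1 - r 0 ^ 2 - r 1 ^ 2 + r 2 ^ 2] :
    Matrix (Fin 3) (Fin 3) ℝ) i j

/-- The rotation with given Cayley coordinates. -/
def rodrigues (r : E 3) : SO3 :=
  SO3.ofEntries (rodriguesEntries r) (by
    have hD : 1 + (r 0 ^ 2 + r 1 ^ 2 + r 2 ^ 2) ≠ 0 := by positivity
    intro i j
    fin_cases i <;> fin_cases j <;>
      simp [rodriguesEntries, Fin.sum_univ_three] <;> field_simp <;> ring) (by
    have hD : 1 + (r 0 ^ 2 + r 1 ^ 2 + r 2 ^ 2) ≠ 0 := by positivity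
    simp [rodriguesEntries]
    field_simp
    ring)

theorem tr_rodrigues (r : E 3) : 1 + tr (entries (rodrigues r)) ≠ 0 := by
  have hD : 0 < 1 + (r 0 ^ 2 + r 1 ^ 2 + r 2 ^ 2) := by positivity
  have : 1 + tr (entries (rodrigues r)) = 4 * (1 + (r 0 ^ 2 + r 1 ^ 2 + r 2 ^ 2))⁻¹ := by
    simp [rodrigues, tr, rodriguesEntries]
    field_simp
    ring
  rw [this]
  positivity

theorem cayley_rodrigues (r : E 3) : cayley (entries (rodrigues r)) = r := by
  have hD : 1 + (r 0 ^ 2 + r 1 ^ 2 + r 2 ^ 2) ≠ 0 := by positivity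
  have : 1 + tr (entries (rodrigues r)) = 4 * (1 + (r 0 ^ 2 + r 1 ^ 2 + r 2 ^ 2))⁻¹ := by
    simp [rodrigues, tr, rodriguesEntries]
    field_simp
    ring
  ext i
  simp only [cayley, this]
  fin_cases i <;> simp [rodrigues, rodriguesEntries] <;> field_simp <;> ring

theorem rodrigues_cayley (g : SO3) (hg : 1 + tr (entries g) ≠ 0) :
    rodrigues (cayley (entries g)) = g := by
  obtain ⟨c00, c01, c02, c10, c11, c12, c20, c21, c22⟩ := entries_cofactor g
  have col := fun i j => entries_cols g i j
  have row := fun i j => entries_rows g i j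
  simp only [Fin.sum_univ_three] at col row
  have k00 := col 0 0; have k11 := col 1 1; have k22 := col 2 2
  have k01 := col 0 1; have k02 := col 0 2; have k12 := col 1 2
  have r00 := row 0 0; have r11 := row 1 1; have r22 := row 2 2
  have r01 := row 0 1; have r02 := row 0 2; have r12 := row 1 2
  simp at k00 k11 k22 k01 k02 k12 r00 r11 r22 r01 r02 r12
  apply entries_injective
  set A := entries g
  set t := 1 + tr A with ht
  have ht' : t = 1 + (A 0 0 + A 1 1 + A 2 2) := rfl
  -- the squares and products of the components of the antisymmetric part
  have v0 : (A 2 1 - A 1 2) ^ 2 = t * (2 * A 0 0 - t + 2) := by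
    rw [ht']; linear_combination -2 * c00 + r11 + r22 - k00
  have v1 : (A 0 2 - A 2 0) ^ 2 = t * (2 * A 1 1 - t + 2) := by
    rw [ht']; linear_combination -2 * c11 + r00 + r22 - k11
  have v2 : (A 1 0 - A 0 1) ^ 2 = t * (2 * A 2 2 - t + 2) := by
    rw [ht']; linear_combination -2 * c22 + r00 + r11 - k22
  have v01 : (A 2 1 - A 1 2) * (A 0 2 - A 2 0) = (A 0 1 + A 1 0) * t := by
    rw [ht']; linear_combination -k01 - r01 - c10 - c01
  have v02 : (A 2 1 - A 1 2) * (A 1 0 - A 0 1) = (A 0 2 + A 2 0) * t := by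
    rw [ht']; linear_combination -k02 - r02 - c20 - c02
  have v12 : (A 0 2 - A 2 0) * (A 1 0 - A 0 1) = (A 1 2 + A 2 1) * t := by
    rw [ht']; linear_combination -k12 - r12 - c21 - c12
  have hN : t ^ 2 + ((A 2 1 - A 1 2) ^ 2 + (A 0 2 - A 2 0) ^ 2 + (A 1 0 - A 0 1) ^ 2) = 4 * t := by
    rw [v0, v1, v2, ht']; ring
  have hD : 1 + (((A 2 1 - A 1 2) / t) ^ 2 + ((A 0 2 - A 2 0) / t) ^ 2 + ((A 1 0 - A 0 1) / t) ^ 2)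
      = 4 / t := by
    field_simp
    linear_combination hN
  ext i j
  simp only [rodrigues, entries_ofEntries, rodriguesEntries, cayley, ← ht]
  simp only [Matrix.cons_val, hD]
  fin_cases i <;> fin_cases j <;> simp
  all_goals field_simp
  · linear_combination v0 - v1 - v2 + 2 * t * ht'
  · linear_combination 2 * v01
  · linear_combination 2 * v02
  · linear_combination 2 * v01
  · linear_combination v1 - v0 - v2 + 2 * t * ht'
  · linear_combination 2 * v12
  · linear_combination 2 * v02
  · linear_combination 2 * v12
  · linear_combination v2 - v1 - v0 + 2 * t * ht'

theorem contDiff_rodriguesEntries : ContDiff ℝ ∞ rodriguesEntries := by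
  rw [contDiff_pi]
  intro i
  rw [contDiff_pi]
  intro j
  have hD : ∀ r : E 3, 1 + (r 0 ^ 2 + r 1 ^ 2 + r 2 ^ 2) ≠ 0 := fun r => by positivity
  refine ContDiff.mul (ContDiff.inv (by fun_prop) hD) ?_
  fin_cases i <;> fin_cases j <;> simp <;> fun_prop

theorem contDiffAt_cayley {A : Mat3} (hA : 1 + tr A ≠ 0) : ContDiffAt ℝ ∞ cayley A := by
  have h : ∀ i j : Fin 3, ContDiffAt ℝ ∞ (fun A : Mat3 => A i j) A := fun i j => by fun_prop
  have ht : ContDiffAt ℝ ∞ (fun A : Mat3 => 1 + tr A) A := by unfold tr; fun_prop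
  rw [contDiffAt_euclidean]
  intro i
  fin_cases i <;> exact ContDiffAt.div ((h _ _).sub (h _ _)) ht hA

theorem continuous_entries : Continuous entries := isEmbedding_entries.continuous

theorem continuous_tr : Continuous tr := by unfold tr; fun_prop

theorem continuous_rodrigues : Continuous rodrigues :=
  isEmbedding_entries.continuous_iff.mpr contDiff_rodriguesEntries.continuous

/-- The matrix product of arrays. -/
def matMul (A B : Mat3) : Mat3 := fun i j => ∑ k, A i k * B k j

theorem entries_mul' (g h : SO3) : entries (g * h) = matMul (entries g) (entries h) := rfl

theorem contDiff_matMul : ContDiff ℝ ∞ (fun p : Mat3 × Mat3 => matMul p.1 p.2) := by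
  unfold matMul
  fun_prop

instance : IsTopologicalGroup SO3 where
  continuous_mul := isEmbedding_entries.continuous_iff.mpr
    (contDiff_matMul.continuous.comp (continuous_entries.prodMap continuous_entries))
  continuous_inv := by
    have h : Continuous fun A : Mat3 => (fun i j => A j i : Mat3) := by fun_prop
    exact isEmbedding_entries.continuous_iff.mpr (h.comp continuous_entries)

/-- The Cayley coordinates near the rotation `g₀`. -/
def cayleyChart (g₀ : SO3) : OpenPartialHomeomorph SO3 (E 3) where
  toFun g := cayley (entries (g₀⁻¹ * g))
  invFun r := g₀ * rodrigues r
  source := {g | 1 + tr (entries (g₀⁻¹ * g)) ≠ 0}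
  target := univ
  map_source' _ _ := trivial
  map_target' r _ := by simpa using tr_rodrigues r
  left_inv' g hg := by rw [rodrigues_cayley _ hg, mul_inv_cancel_left]
  right_inv' r _ := by rw [inv_mul_cancel_left, cayley_rodrigues]
  open_source := by
    refine isOpen_ne.preimage (f := fun g => 1 + tr (entries (g₀⁻¹ * g))) ?_
    exact continuous_const.add (continuous_tr.comp (continuous_entries.comp
      (continuous_const.mul continuous_id)))
  open_target := isOpen_univ
  continuousOn_toFun := fun g hg => ContinuousAt.continuousWithinAt <|
    ContinuousAt.comp (g := cayley) (contDiffAt_cayley hg).continuousAt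
      (continuous_entries.comp (continuous_const.mul continuous_id)).continuousAt
  continuousOn_invFun := (continuous_const.mul continuous_rodrigues).continuousOn

theorem cayleyChart_compat (g₀ g₁ : SO3) : ContMDiffOn (𝓡 3) (𝓡 3) ∞
    ((cayleyChart g₀).symm ≫ₕ cayleyChart g₁) ((cayleyChart g₀).symm ≫ₕ cayleyChart g₁).source := by
  rw [contMDiffOn_iff_contDiffOn]
  intro r hr
  refine ContDiffAt.contDiffWithinAt ?_
  have hr' : 1 + tr (entries (g₁⁻¹ * (g₀ * rodrigues r))) ≠ 0 := hr.2
  refine ContDiffAt.comp (g := cayley) (f := fun r => entries (g₁⁻¹ * (g₀ * rodrigues r))) r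
    (contDiffAt_cayley hr') ?_
  refine ContDiff.contDiffAt ?_
  exact contDiff_matMul.comp (contDiff_const.prodMk
    (contDiff_matMul.comp (contDiff_const.prodMk contDiff_rodriguesEntries)))

theorem mem_cayleyChart_source (g : SO3) : g ∈ (cayleyChart g).source := by
  change 1 + tr (entries (g⁻¹ * g)) ≠ 0
  rw [inv_mul_cancel]
  simp [tr, entries_one]
  norm_num

instance : ChartedSpace (E 3) SO3 :=
  pullCharted (𝓡 3) (.refl ℝ (E 3)) cayleyChart id mem_cayleyChart_source

instance : IsManifold (𝓡 3) ∞ SO3 :=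
  pullCharted_isManifold _ _ _ mem_cayleyChart_source cayleyChart_compat

theorem contMDiffOn_cayleyChart (g : SO3) :
    ContMDiffOn (𝓡 3) (𝓡 3) ∞ (cayleyChart g) (cayleyChart g).source ∧
      ContMDiffOn (𝓡 3) (𝓡 3) ∞ (cayleyChart g).symm (cayleyChart g).target :=
  pullCharted_contMDiffOn _ _ _ mem_cayleyChart_source cayleyChart_compat g

theorem contMDiff_entries : ContMDiff (𝓡 3) 𝓘(ℝ, Mat3) ∞ entries := by
  intro g
  have h1 : ContMDiffAt (𝓡 3) (𝓡 3) ∞ (cayleyChart g) g :=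
    (contMDiffOn_cayleyChart g).1.contMDiffAt
      ((cayleyChart g).open_source.mem_nhds (mem_cayleyChart_source g))
  have h2 : ContMDiff (𝓡 3) 𝓘(ℝ, Mat3) ∞ (fun r => entries (g * rodrigues r)) :=
    (contDiff_matMul.comp (contDiff_const.prodMk contDiff_rodriguesEntries)).contMDiff
  refine (ContMDiffAt.comp g (g := fun r => entries (g * rodrigues r)) h2.contMDiffAt
    h1).congr_of_eventuallyEq ?_
  filter_upwards [(cayleyChart g).open_source.mem_nhds (mem_cayleyChart_source g)] with x hx
  exact congrArg entries ((cayleyChart g).left_inv hx).symm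

/-- A retraction near `g₀` sends `A` to `g₀` times the rotation with the Cayley parameter of
`g₀⁻¹ A`. -/
theorem hasSmoothRetractions_entries : HasSmoothRetractions (𝓡 3) entries := by
  intro g
  refine ⟨fun A => (cayleyChart g).symm (cayley (matMul (entries g⁻¹) A)), ?_, ?_⟩
  · have h1 : ContMDiff (𝓡 3) (𝓡 3) ∞ (cayleyChart g).symm :=
      contMDiffOn_univ.mp (contMDiffOn_cayleyChart g).2
    refine h1.contMDiffAt.comp (I' := 𝓡 3) _
      (f := fun A => cayley (matMul (entries g⁻¹) A)) (ContDiffAt.contMDiffAt ?_)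
    refine ContDiffAt.comp (g := cayley) (f := fun A => matMul (entries g⁻¹) A) _
      (contDiffAt_cayley (mem_cayleyChart_source g)) ?_
    exact (contDiff_matMul.comp (contDiff_const.prodMk contDiff_id)).contDiffAt
  · filter_upwards [(cayleyChart g).open_source.mem_nhds (mem_cayleyChart_source g)] with x hx
    exact (cayleyChart g).left_inv hx

/-- A map to the rotation group is smooth if its matrix entries are. -/
theorem contMDiffAt_SO3 {EN HN : Type} [NormedAddCommGroup EN] [NormedSpace ℝ EN]
    [TopologicalSpace HN] {J : ModelWithCorners ℝ EN HN} {N : Type} [TopologicalSpace N]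
    [ChartedSpace HN N] {h : N → SO3} {y : N}
    (hs : ContMDiffAt J 𝓘(ℝ, Mat3) ∞ (fun z => entries (h z)) y) : ContMDiffAt J (𝓡 3) ∞ h y :=
  hasSmoothRetractions_entries.contMDiffAt
    (isEmbedding_entries.continuousAt_iff.mpr hs.continuousAt) hs

instance : LieGroup (𝓡 3) ∞ SO3 where
  contMDiff_mul := fun p => contMDiffAt_SO3 <| by
    refine ContMDiffAt.comp p (I' := 𝓘(ℝ, Mat3 × Mat3)) (g := fun p : Mat3 × Mat3 => matMul p.1 p.2)
      (f := fun p : SO3 × SO3 => (entries p.1, entries p.2))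
      contDiff_matMul.contMDiff.contMDiffAt ?_
    exact (contMDiff_entries.comp contMDiff_fst p).prodMk_space
      (contMDiff_entries.comp contMDiff_snd p)
  contMDiff_inv := fun p => contMDiffAt_SO3 <| by
    have h : ContDiff ℝ ∞ fun A : Mat3 => (fun i j => A j i : Mat3) := by fun_prop
    exact ContMDiffAt.comp p (I' := 𝓘(ℝ, Mat3)) (g := fun A : Mat3 => (fun i j => A j i : Mat3))
      (f := entries) h.contMDiff.contMDiffAt contMDiff_entries.contMDiffAt

theorem isSmoothEmbedding_entries :
    IsSmoothEmbedding (𝓡 3) 𝓘(ℝ, Fin 3 → Fin 3 → ℝ) ∞ entries :=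
  ⟨isImmersion_of_retractions contMDiff_entries hasSmoothRetractions_entries, isEmbedding_entries⟩

/-! ### Vector algebra in `ℝ³` -/

theorem inner_eq (x y : E 3) : inner ℝ x y = x 0 * y 0 + x 1 * y 1 + x 2 * y 2 := by
  simp [PiLp.inner_apply, Fin.sum_univ_three, mul_comm]

theorem norm_sq_eq (x : E 3) : ‖x‖ ^ 2 = x 0 ^ 2 + x 1 ^ 2 + x 2 ^ 2 := by
  rw [← real_inner_self_eq_norm_sq, inner_eq]; ring

theorem rot_apply (g : SO3) (x : E 3) (i : Fin 3) :
    (g • x) i = entries g i 0 * x 0 + entries g i 1 * x 1 + entries g i 2 * x 2 := by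
  simp [rot_def, Matrix.mulVec, dotProduct, Fin.sum_univ_three, entries]

theorem ext3 {x y : E 3} (h0 : x 0 = y 0) (h1 : x 1 = y 1) (h2 : x 2 = y 2) : x = y := by
  ext i; fin_cases i <;> assumption

/-- The cross product. -/
def cross (u v : E 3) : E 3 :=
  !₂[u 1 * v 2 - u 2 * v 1, u 2 * v 0 - u 0 * v 2, u 0 * v 1 - u 1 * v 0]

@[simp] theorem cross_zero (u v : E 3) : cross u v 0 = u 1 * v 2 - u 2 * v 1 := rfl
@[simp] theorem cross_one (u v : E 3) : cross u v 1 = u 2 * v 0 - u 0 * v 2 := rfl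
@[simp] theorem cross_two (u v : E 3) : cross u v 2 = u 0 * v 1 - u 1 * v 0 := rfl

theorem rot_cross (g : SO3) (u v : E 3) : g • cross u v = cross (g • u) (g • v) := by
  obtain ⟨c00, c01, c02, c10, c11, c12, c20, c21, c22⟩ := entries_cofactor g
  refine ext3 ?_ ?_ ?_ <;>
    simp only [rot_apply, cross_zero, cross_one, cross_two]
  · linear_combination (u 1 * v 2 - u 2 * v 1) * c00 + (u 2 * v 0 - u 0 * v 2) * c01 +
      (u 0 * v 1 - u 1 * v 0) * c02
  · linear_combination (u 1 * v 2 - u 2 * v 1) * c10 + (u 2 * v 0 - u 0 * v 2) * c11 +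
      (u 0 * v 1 - u 1 * v 0) * c12
  · linear_combination (u 1 * v 2 - u 2 * v 1) * c20 + (u 2 * v 0 - u 0 * v 2) * c21 +
      (u 0 * v 1 - u 1 * v 0) * c22

theorem contDiff_cross : ContDiff ℝ ∞ (fun p : E 3 × E 3 => cross p.1 p.2) := by
  rw [contDiff_euclidean]
  intro i
  fin_cases i <;> simp <;> fun_prop

theorem norm_cross_sq (u v : E 3) :
    ‖cross u v‖ ^ 2 = ‖u‖ ^ 2 * ‖v‖ ^ 2 - inner ℝ u v ^ 2 := by
  simp only [norm_sq_eq, inner_eq, cross_zero, cross_one, cross_two]; ring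

theorem inner_cross_left (u v : E 3) : inner ℝ u (cross u v) = 0 := by
  simp only [inner_eq, cross_zero, cross_one, cross_two]; ring

theorem cross_smul_right (c : ℝ) (u v : E 3) : cross u (c • v) = c • cross u v := by
  refine ext3 ?_ ?_ ?_ <;> simp <;> ring

theorem cross_ne_zero {u v : E 3} (hu : u ≠ 0) (hv : v ≠ 0) (h : inner ℝ u v = 0) :
    cross u v ≠ 0 := by
  intro h0
  have := norm_cross_sq u v
  rw [h0, h] at this
  simp at this
  exact this.elim hu hv

/-- The standard basis vectors of `ℝ³`. -/
def e (i : Fin 3) : E 3 := EuclideanSpace.single i 1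

theorem e_apply (i j : Fin 3) : e i j = if j = i then 1 else 0 := by
  simp [e]

theorem rot_e (g : SO3) (i j : Fin 3) : (g • e j) i = entries g i j := by
  rw [rot_apply]
  fin_cases j <;> simp [e_apply]

theorem SO3.ext_e {g h : SO3} (H : ∀ j, g • e j = h • e j) : g = h := by
  apply entries_injective
  funext i j
  rw [← rot_e, ← rot_e, H]

theorem rot_mul (g h : SO3) (x : E 3) : (g * h) • x = g • h • x := mul_smul g h x

/-! ### Moving frames -/

/-- The vector in the direction of `v`. -/
def unit (v : E 3) : E 3 := ‖v‖⁻¹ • v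

theorem norm_unit {v : E 3} (hv : v ≠ 0) : ‖unit v‖ = 1 := by
  rw [unit, norm_smul, norm_inv, norm_norm, inv_mul_cancel₀ (norm_ne_zero_iff.mpr hv)]

theorem rot_unit (g : SO3) (v : E 3) : g • unit v = unit (g • v) := by
  rw [unit, unit, rot_smul, rot_norm]

theorem unit_of_norm_one {v : E 3} (hv : ‖v‖ = 1) : unit v = v := by simp [unit, hv]

theorem contDiffAt_unit {v : E 3} (hv : v ≠ 0) : ContDiffAt ℝ ∞ unit v :=
  ((contDiffAt_norm ℝ hv).inv (norm_ne_zero_iff.mpr hv)).smul contDiffAt_id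

/-- The entries of the matrix with columns `c × n̂`, `c`, `n̂`, where `n̂` is the direction of
`n` and `c` that of `n × z`. -/
def frameEntries (z n : E 3) : Mat3 := fun i j =>
  ![cross (unit (cross n z)) (unit n) i, unit (cross n z) i, unit n i] j

/-- The rotation whose third column is the direction of `n`, and whose first column is the direction
of the component of `z` normal to `n`, when `z` and `n` are not parallel. -/
def frame (z n : E 3) : SO3 :=
  open Classical in
  if h : cross n z ≠ 0 then
    have hn : n ≠ 0 := by
      rintro rfl
      exact h (ext3 (by simp) (by simp) (by simp))
    have h1 : unit n 0 ^ 2 + unit n 1 ^ 2 + unit n 2 ^ 2 = 1 := by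
      rw [← norm_sq_eq, norm_unit hn, one_pow]
    have h2 : unit (cross n z) 0 ^ 2 + unit (cross n z) 1 ^ 2 + unit (cross n z) 2 ^ 2 = 1 := by
      rw [← norm_sq_eq, norm_unit h, one_pow]
    have h3 : unit n 0 * unit (cross n z) 0 + unit n 1 * unit (cross n z) 1 +
        unit n 2 * unit (cross n z) 2 = 0 := by
      rw [← inner_eq, unit, unit, inner_smul_left, inner_smul_right, inner_cross_left, mul_zero,
        mul_zero]
    SO3.ofEntries (frameEntries z n) (by
      intro i j
      generalize hu : unit n = u at h1 h3
      generalize hv : unit (cross n z) = v at h2 h3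
      fin_cases i <;> fin_cases j <;>
        simp [frameEntries, Fin.sum_univ_three, hu, hv]
      · linear_combination (u 0 ^ 2 + u 1 ^ 2 + u 2 ^ 2) * h2 + h1 -
          (u 0 * v 0 + u 1 * v 1 + u 2 * v 2) * h3
      · ring
      · ring
      · ring
      · linear_combination h2
      · linear_combination h3
      · ring
      · linear_combination h3
      · linear_combination h1) (by
      generalize hu : unit n = u at h1 h3
      generalize hv : unit (cross n z) = v at h2 h3
      simp [frameEntries, hu, hv]
      linear_combination (u 0 ^ 2 + u 1 ^ 2 + u 2 ^ 2) * h2 + h1 -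
          (u 0 * v 0 + u 1 * v 1 + u 2 * v 2) * h3)
  else 1

theorem entries_frame {z n : E 3} (h : cross n z ≠ 0) : entries (frame z n) = frameEntries z n := by
  rw [frame, dif_pos h, entries_ofEntries]

theorem frame_e0 {z n : E 3} (h : cross n z ≠ 0) :
    frame z n • e 0 = cross (unit (cross n z)) (unit n) := by
  ext i; rw [rot_e, entries_frame h]; rfl

theorem frame_e1 {z n : E 3} (h : cross n z ≠ 0) : frame z n • e 1 = unit (cross n z) := by
  ext i; rw [rot_e, entries_frame h]; rfl

theorem frame_e2 {z n : E 3} (h : cross n z ≠ 0) : frame z n • e 2 = unit n := by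
  ext i; rw [rot_e, entries_frame h]; rfl

theorem rot_eq_zero_iff (g : SO3) (v : E 3) : g • v = 0 ↔ v = 0 := by
  rw [← norm_eq_zero, rot_norm, norm_eq_zero]

theorem frame_rot (g : SO3) {z n : E 3} (h : cross n z ≠ 0) :
    frame (g • z) (g • n) = g * frame z n := by
  have h' : cross (g • n) (g • z) ≠ 0 := by
    rwa [← rot_cross, Ne, rot_eq_zero_iff]
  apply SO3.ext_e
  intro j
  rw [rot_mul]
  fin_cases j
  · change frame _ _ • e 0 = g • frame _ _ • e 0
    rw [frame_e0 h, frame_e0 h', rot_cross, rot_unit, rot_unit, rot_cross]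
  · change frame _ _ • e 1 = g • frame _ _ • e 1
    rw [frame_e1 h, frame_e1 h', rot_unit, rot_cross]
  · change frame _ _ • e 2 = g • frame _ _ • e 2
    rw [frame_e2 h, frame_e2 h', rot_unit]

theorem contDiffAt_frameEntries {z n : E 3} (h : cross n z ≠ 0) :
    ContDiffAt ℝ ∞ (fun p : E 3 × E 3 => frameEntries p.1 p.2) (z, n) := by
  have hn : n ≠ 0 := by
    rintro rfl
    exact h (ext3 (by simp) (by simp) (by simp))
  have h1 : ContDiffAt ℝ ∞ (fun p : E 3 × E 3 => unit p.2) (z, n) :=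
    ContDiffAt.comp (z, n) (g := unit) (contDiffAt_unit hn) contDiffAt_snd
  have h2 : ContDiffAt ℝ ∞ (fun p : E 3 × E 3 => unit (cross p.2 p.1)) (z, n) :=
    ContDiffAt.comp (z, n) (g := unit) (f := fun p : E 3 × E 3 => cross p.2 p.1)
      (contDiffAt_unit h)
      ((contDiff_cross.comp (contDiff_snd.prodMk contDiff_fst)).contDiffAt)
  have h3 : ContDiffAt ℝ ∞ (fun p : E 3 × E 3 => cross (unit (cross p.2 p.1)) (unit p.2)) (z, n) :=
    ContDiffAt.comp (z, n) (g := fun p : E 3 × E 3 => cross p.1 p.2)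
      (f := fun p : E 3 × E 3 => (unit (cross p.2 p.1), unit p.2))
      contDiff_cross.contDiffAt (h2.prodMk h1)
  rw [contDiffAt_pi]
  intro i
  rw [contDiffAt_pi]
  intro j
  fin_cases j
  · exact contDiffAt_euclidean.mp h3 i
  · exact contDiffAt_euclidean.mp h2 i
  · exact contDiffAt_euclidean.mp h1 i

/-! ### Jacobi coordinates -/

section Jacobi

variable (m : Fin 3 → ℝ)

/-- The coefficient of the first Jacobi vector. -/
def jacobiA : ℝ := √(m 0 * m 1 / (m 0 + m 1))

/-- The coefficient of the second Jacobi vector. -/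
def jacobiC : ℝ := √(m 2 * (m 0 + m 1 + m 2) / (m 0 + m 1))

/-- The normalized Jacobi vectors of a triple of points with center of mass at the origin: multiples
of the vector from the first point to the second (for `true`), and of the third point
(for `false`). -/
def jacobi (p : Ambient) : Bool → E 3
  | true => jacobiA m • (p.1 1 - p.1 0)
  | false => jacobiC m • p.1 2

/-- The triple with given Jacobi vectors. -/
def unjacobi (z : Bool → E 3) : Fin 3 → E 3 :=
  ![(-(m 2 / (m 0 + m 1)) / jacobiC m) • z false - (m 1 / (m 0 + m 1) / jacobiA m) • z true,
    (-(m 2 / (m 0 + m 1)) / jacobiC m) • z false + (m 0 / (m 0 + m 1) / jacobiA m) • z true,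
    (jacobiC m)⁻¹ • z false]

variable {m} (hm : ∀ a, 0 < m a)
include hm

theorem jacobiA_pos : 0 < jacobiA m := by
  have := hm 0; have := hm 1
  exact Real.sqrt_pos.mpr (by positivity)

theorem jacobiC_pos : 0 < jacobiC m := by
  have := hm 0; have := hm 1; have := hm 2
  exact Real.sqrt_pos.mpr (by positivity)

theorem jacobi_unjacobi (z : Bool → E 3) (n : E 3) (i : Bool) :
    jacobi m (unjacobi m z, n) i = z i := by
  have hA := (jacobiA_pos hm).ne'
  have hC := (jacobiC_pos hm).ne'
  have h0 := hm 0; have h1 := hm 1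
  have h01 : m 0 + m 1 ≠ 0 := by positivity
  ext k
  cases i
  · simp [jacobi, unjacobi]; field_simp
  · simp [jacobi, unjacobi]; field_simp

theorem sum_unjacobi (z : Bool → E 3) : ∑ a, m a • unjacobi m z a = 0 := by
  have hA := (jacobiA_pos hm).ne'
  have hC := (jacobiC_pos hm).ne'
  have h0 := hm 0; have h1 := hm 1
  have h01 : m 0 + m 1 ≠ 0 := by positivity
  ext k
  simp [Fin.sum_univ_three, unjacobi]; field_simp; ring

theorem unjacobi_jacobi (p : Ambient) (hp : ∑ a, m a • p.1 a = 0) :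
    unjacobi m (jacobi m p) = p.1 := by
  have hA := (jacobiA_pos hm).ne'
  have hC := (jacobiC_pos hm).ne'
  have h0 := hm 0; have h1 := hm 1; have h2 := hm 2
  have h01 : m 0 + m 1 ≠ 0 := by positivity
  funext a
  ext k
  have hk := congrArg (fun v : E 3 => v k) hp
  simp [Fin.sum_univ_three] at hk
  fin_cases a
  · simp [jacobi, unjacobi]; field_simp; linear_combination -hk
  · simp [jacobi, unjacobi]; field_simp; linear_combination -hk
  · simp [jacobi, unjacobi]; field_simp

/-- Jacobi coordinates diagonalize the moment of inertia. -/
theorem sum_norm_unjacobi (z : Bool → E 3) :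
    ∑ a, m a * ‖unjacobi m z a‖ ^ 2 = ‖z true‖ ^ 2 + ‖z false‖ ^ 2 := by
  have hA := (jacobiA_pos hm).ne'
  have hC := (jacobiC_pos hm).ne'
  have h0 := hm 0; have h1 := hm 1; have h2 := hm 2
  have h01 : m 0 + m 1 ≠ 0 := by positivity
  have hA2 : jacobiA m ^ 2 = m 0 * m 1 / (m 0 + m 1) := Real.sq_sqrt (by positivity)
  have hC2 : jacobiC m ^ 2 = m 2 * (m 0 + m 1 + m 2) / (m 0 + m 1) := Real.sq_sqrt (by positivity)
  set A := jacobiA m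
  set C := jacobiC m
  have key : ∀ x y : ℝ, m 0 * ((-(m 2 / (m 0 + m 1)) / C) * y - (m 1 / (m 0 + m 1) / A) * x) ^ 2 +
      m 1 * ((-(m 2 / (m 0 + m 1)) / C) * y + (m 0 / (m 0 + m 1) / A) * x) ^ 2 +
      m 2 * (C⁻¹ * y) ^ 2 = x ^ 2 + y ^ 2 := by
    intro x y
    have e1 : m 0 * ((-(m 2 / (m 0 + m 1)) / C) * y - (m 1 / (m 0 + m 1) / A) * x) ^ 2 +
      m 1 * ((-(m 2 / (m 0 + m 1)) / C) * y + (m 0 / (m 0 + m 1) / A) * x) ^ 2 +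
      m 2 * (C⁻¹ * y) ^ 2 = (m 0 * m 1 / (m 0 + m 1)) / A ^ 2 * x ^ 2 +
        (m 2 * (m 0 + m 1 + m 2) / (m 0 + m 1)) / C ^ 2 * y ^ 2 := by
      field_simp; ring
    rw [e1, ← hA2, ← hC2, div_self (by positivity), div_self (by positivity)]; ring
  simp only [Fin.sum_univ_three, norm_sq_eq, unjacobi]
  simp
  linear_combination key (z true 0) (z false 0) + key (z true 1) (z false 1) +
    key (z true 2) (z false 2)

end Jacobi

/-! ### Coordinates on the space of oriented triangles with `I = 1` -/

section Coordinates

variable {m : Fin 3 → ℝ} [hm : Fact (∀ a, 0 < m a)]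

/-- The position of an oriented triangle in the ambient vector space. -/
def S5.val (s : S5 m) : Ambient := s.1.1

/-- The Jacobi vectors. -/
def S5.z (s : S5 m) (i : Bool) : E 3 := jacobi m s.val i

/-- The unit normal. -/
def S5.n (s : S5 m) : E 3 := s.val.2

omit hm in
theorem isEmbedding_S5 : IsEmbedding (S5.val (m := m)) :=
  IsEmbedding.subtypeVal.comp IsEmbedding.subtypeVal

omit hm in
theorem S5.norm_n (s : S5 m) : ‖s.n‖ = 1 := s.1.2.2.1

omit hm in
theorem S5.n_ne_zero (s : S5 m) : s.n ≠ 0 := by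
  rw [← norm_ne_zero_iff, s.norm_n]; exact one_ne_zero

omit hm in
theorem S5.inner_z_n (s : S5 m) (i : Bool) : inner ℝ (s.z i) s.n = 0 := by
  have h := (normal_iff _ _).mp s.1.2.2.2
  have h' : ∀ a, inner ℝ (s.val.1 a) s.n = 0 := h
  cases i
  · simp [S5.z, jacobi, inner_smul_left, h']
  · simp [S5.z, jacobi, inner_smul_left, inner_sub_left, h']

theorem S5.unjacobi_z (s : S5 m) : unjacobi m s.z = s.val.1 :=
  unjacobi_jacobi hm.out s.val s.1.2.1

theorem S5.norm_z (s : S5 m) : ‖s.z true‖ ^ 2 + ‖s.z false‖ ^ 2 = 1 := by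
  rw [← sum_norm_unjacobi hm.out, s.unjacobi_z]
  exact s.2

theorem S5.ext_z {s t : S5 m} (hz : ∀ i, s.z i = t.z i) (hn : s.n = t.n) : s = t := by
  refine isEmbedding_S5.injective (Prod.ext ?_ hn)
  rw [← s.unjacobi_z, ← t.unjacobi_z, funext hz]

omit hm in
theorem S5.rot_z (g : SO3) (s : S5 m) (i : Bool) : (g • s).z i = g • s.z i := by
  have h : ∀ a, (g • s).val.1 a = g • s.val.1 a := fun a => rfl
  have hsub : ∀ x y : E 3, g • (x - y) = g • x - g • y := fun x y => by
    rw [eq_sub_iff_add_eq, ← rot_add, sub_add_cancel]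
  cases i
  · simp only [S5.z, jacobi, h, rot_smul]
  · simp only [S5.z, jacobi, h, rot_smul, hsub]

omit hm in
theorem S5.rot_n (g : SO3) (s : S5 m) : (g • s).n = g • s.n := rfl

/-- The oriented triangle with given Jacobi vectors and normal. -/
def S5.ofJacobi (m : Fin 3 → ℝ) [hm : Fact (∀ a, 0 < m a)] (z : Bool → E 3) (n : E 3)
    (hn : ‖n‖ = 1) (h : ∀ i, inner ℝ (z i) n = 0)
    (hz : ‖z true‖ ^ 2 + ‖z false‖ ^ 2 = 1) : S5 m :=
  ⟨⟨(unjacobi m z, n), sum_unjacobi hm.out z, hn, by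
    rw [normal_iff]
    intro a
    fin_cases a <;> simp [unjacobi, inner_add_left, inner_sub_left, inner_smul_left, h]⟩,
    (sum_norm_unjacobi hm.out z).trans hz⟩

theorem S5.ofJacobi_z (z : Bool → E 3) (n : E 3) (hn h hz) (i : Bool) :
    (S5.ofJacobi m z n hn h hz).z i = z i := jacobi_unjacobi hm.out z n i

theorem S5.ofJacobi_val (z : Bool → E 3) (n : E 3) (hn h hz) :
    (S5.ofJacobi m z n hn h hz).val = (unjacobi m z, n) := rfl

/-! ### The shape map -/

/-- The image `(‖x‖² - ‖y‖², 2 x · y, 2 n · (x × y))` of the Jacobi vectors `x`, `y` under the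
Hopf map, taken in the plane that `n` orients. -/
def shapeVec (z : Bool → E 3) (n : E 3) : E 3 :=
  !₂[‖z true‖ ^ 2 - ‖z false‖ ^ 2, 2 * inner ℝ (z true) (z false),
    2 * inner ℝ n (cross (z true) (z false))]

theorem norm_shapeVec {z : Bool → E 3} {n : E 3} (hn : ‖n‖ = 1) (h : ∀ i, inner ℝ (z i) n = 0)
    (hz : ‖z true‖ ^ 2 + ‖z false‖ ^ 2 = 1) : ‖shapeVec z n‖ = 1 := by
  have h0 := h true
  have h1 := h false
  have hn' : ‖n‖ ^ 2 = 1 := by rw [hn, one_pow]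
  rw [← sq_eq_sq₀ (norm_nonneg _) zero_le_one, norm_sq_eq]
  simp only [shapeVec, Matrix.cons_val]
  simp only [inner_eq, norm_sq_eq, cross_zero, cross_one, cross_two] at *
  set x := z true
  set y := z false
  have gram : (n 0 * (x 1 * y 2 - x 2 * y 1) + n 1 * (x 2 * y 0 - x 0 * y 2) +
      n 2 * (x 0 * y 1 - x 1 * y 0)) ^ 2 =
      (x 0 ^ 2 + x 1 ^ 2 + x 2 ^ 2) * (y 0 ^ 2 + y 1 ^ 2 + y 2 ^ 2) -
        (x 0 * y 0 + x 1 * y 1 + x 2 * y 2) ^ 2 := by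
    linear_combination ((x 0 ^ 2 + x 1 ^ 2 + x 2 ^ 2) * (y 0 ^ 2 + y 1 ^ 2 + y 2 ^ 2) -
        (x 0 * y 0 + x 1 * y 1 + x 2 * y 2) ^ 2) * hn' +
      (2 * (y 0 * n 0 + y 1 * n 1 + y 2 * n 2) * (x 0 * y 0 + x 1 * y 1 + x 2 * y 2) -
        (x 0 * n 0 + x 1 * n 1 + x 2 * n 2) * (y 0 ^ 2 + y 1 ^ 2 + y 2 ^ 2)) * h0 -
      (y 0 * n 0 + y 1 * n 1 + y 2 * n 2) * (x 0 ^ 2 + x 1 ^ 2 + x 2 ^ 2) * h1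
  linear_combination 4 * gram +
    (x 0 ^ 2 + x 1 ^ 2 + x 2 ^ 2 + (y 0 ^ 2 + y 1 ^ 2 + y 2 ^ 2) + 1) * hz

/-- The shape of an oriented triangle as a point of the sphere. -/
def S5.w (s : S5 m) : S2 :=
  ⟨shapeVec s.z s.n, by
    simp [norm_shapeVec s.norm_n s.inner_z_n s.norm_z]⟩

theorem S5.rot_w (g : SO3) (s : S5 m) : (g • s).w = s.w := by
  apply Subtype.ext
  simp only [S5.w, shapeVec, S5.rot_z, S5.rot_n, ← rot_cross, rot_norm, rot_inner]

/-- The sign that distinguishes the two Jacobi vectors in the shape map. -/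
def sgn (i : Bool) : ℝ := if i then 1 else -1

theorem sgn_sq (i : Bool) : sgn i * sgn i = 1 := by cases i <;> simp [sgn]

theorem S5.norm_z_sq (s : S5 m) (i : Bool) : 2 * ‖s.z i‖ ^ 2 = 1 + sgn i * s.w.1 0 := by
  have h := s.norm_z
  cases i <;> simp [S5.w, shapeVec, sgn] <;> linarith

theorem S5.z_ne_zero_iff (s : S5 m) (i : Bool) : s.z i ≠ 0 ↔ 0 < 1 + sgn i * s.w.1 0 := by
  rw [← s.norm_z_sq]
  have := norm_pos_iff (a := s.z i)
  constructor
  · intro h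
    have := this.mpr h
    positivity
  · rintro h h0
    rw [h0] at h
    simp at h

theorem S5.exists_z_ne_zero (s : S5 m) : ∃ i, s.z i ≠ 0 := by
  by_contra! h
  have := s.norm_z
  rw [h, h] at this
  simp at this

theorem exists_sgn_pos (b : S2) : ∃ i, 0 < 1 + sgn i * b.1 0 := by
  rcases le_or_gt 0 (b.1 0) with h | h
  · exact ⟨true, by simp [sgn]; linarith⟩
  · exact ⟨false, by simp [sgn]; linarith⟩

/-! ### Local sections of the shape map -/

/-- The Jacobi vectors of the triangle in the horizontal plane with a given shape, whose `i`-th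
Jacobi vector is a positive multiple of the first basis vector. -/
def secJacobi (i : Bool) (b : E 3) (j : Bool) : E 3 :=
  if j = i then √((1 + sgn i * b 0) / 2) • e 0
  else (b 1 / (2 * √((1 + sgn i * b 0) / 2))) • e 0 +
    (sgn i * b 2 / (2 * √((1 + sgn i * b 0) / 2))) • e 1

theorem inner_secJacobi (i : Bool) (b : E 3) (j : Bool) : inner ℝ (secJacobi i b j) (e 2) = 0 := by
  rw [inner_eq]
  unfold secJacobi
  split_ifs <;> simp [e_apply]

theorem norm_e (i : Fin 3) : ‖e i‖ = 1 := by simp [e]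

theorem norm_secJacobi {i : Bool} {b : E 3} (hb : ‖b‖ = 1) (h : 0 < 1 + sgn i * b 0) :
    ‖secJacobi i b true‖ ^ 2 + ‖secJacobi i b false‖ ^ 2 = 1 := by
  have hb' : b 0 ^ 2 + b 1 ^ 2 + b 2 ^ 2 = 1 := by rw [← norm_sq_eq, hb, one_pow]
  have hα : √((1 + sgn i * b 0) / 2) ^ 2 = (1 + sgn i * b 0) / 2 := Real.sq_sqrt (by positivity)
  have hα0 : √((1 + sgn i * b 0) / 2) ≠ 0 := (Real.sqrt_pos.mpr (by positivity)).ne'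
  have hs := sgn_sq i
  have key : √((1 + sgn i * b 0) / 2) ^ 2 + ((b 1 / (2 * √((1 + sgn i * b 0) / 2))) ^ 2 +
      (sgn i * b 2 / (2 * √((1 + sgn i * b 0) / 2))) ^ 2) = 1 := by
    generalize √((1 + sgn i * b 0) / 2) = α at hα hα0
    field_simp
    linear_combination (4 * (α ^ 2 + (1 + sgn i * b 0) / 2) - 4) * hα + hb' +
      (b 2 ^ 2 + b 0 ^ 2) * hs
  rw [norm_sq_eq, norm_sq_eq, ← key]
  cases i <;> simp [secJacobi, e_apply]
  ring

/-- The section of the shape map over the shapes for which the `i`-th Jacobi vector does not vanish.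
Outside this open set its value has no meaning. -/
def sec (m : Fin 3 → ℝ) [Fact (∀ a, 0 < m a)] (i : Bool) (b : S2) : S5 m :=
  open Classical in
  if h : 0 < 1 + sgn i * b.1 0 then
    S5.ofJacobi m (secJacobi i b.1) (e 2) (norm_e 2) (inner_secJacobi i b.1)
      (norm_secJacobi (by simp) h)
  else
    S5.ofJacobi m (fun j => if j then e 0 else 0) (e 2) (norm_e 2)
      (fun j => by cases j <;> simp [inner_eq, e_apply]) (by simp [norm_e])

theorem sec_z {i : Bool} {b : S2} (h : 0 < 1 + sgn i * b.1 0) (j : Bool) :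
    (sec m i b).z j = secJacobi i b.1 j := by
  rw [sec, dif_pos h, S5.ofJacobi_z]

theorem sec_n (i : Bool) (b : S2) : (sec m i b).n = e 2 := by
  rw [sec]; split_ifs <;> rfl

theorem sec_val {i : Bool} {b : S2} (h : 0 < 1 + sgn i * b.1 0) :
    (sec m i b).val = (unjacobi m (secJacobi i b.1), e 2) := by
  rw [sec, dif_pos h, S5.ofJacobi_val]

theorem sec_w {i : Bool} {b : S2} (h : 0 < 1 + sgn i * b.1 0) : (sec m i b).w = b := by
  have hb : ‖b.1‖ = 1 := by simp
  have hb' : b.1 0 ^ 2 + b.1 1 ^ 2 + b.1 2 ^ 2 = 1 := by rw [← norm_sq_eq, hb, one_pow]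
  have hα : √((1 + sgn i * b.1 0) / 2) ^ 2 = (1 + sgn i * b.1 0) / 2 :=
    Real.sq_sqrt (by positivity)
  have hα0 : √((1 + sgn i * b.1 0) / 2) ≠ 0 := (Real.sqrt_pos.mpr (by positivity)).ne'
  have hn := (sec m i b).norm_z_sq i
  rw [sec_z h] at hn
  have hw0 : (sec m i b).w.1 0 = b.1 0 := by
    have h2 : ‖secJacobi i b.1 i‖ ^ 2 = (1 + sgn i * b.1 0) / 2 := by
      rw [secJacobi, if_pos rfl, norm_smul, norm_e, mul_one, Real.norm_eq_abs, sq_abs, hα]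
    rw [h2] at hn
    have h3 : sgn i * (sec m i b).w.1 0 = sgn i * b.1 0 := by linarith
    have h4 : sgn i ≠ 0 := by cases i <;> simp [sgn]
    exact mul_left_cancel₀ h4 h3
  refine Subtype.ext (ext3 hw0 ?_ ?_)
  · change 2 * inner ℝ ((sec m i b).z true) ((sec m i b).z false) = _
    rw [sec_z h, sec_z h, inner_eq]
    generalize √((1 + sgn i * b.1 0) / 2) = α at hα hα0
    cases i <;> simp [secJacobi, e_apply] <;> field_simp
  · change 2 * inner ℝ (sec m i b).n (cross ((sec m i b).z true) ((sec m i b).z false)) = _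
    rw [sec_n, sec_z h, sec_z h, inner_eq]
    cases i <;> simp [secJacobi, e_apply, sgn] at hα0 ⊢ <;> field_simp

/-- The rotation that carries the horizontal plane, with its first axis, to the plane of the
triangle, with the axis along the `i`-th Jacobi vector. -/
def S5.frame (s : S5 m) (i : Bool) : SO3 := ThreeBody.frame (s.z i) s.n

omit hm in
theorem S5.cross_ne_zero {s : S5 m} {i : Bool} (h : s.z i ≠ 0) : cross s.n (s.z i) ≠ 0 :=
  ThreeBody.cross_ne_zero s.n_ne_zero h (by rw [real_inner_comm]; exact s.inner_z_n i)

omit hm in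
theorem S5.frame_rot {s : S5 m} {i : Bool} (h : s.z i ≠ 0) (g : SO3) :
    (g • s).frame i = g * s.frame i := by
  rw [S5.frame, S5.rot_z, S5.rot_n, ThreeBody.frame_rot g (S5.cross_ne_zero h), S5.frame]

theorem sec_z_ne_zero {i : Bool} {b : S2} (h : 0 < 1 + sgn i * b.1 0) : (sec m i b).z i ≠ 0 := by
  rw [S5.z_ne_zero_iff, sec_w h]; exact h

theorem one_rot (v : E 3) : (1 : SO3) • v = v := one_smul SO3 v

theorem sec_frame {i : Bool} {b : S2} (h : 0 < 1 + sgn i * b.1 0) : (sec m i b).frame i = 1 := by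
  have hc := S5.cross_ne_zero (sec_z_ne_zero (m := m) h)
  have hα0 : 0 < √((1 + sgn i * b.1 0) / 2) := Real.sqrt_pos.mpr (by positivity)
  have h1 : unit (cross (sec m i b).n ((sec m i b).z i)) = e 1 := by
    have : cross (sec m i b).n ((sec m i b).z i) = √((1 + sgn i * b.1 0) / 2) • e 1 := by
      rw [sec_n, sec_z h, secJacobi, if_pos rfl, cross_smul_right]
      congr 1
      refine ext3 ?_ ?_ ?_ <;> simp [e_apply]
    rw [this, unit, norm_smul, norm_e, mul_one, Real.norm_of_nonneg hα0.le, smul_smul,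
      inv_mul_cancel₀ hα0.ne', one_smul]
  have h2 : unit (sec m i b).n = e 2 := by rw [sec_n, unit_of_norm_one (norm_e 2)]
  apply SO3.ext_e
  intro j
  rw [one_rot]
  fin_cases j
  · refine (frame_e0 hc).trans ?_
    rw [h1, h2]
    refine ext3 ?_ ?_ ?_ <;> simp [e_apply]
  · exact (frame_e1 hc).trans h1
  · exact (frame_e2 hc).trans h2

/-- A triangle is determined by its shape and its frame. -/
theorem S5.eq_sec_of_frame_eq_one {s : S5 m} {i : Bool} (h : s.z i ≠ 0) (hf : s.frame i = 1) :
    s = sec m i s.w := by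
  have hc := S5.cross_ne_zero h
  have hw := (s.z_ne_zero_iff i).mp h
  have hn : s.n = e 2 := by
    have := frame_e2 hc
    rw [unit_of_norm_one s.norm_n] at this
    rw [← this]
    change s.frame i • e 2 = e 2
    rw [hf, one_rot]
  have h1 : unit (cross s.n (s.z i)) = e 1 := by
    rw [← frame_e1 hc]
    change s.frame i • e 1 = e 1
    rw [hf, one_rot]
  have hcr : cross s.n (s.z i) = ‖cross s.n (s.z i)‖ • e 1 := by
    rw [← h1, unit, smul_smul, mul_inv_cancel₀ (norm_ne_zero_iff.mpr hc), one_smul]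
  have hz2 : ∀ j, s.z j 2 = 0 := by
    intro j
    have := s.inner_z_n j
    rw [hn, inner_eq] at this
    simpa [e_apply] using this
  have hz1 : s.z i 1 = 0 := by
    have := congrArg (fun v : E 3 => v 0) hcr
    rw [hn] at this
    simpa [e_apply] using this
  have hz0 : 0 ≤ s.z i 0 := by
    have := congrArg (fun v : E 3 => v 1) hcr
    simp only [PiLp.smul_apply, smul_eq_mul, e_apply] at this
    rw [hn] at this
    simp [e_apply] at this
    rw [this]; exact norm_nonneg _
  have hα : √((1 + sgn i * s.w.1 0) / 2) = s.z i 0 := by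
    rw [← s.norm_z_sq, mul_div_cancel_left₀ _ two_ne_zero, norm_sq_eq, hz1, hz2]
    simp [Real.sqrt_sq hz0]
  have hzi : s.z i = s.z i 0 • e 0 := by
    refine ext3 ?_ ?_ ?_ <;> simp [e_apply, hz1, hz2]
  have hz00 : s.z i 0 ≠ 0 := by
    intro h0
    rw [h0, zero_smul] at hzi
    exact h hzi
  have hw1 : s.w.1 1 = 2 * inner ℝ (s.z true) (s.z false) := rfl
  have hw2 : s.w.1 2 = 2 * inner ℝ s.n (cross (s.z true) (s.z false)) := rfl
  rw [inner_eq] at hw1 hw2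
  rw [hn] at hw2
  refine S5.ext_z (fun j => ?_) (by rw [hn, sec_n])
  rw [sec_z hw, secJacobi, hα]
  split_ifs with hji
  · rw [hji]; exact hzi
  · refine ext3 ?_ ?_ ?_
    · rw [hw1]
      cases i <;> cases j <;> first
        | exact absurd rfl hji
        | (simp [e_apply, hz1, hz2]; field_simp)
    · rw [hw2]
      cases i <;> cases j <;> first
        | exact absurd rfl hji
        | (simp [e_apply, sgn, hz1, hz2]; field_simp)
    · simp [e_apply, hz2]

theorem S5.frame_smul_sec {s : S5 m} {i : Bool} (h : s.z i ≠ 0) :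
    s.frame i • sec m i s.w = s := by
  have h' : ((s.frame i)⁻¹ • s).z i ≠ 0 := by
    rw [S5.rot_z, Ne, rot_eq_zero_iff]; exact h
  have := S5.eq_sec_of_frame_eq_one h' (by rw [S5.frame_rot h, inv_mul_cancel])
  rw [S5.rot_w] at this
  rw [← this, smul_inv_smul]

/-- Rotations act freely. -/
theorem S5.rot_left_cancel {g h : SO3} {s : S5 m} (hgh : g • s = h • s) : g = h := by
  obtain ⟨i, hi⟩ := s.exists_z_ne_zero
  have := congrArg (fun t => S5.frame t i) hgh
  simp only [S5.frame_rot hi] at this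
  exact mul_right_cancel this

omit hm in
theorem toShape_rot (g : SO3) (s : S5 m) : toShape (g • s) = toShape s :=
  Quotient.sound ⟨g, rfl⟩

omit hm in
theorem toShape_eq_iff {s t : S5 m} : toShape s = toShape t ↔ ∃ g : SO3, g • t = s := by
  refine ⟨fun h => ?_, fun ⟨g, hg⟩ => hg ▸ toShape_rot g t⟩
  exact Quotient.exact h

theorem w_eq_iff {s t : S5 m} : s.w = t.w ↔ toShape s = toShape t := by
  constructor
  · intro h
    obtain ⟨i, hi⟩ := s.exists_z_ne_zero
    have hi' : t.z i ≠ 0 := by rwa [S5.z_ne_zero_iff, ← h, ← S5.z_ne_zero_iff]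
    rw [← S5.frame_smul_sec hi, ← S5.frame_smul_sec hi', toShape_rot, toShape_rot, h]
  · intro h
    obtain ⟨g, rfl⟩ := toShape_eq_iff.mp h
    exact S5.rot_w g t

end Coordinates

/-! ### Smoothness of the coordinate functions -/

section Smooth

instance : Fact (Module.finrank ℝ (E 3) = 2 + 1) := ⟨finrank_euclideanSpace_fin⟩

theorem contDiff_toLp : ContDiff ℝ ∞ (fun f : Fin 3 → ℝ => (WithLp.toLp 2 f : E 3)) := by
  rw [contDiff_euclidean]
  intro i
  exact contDiff_apply ℝ ℝ i

/-- The action of a matrix on the ambient space. -/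
def matAct (A : Mat3) (p : Ambient) : Ambient :=
  (fun a => WithLp.toLp 2 fun i => ∑ j, A i j * p.1 a j, WithLp.toLp 2 fun i => ∑ j, A i j * p.2 j)

theorem contDiff_matAct : ContDiff ℝ ∞ (fun q : Mat3 × Ambient => matAct q.1 q.2) := by
  refine ContDiff.prodMk ?_ ?_
  · rw [contDiff_pi]
    intro a
    refine contDiff_toLp.comp ?_
    fun_prop
  · refine contDiff_toLp.comp ?_
    fun_prop

theorem contDiff_jacobi (m : Fin 3 → ℝ) (i : Bool) : ContDiff ℝ ∞ (fun p => jacobi m p i) := by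
  cases i <;> simp only [jacobi] <;> fun_prop

theorem contDiff_unjacobi (m : Fin 3 → ℝ) : ContDiff ℝ ∞ (unjacobi m) := by
  rw [contDiff_pi]
  intro a
  fin_cases a <;> simp [unjacobi] <;> fun_prop

theorem contDiff_shapeVec :
    ContDiff ℝ ∞ (fun p : (Bool → E 3) × E 3 => shapeVec p.1 p.2) := by
  have hz : ∀ i, ContDiff ℝ ∞ (fun p : (Bool → E 3) × E 3 => p.1 i) := fun i => by fun_prop
  have hn : ContDiff ℝ ∞ (fun p : (Bool → E 3) × E 3 => p.2) := contDiff_snd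
  rw [contDiff_euclidean]
  intro i
  fin_cases i
  · exact ((hz true).norm_sq ℝ).sub ((hz false).norm_sq ℝ)
  · exact contDiff_const.mul ((hz true).inner ℝ (hz false))
  · exact contDiff_const.mul (hn.inner ℝ (contDiff_cross.comp ((hz true).prodMk (hz false))))

theorem contDiffAt_secJacobi {i : Bool} {b : E 3} (h : 0 < 1 + sgn i * b 0) :
    ContDiffAt ℝ ∞ (secJacobi i) b := by
  have hb : ∀ k, ContDiffAt ℝ ∞ (fun b : E 3 => b k) b := fun k => by fun_prop
  have h1 : (1 + sgn i * b 0) / 2 ≠ 0 := by positivity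
  have hα : ContDiffAt ℝ ∞ (fun b : E 3 => √((1 + sgn i * b 0) / 2)) b :=
    ContDiffAt.sqrt (by fun_prop) h1
  have hα0 : 2 * √((1 + sgn i * b 0) / 2) ≠ 0 := by positivity
  rw [contDiffAt_pi]
  intro j
  unfold secJacobi
  split_ifs
  · exact hα.smul contDiffAt_const
  · exact (((hb 1).div (contDiffAt_const.mul hα) hα0).smul contDiffAt_const).add
      (((contDiffAt_const.mul (hb 2)).div (contDiffAt_const.mul hα) hα0).smul contDiffAt_const)

variable {EN HN : Type} [NormedAddCommGroup EN] [NormedSpace ℝ EN]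
    [TopologicalSpace HN] {J : ModelWithCorners ℝ EN HN} {N : Type} [TopologicalSpace N]
    [ChartedSpace HN N]

theorem smooth_comp {V W : Type} [NormedAddCommGroup V] [NormedSpace ℝ V] [NormedAddCommGroup W]
    [NormedSpace ℝ W] {F : V → W} {h : N → V} {y : N} (hF : ContDiffAt ℝ ∞ F (h y))
    (hh : ContMDiffAt J 𝓘(ℝ, V) ∞ h y) : ContMDiffAt J 𝓘(ℝ, W) ∞ (fun x => F (h x)) y :=
  hF.contMDiffAt.comp y hh

/-- The retraction near a point of the sphere is normalization. -/
theorem hasSmoothRetractions_sphere : HasSmoothRetractions (𝓡 2) (Subtype.val : S2 → E 3) := by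
  intro x
  have hx : ‖x.1‖ = 1 := by simp
  set U : TopologicalSpace.Opens (E 3) := ⟨{v | v ≠ 0}, isOpen_ne⟩
  have hU : ∀ v : U, ‖unit v.1‖ = 1 := fun v => norm_unit v.2
  have h1 : ContMDiff 𝓘(ℝ, E 3) 𝓘(ℝ, E 3) ∞ (fun v : U => unit v.1) := fun v =>
    smooth_comp (contDiffAt_unit v.2) (contMDiff_subtype_val (I := 𝓘(ℝ, E 3)) (n := ∞) v)
  have h2 := ContMDiff.codRestrict_sphere (n := 2) h1 (fun v => by simpa using hU v)
  set r : E 3 → S2 := fun v =>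
    open Classical in if h : v ≠ 0 then ⟨unit v, by simpa using norm_unit h⟩ else x
  have hr : ∀ v (h : v ≠ 0), r v = ⟨unit v, by simpa using norm_unit h⟩ := fun v h => dif_pos h
  have hx0 : x.1 ≠ 0 := by rw [← norm_ne_zero_iff, hx]; exact one_ne_zero
  refine ⟨r, ?_, Filter.Eventually.of_forall fun y => ?_⟩
  · have h3 : ContMDiffAt 𝓘(ℝ, E 3) (𝓡 2) ∞ (fun v : U => r v) ⟨x.1, hx0⟩ := by
      refine (h2 _).congr_of_eventuallyEq (Filter.Eventually.of_forall fun v => ?_)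
      exact hr v.1 v.2
    exact contMDiffAt_subtype_iff.mp h3
  · have hy : ‖y.1‖ = 1 := by simp
    have hy0 : y.1 ≠ 0 := by rw [← norm_ne_zero_iff, hy]; exact one_ne_zero
    rw [hr _ hy0]
    exact Subtype.ext (unit_of_norm_one hy)

theorem contMDiffAt_sphere {h : N → S2} {y : N}
    (hs : ContMDiffAt J 𝓘(ℝ, E 3) ∞ (fun z => (h z).1) y) : ContMDiffAt J (𝓡 2) ∞ h y :=
  hasSmoothRetractions_sphere.contMDiffAt
    (IsEmbedding.subtypeVal.continuousAt_iff.mpr hs.continuousAt) hs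

end Smooth

section Structures

variable {m : Fin 3 → ℝ} [hm : Fact (∀ a, 0 < m a)]

omit hm in
theorem val_rot (g : SO3) (s : S5 m) : (g • s).val = matAct (entries g) s.val := by
  have h : ∀ x : E 3, g • x = WithLp.toLp 2 fun i => ∑ j, entries g i j * x j := fun x => rfl
  exact Prod.ext (funext fun a => h _) (h _)

omit hm in
theorem continuous_val : Continuous (S5.val (m := m)) := isEmbedding_S5.continuous

omit hm in
theorem continuous_rot : Continuous (fun p : SO3 × S5 m => p.1 • p.2) := by
  rw [isEmbedding_S5.continuous_iff]
  have : S5.val ∘ (fun p : SO3 × S5 m => p.1 • p.2) =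
      (fun q : Mat3 × Ambient => matAct q.1 q.2) ∘ Prod.map entries S5.val :=
    funext fun p => val_rot p.1 p.2
  rw [this]
  exact contDiff_matAct.continuous.comp (continuous_entries.prodMap continuous_val)

omit hm in
instance : ContinuousSMul SO3 (S5 m) := ⟨continuous_rot⟩

omit hm in
theorem continuous_z (i : Bool) : Continuous (fun s : S5 m => s.z i) :=
  (contDiff_jacobi m i).continuous.comp continuous_val

omit hm in
theorem continuous_n : Continuous (fun s : S5 m => s.n) := continuous_snd.comp continuous_val

theorem continuous_w : Continuous (S5.w (m := m)) := by
  have h : Continuous (fun s : S5 m => (fun i => s.z i, s.n)) :=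
    (continuous_pi continuous_z).prodMk continuous_n
  exact Continuous.subtype_mk (contDiff_shapeVec.continuous.comp h) _

/-- The frame as a function on the ambient space. -/
def frameAmbient (m : Fin 3 → ℝ) (i : Bool) (p : Ambient) : Mat3 := frameEntries (jacobi m p i) p.2

omit hm in
theorem entries_frame_eq {s : S5 m} {i : Bool} (h : s.z i ≠ 0) :
    entries (s.frame i) = frameAmbient m i s.val := entries_frame (S5.cross_ne_zero h)

omit hm in
theorem contDiffAt_frameAmbient {s : S5 m} {i : Bool} (h : s.z i ≠ 0) :
    ContDiffAt ℝ ∞ (frameAmbient m i) s.val :=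
  ContDiffAt.comp s.val (g := fun p : E 3 × E 3 => frameEntries p.1 p.2)
    (f := fun p : Ambient => (jacobi m p i, p.2))
    (contDiffAt_frameEntries (S5.cross_ne_zero h))
    ((contDiff_jacobi m i).contDiffAt.prodMk contDiffAt_snd)

omit hm in
theorem isOpen_z_ne_zero (i : Bool) : IsOpen {s : S5 m | s.z i ≠ 0} :=
  isOpen_ne.preimage (continuous_z i)

omit hm in
theorem continuousAt_frame {s : S5 m} {i : Bool} (h : s.z i ≠ 0) :
    ContinuousAt (fun s : S5 m => s.frame i) s := by
  rw [isEmbedding_entries.continuousAt_iff]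
  refine ContinuousAt.congr (ContinuousAt.comp (g := frameAmbient m i)
    (contDiffAt_frameAmbient h).continuousAt continuous_val.continuousAt) ?_
  filter_upwards [(isOpen_z_ne_zero i).mem_nhds h] with t ht
  exact (entries_frame_eq ht).symm

theorem isOpen_sgn_pos (i : Bool) : IsOpen {b : E 3 | 0 < 1 + sgn i * b 0} :=
  isOpen_lt continuous_const (by fun_prop)

theorem isOpen_sgn_pos' (i : Bool) : IsOpen {b : S2 | 0 < 1 + sgn i * b.1 0} :=
  (isOpen_sgn_pos i).preimage continuous_subtype_val

/-- The shape vector as a function on the ambient space. -/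
def shapeAmbient (m : Fin 3 → ℝ) (p : Ambient) : E 3 := shapeVec (jacobi m p) p.2

omit hm in
theorem contDiff_shapeAmbient : ContDiff ℝ ∞ (shapeAmbient m) := by
  have h0 : ContDiff ℝ ∞ (fun p : Ambient => jacobi m p) := by
    rw [contDiff_pi]
    exact contDiff_jacobi m
  have h : ContDiff ℝ ∞ (fun p : Ambient => (jacobi m p, p.2)) := h0.prodMk contDiff_snd
  have h2 := ContDiff.comp (g := fun p : (Bool → E 3) × E 3 => shapeVec p.1 p.2)
    contDiff_shapeVec h
  exact h2

/-- The section as a function on the ambient space. -/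
def secAmbient (m : Fin 3 → ℝ) (i : Bool) (b : E 3) : Ambient := (unjacobi m (secJacobi i b), e 2)

omit hm in
theorem contDiffAt_secAmbient {i : Bool} {b : E 3} (h : 0 < 1 + sgn i * b 0) :
    ContDiffAt ℝ ∞ (secAmbient m i) b :=
  ((contDiff_unjacobi m).contDiffAt.comp b (contDiffAt_secJacobi h)).prodMk contDiffAt_const

theorem continuousAt_sec {i : Bool} {b : S2} (h : 0 < 1 + sgn i * b.1 0) :
    ContinuousAt (sec m i) b := by
  rw [isEmbedding_S5.continuousAt_iff]
  refine ContinuousAt.congr (ContinuousAt.comp (g := secAmbient m i) (f := Subtype.val)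
    (contDiffAt_secAmbient h).continuousAt continuous_subtype_val.continuousAt) ?_
  filter_upwards [(isOpen_sgn_pos' i).mem_nhds h] with t ht
  exact (sec_val ht).symm

/-! ### The shape space as a sphere -/

omit hm in
theorem continuous_toShape : Continuous (toShape (m := m)) := continuous_quotient_mk'

/-- The shape space is homeomorphic to the sphere. -/
def shapeHomeo : Shape m ≃ₜ S2 where
  toFun := Quotient.lift S5.w fun _ _ h => w_eq_iff.mpr (Quotient.sound h)
  invFun b := toShape (sec m (exists_sgn_pos b).choose b)
  left_inv := by
    rintro ⟨s⟩
    exact w_eq_iff.mp (sec_w (exists_sgn_pos s.w).choose_spec)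
  right_inv b := sec_w (exists_sgn_pos b).choose_spec
  continuous_toFun := continuous_w.quotient_lift _
  continuous_invFun := by
    rw [continuous_iff_continuousAt]
    intro b
    obtain ⟨i, hi⟩ := exists_sgn_pos b
    refine ContinuousAt.congr (ContinuousAt.comp (g := toShape) (f := sec m i)
      continuous_toShape.continuousAt (continuousAt_sec hi)) ?_
    filter_upwards [(isOpen_sgn_pos' i).mem_nhds hi] with c hc
    refine w_eq_iff.mp ((sec_w hc).trans ?_)
    exact (sec_w (exists_sgn_pos c).choose_spec).symm

instance : ChartedSpace (E 2) (Shape m) := homeoCharted (𝓡 2) (.refl ℝ (E 2)) shapeHomeo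

instance : IsManifold (𝓡 2) ∞ (Shape m) := homeoCharted_isManifold _ shapeHomeo

/-- The shape space is diffeomorphic to the sphere. -/
def shapeDiffeo : Shape m ≃ₘ⟮𝓡 2, 𝓡 2⟯ S2 := homeoCharted_diffeomorph (.refl ℝ (E 2)) shapeHomeo

theorem shapeDiffeo_toShape (s : S5 m) : shapeDiffeo (toShape s) = s.w := rfl

theorem contMDiff_shape : ContMDiff (𝓡 2) 𝓘(ℝ, E 3) ∞ (fun b : Shape m => (shapeDiffeo b).1) :=
  contMDiff_coe_sphere.comp shapeDiffeo.contMDiff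

/-- The shapes for which the `i`-th Jacobi vector does not vanish. -/
def dom (m : Fin 3 → ℝ) [Fact (∀ a, 0 < m a)] (i : Bool) : Set (Shape m) :=
  {b | 0 < 1 + sgn i * (shapeDiffeo b).1 0}

theorem isOpen_dom (i : Bool) : IsOpen (dom m i) :=
  (isOpen_sgn_pos i).preimage contMDiff_shape.continuous

theorem exists_mem_dom (b : Shape m) : ∃ i, b ∈ dom m i := exists_sgn_pos _

theorem toShape_mem_dom {s : S5 m} {i : Bool} : toShape s ∈ dom m i ↔ s.z i ≠ 0 := by
  rw [S5.z_ne_zero_iff]; rfl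

/-- The local sections of `S̃⁵ → S`. -/
def localSection (i : Bool) (b : Shape m) : S5 m := sec m i (shapeDiffeo b)

theorem toShape_section {i : Bool} {b : Shape m} (h : b ∈ dom m i) :
    toShape (localSection i b) = b :=
  shapeDiffeo.injective (sec_w h)

theorem section_z_ne_zero {i : Bool} {b : Shape m} (h : b ∈ dom m i) : (localSection i b).z i ≠ 0 :=
  sec_z_ne_zero h

theorem section_frame {i : Bool} {b : Shape m} (h : b ∈ dom m i) : (localSection i b).frame i = 1 :=
  sec_frame h

theorem frame_smul_section {s : S5 m} {i : Bool} (h : s.z i ≠ 0) :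
    s.frame i • localSection i (toShape s) = s := S5.frame_smul_sec h

theorem contMDiffAt_val_section {i : Bool} {b : Shape m} (h : b ∈ dom m i) :
    ContMDiffAt (𝓡 2) 𝓘(ℝ, Ambient) ∞ (fun b : Shape m => (localSection i b).val) b := by
  refine (smooth_comp (F := secAmbient m i) (h := fun b : Shape m => (shapeDiffeo b).1)
    (contDiffAt_secAmbient h)
    (contMDiff_shape b)).congr_of_eventuallyEq ?_
  filter_upwards [(isOpen_dom i).mem_nhds h] with c hc
  exact sec_val hc

theorem continuousAt_section {i : Bool} {b : Shape m} (h : b ∈ dom m i) :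
    ContinuousAt (localSection (m := m) i) b :=
  isEmbedding_S5.continuousAt_iff.mpr (contMDiffAt_val_section h).continuousAt

/-! ### The principal bundle -/

/-- The local trivialization of `S̃⁵ → S` by the shape and the frame of a triangle. -/
def trivS5 (i : Bool) : OpenPartialHomeomorph (S5 m) (Shape m × SO3) where
  toFun s := (toShape s, s.frame i)
  invFun p := p.2 • localSection i p.1
  source := {s | s.z i ≠ 0}
  target := dom m i ×ˢ univ
  map_source' _ hs := ⟨toShape_mem_dom.mpr hs, trivial⟩
  map_target' p hp := by
    change (p.2 • localSection i p.1).z i ≠ 0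
    rw [← toShape_mem_dom, toShape_rot, toShape_section hp.1]; exact hp.1
  left_inv' _ hs := frame_smul_section hs
  right_inv' p hp := by
    refine Prod.ext ?_ ?_
    · exact (toShape_rot _ _).trans (toShape_section hp.1)
    · change (p.2 • localSection i p.1).frame i = p.2
      rw [S5.frame_rot (section_z_ne_zero hp.1), section_frame hp.1, mul_one]
  open_source := isOpen_z_ne_zero i
  open_target := (isOpen_dom i).prod isOpen_univ
  continuousOn_toFun _ hs :=
    (continuous_toShape.continuousAt.prodMk (continuousAt_frame hs)).continuousWithinAt
  continuousOn_invFun p hp := ContinuousAt.continuousWithinAt <|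
    continuousAt_snd.smul ((continuousAt_section hp.1).comp continuousAt_fst)

theorem contMDiffAt_val_trivS5_symm {i : Bool} {p : Shape m × SO3} (hp : p.1 ∈ dom m i) :
    ContMDiffAt ((𝓡 2).prod (𝓡 3)) 𝓘(ℝ, Ambient) ∞
      (fun p : Shape m × SO3 => (p.2 • localSection i p.1).val) p := by
  have h1 : ContMDiffAt ((𝓡 2).prod (𝓡 3)) 𝓘(ℝ, Ambient) ∞
      (fun p : Shape m × SO3 => (localSection i p.1).val) p :=
    (contMDiffAt_val_section hp).comp p contMDiffAt_fst
  have h2 : ContMDiffAt ((𝓡 2).prod (𝓡 3)) 𝓘(ℝ, Mat3) ∞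
      (fun p : Shape m × SO3 => entries p.2) p :=
    (contMDiff_entries _).comp p contMDiffAt_snd
  simp only [val_rot]
  exact smooth_comp (F := fun q : Mat3 × Ambient => matAct q.1 q.2)
    contDiff_matAct.contDiffAt (h2.prodMk_space h1)

omit hm in
theorem contMDiffAt_frame_of_val {EN HN : Type} [NormedAddCommGroup EN] [NormedSpace ℝ EN]
    [TopologicalSpace HN] {J : ModelWithCorners ℝ EN HN} {N : Type} [TopologicalSpace N]
    [ChartedSpace HN N] {h : N → S5 m} {y : N} {i : Bool} (hy : (h y).z i ≠ 0)
    (hh : ContMDiffAt J 𝓘(ℝ, Ambient) ∞ (fun x => (h x).val) y) :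
    ContMDiffAt J (𝓡 3) ∞ (fun x => (h x).frame i) y := by
  refine contMDiffAt_SO3 ?_
  refine (smooth_comp (F := frameAmbient m i) (h := fun x => (h x).val) (contDiffAt_frameAmbient hy)
    hh).congr_of_eventuallyEq ?_
  have hc : ContinuousAt h y := isEmbedding_S5.continuousAt_iff.mpr hh.continuousAt
  filter_upwards [hc.eventually ((isOpen_z_ne_zero i).mem_nhds hy)] with x hx
  exact entries_frame_eq hx

theorem trivS5_compat (i j : Bool) : ContMDiffOn ((𝓡 2).prod (𝓡 3)) ((𝓡 2).prod (𝓡 3)) ∞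
    ((trivS5 (m := m) i).symm ≫ₕ trivS5 j) ((trivS5 (m := m) i).symm ≫ₕ trivS5 j).source := by
  intro p hp
  rw [OpenPartialHomeomorph.trans_source] at hp
  have hp1 : p.1 ∈ dom m i := hp.1.1
  have hp2' : (p.2 • localSection i p.1).z j ≠ 0 := hp.2
  have h1 : ContMDiffAt ((𝓡 2).prod (𝓡 3)) (𝓡 3) ∞
      (fun p : Shape m × SO3 => (p.2 • localSection i p.1).frame j) p :=
    contMDiffAt_frame_of_val (h := fun p : Shape m × SO3 => p.2 • localSection i p.1) hp2'
      (contMDiffAt_val_trivS5_symm hp1)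
  have h2 : ContMDiffAt ((𝓡 2).prod (𝓡 3)) ((𝓡 2).prod (𝓡 3)) ∞
      (fun p : Shape m × SO3 => (p.1, (p.2 • localSection i p.1).frame j)) p :=
    contMDiffAt_fst.prodMk h1
  refine (h2.congr_of_eventuallyEq ?_).contMDiffWithinAt
  filter_upwards [((isOpen_dom i).prod isOpen_univ).mem_nhds ⟨hp1, trivial⟩] with q hq
  exact Prod.ext ((toShape_rot _ _).trans (toShape_section hq.1)) rfl

/-- An index of a Jacobi vector that does not vanish. -/
def S5.index (s : S5 m) : Bool := s.exists_z_ne_zero.choose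

theorem S5.index_spec (s : S5 m) : s ∈ (trivS5 (m := m) s.index).source :=
  s.exists_z_ne_zero.choose_spec

/-- The identification `ℝᵃ × ℝᵇ = ℝᵃ⁺ᵇ`. -/
def sumEquiv (a b : ℕ) : (E a × E b) ≃L[ℝ] E (a + b) :=
  ContinuousLinearEquiv.ofFinrankEq (by simp)

instance : ChartedSpace (E 5) (S5 m) :=
  pullCharted ((𝓡 2).prod (𝓡 3)) (sumEquiv 2 3) trivS5 S5.index S5.index_spec

instance : IsManifold (𝓡 5) ∞ (S5 m) :=
  pullCharted_isManifold (sumEquiv 2 3) trivS5 S5.index S5.index_spec trivS5_compat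

theorem contMDiffOn_trivS5 (i : Bool) :
    ContMDiffOn (𝓡 5) ((𝓡 2).prod (𝓡 3)) ∞ (trivS5 (m := m) i) (trivS5 (m := m) i).source ∧
      ContMDiffOn ((𝓡 2).prod (𝓡 3)) (𝓡 5) ∞ (trivS5 (m := m) i).symm
        (trivS5 (m := m) i).target :=
  pullCharted_contMDiffOn (sumEquiv 2 3) trivS5 S5.index S5.index_spec trivS5_compat i

theorem contMDiff_toShape : ContMDiff (𝓡 5) (𝓡 2) ∞ (toShape (m := m)) := by
  intro s
  obtain ⟨i, hi⟩ := s.exists_z_ne_zero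
  exact contMDiffAt_fst.comp s
    ((contMDiffOn_trivS5 i).1.contMDiffAt ((trivS5 i).open_source.mem_nhds hi))

theorem contMDiff_val : ContMDiff (𝓡 5) 𝓘(ℝ, Ambient) ∞ (S5.val (m := m)) := by
  intro s
  obtain ⟨i, hi⟩ := s.exists_z_ne_zero
  have h1 := (contMDiffOn_trivS5 i).1.contMDiffAt ((trivS5 i).open_source.mem_nhds hi)
  refine ((contMDiffAt_val_trivS5_symm (toShape_mem_dom.mpr hi)).comp s h1).congr_of_eventuallyEq ?_
  filter_upwards [(trivS5 i).open_source.mem_nhds hi] with t ht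
  exact congrArg S5.val (frame_smul_section ht).symm

theorem contMDiffAt_smul_section {i : Bool} {p : Shape m × SO3} (hp : p.1 ∈ dom m i) :
    ContMDiffAt ((𝓡 2).prod (𝓡 3)) (𝓡 5) ∞
      (fun p : Shape m × SO3 => p.2 • localSection i p.1) p :=
  (contMDiffOn_trivS5 i).2.contMDiffAt ((trivS5 i).open_target.mem_nhds ⟨hp, trivial⟩)

/-- A retraction near `s` rebuilds the triangle from the local trivialization, whose two components
are smooth functions on the ambient space. -/
theorem hasSmoothRetractions_val : HasSmoothRetractions (𝓡 5) (S5.val (m := m)) := by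
  intro s
  obtain ⟨i, hi⟩ := s.exists_z_ne_zero
  obtain ⟨r, hr, hr'⟩ := hasSmoothRetractions_sphere s.w
  obtain ⟨ρ, hρ, hρ'⟩ := hasSmoothRetractions_entries (s.frame i)
  have h1 : ContMDiffAt 𝓘(ℝ, Ambient) (𝓡 2) ∞ (fun p => r (shapeAmbient m p)) s.val := by
    have h : ContMDiffAt 𝓘(ℝ, E 3) (𝓡 2) ∞ r (shapeAmbient m s.val) := hr
    exact h.comp s.val contDiff_shapeAmbient.contMDiff.contMDiffAt
  have h2 : ContMDiffAt 𝓘(ℝ, Ambient) (𝓡 3) ∞ (fun p => ρ (frameAmbient m i p)) s.val := by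
    have h : ContMDiffAt 𝓘(ℝ, Mat3) (𝓡 3) ∞ ρ (frameAmbient m i s.val) := by
      rw [← entries_frame_eq hi]
      exact hρ
    exact h.comp s.val (contDiffAt_frameAmbient hi).contMDiffAt
  have h3 : ContMDiffAt 𝓘(ℝ, Ambient) ((𝓡 2).prod (𝓡 3)) ∞
      (fun p => (shapeDiffeo.symm (r (shapeAmbient m p)), ρ (frameAmbient m i p))) s.val :=
    ((shapeDiffeo (m := m)).symm.contMDiff.contMDiffAt.comp _ h1).prodMk h2
  have hrw : ∀ t : S5 m, shapeAmbient m t.val = t.w.1 := fun t => rfl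
  have e1 : shapeDiffeo.symm (r (shapeAmbient m s.val)) = toShape s := by
    rw [hrw, hr'.self_of_nhds, ← shapeDiffeo_toShape, shapeDiffeo.symm_apply_apply]
  have h4 : shapeDiffeo.symm (r (shapeAmbient m s.val)) ∈ dom m i := by
    rw [e1]; exact toShape_mem_dom.mpr hi
  have h5 : ContMDiffAt 𝓘(ℝ, Ambient) (𝓡 5) ∞ (fun p =>
      ρ (frameAmbient m i p) • localSection i (shapeDiffeo.symm (r (shapeAmbient m p)))) s.val :=
    ContMDiffAt.comp s.val (g := fun p : Shape m × SO3 => p.2 • localSection i p.1)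
      (contMDiffAt_smul_section h4) h3
  have h6 : ∀ᶠ t : S5 m in 𝓝 s, ρ (frameAmbient m i t.val) •
      localSection i (shapeDiffeo.symm (r (shapeAmbient m t.val))) = t := by
    filter_upwards [(isOpen_z_ne_zero i).mem_nhds hi, continuous_w.continuousAt.eventually hr',
      (continuousAt_frame hi).eventually hρ'] with t h1 h2 h3
    rw [← entries_frame_eq h1, hrw, h2, h3, ← shapeDiffeo_toShape, shapeDiffeo.symm_apply_apply]
    exact frame_smul_section h1
  exact ⟨_, h5, h6⟩

/-- A map to the space of oriented triangles is smooth if it is smooth as a map to the ambient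
space. -/
theorem contMDiffAt_S5 {EN HN : Type} [NormedAddCommGroup EN] [NormedSpace ℝ EN]
    [TopologicalSpace HN] {J : ModelWithCorners ℝ EN HN} {N : Type} [TopologicalSpace N]
    [ChartedSpace HN N] {h : N → S5 m} {y : N}
    (hs : ContMDiffAt J 𝓘(ℝ, Ambient) ∞ (fun z => (h z).val) y) : ContMDiffAt J (𝓡 5) ∞ h y :=
  hasSmoothRetractions_val.contMDiffAt
    (isEmbedding_S5.continuousAt_iff.mpr hs.continuousAt) hs

theorem isSmoothEmbedding_val : IsSmoothEmbedding (𝓡 5) 𝓘(ℝ, Ambient) ∞ (S5.val (m := m)) :=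
  ⟨isImmersion_of_retractions contMDiff_val hasSmoothRetractions_val, isEmbedding_S5⟩

theorem contMDiffAt_frame {s : S5 m} {i : Bool} (h : s.z i ≠ 0) :
    ContMDiffAt (𝓡 5) (𝓡 3) ∞ (fun s : S5 m => s.frame i) s :=
  contMDiffAt_frame_of_val h contMDiff_val.contMDiffAt

theorem contMDiff_rot :
    ContMDiff ((𝓡 3).prod (𝓡 5)) (𝓡 5) ∞ (fun p : SO3 × S5 m => p.1 • p.2) := by
  intro p
  refine contMDiffAt_S5 ?_
  simp only [val_rot]
  exact smooth_comp (F := fun q : Mat3 × Ambient => matAct q.1 q.2) contDiff_matAct.contDiffAt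
    (((contMDiff_entries _).comp p contMDiffAt_fst).prodMk_space
      ((contMDiff_val _).comp p contMDiffAt_snd))

theorem contMDiffAt_section {i : Bool} {b : Shape m} (h : b ∈ dom m i) :
    ContMDiffAt (𝓡 2) (𝓡 5) ∞ (localSection (m := m) i) b :=
  contMDiffAt_S5 (contMDiffAt_val_section h)

end Structures

/-! ### Triangles of arbitrary size -/

/-- The positive half-line, as an open submanifold of `ℝ`. -/
abbrev PosR : TopologicalSpace.Opens ℝ := ⟨Set.Ioi 0, isOpen_Ioi⟩

theorem hasSmoothRetractions_PosR :
    HasSmoothRetractions 𝓘(ℝ, ℝ) (Subtype.val : PosR → ℝ) := by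
  intro t
  set r : ℝ → PosR := fun x => open Classical in if h : 0 < x then ⟨x, h⟩ else t
  have hr : ∀ s : PosR, r s.1 = s := fun s => dif_pos s.2
  refine ⟨r, ?_, Filter.Eventually.of_forall hr⟩
  have h : ContMDiffAt 𝓘(ℝ, ℝ) 𝓘(ℝ, ℝ) ∞ (fun s : PosR => r s) t := by
    simp only [hr]
    exact contMDiffAt_id
  exact contMDiffAt_subtype_iff.mp h

section Star

variable {m : Fin 3 → ℝ}

/-- The position of an oriented triangle in the ambient vector space. -/
def OTriStar.val (x : OTriStar m) : Ambient := x.1.1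

theorem isEmbedding_OTriStar : IsEmbedding (OTriStar.val (m := m)) :=
  IsEmbedding.subtypeVal.comp IsEmbedding.subtypeVal

theorem dilate_dilate (c d : ℝ) (x : OTri m) : dilate c (dilate d x) = dilate (c * d) x :=
  Subtype.ext (Prod.ext (mul_smul c d x.1.1).symm rfl)

theorem dilate_one (x : OTri m) : dilate 1 x = x :=
  Subtype.ext (Prod.ext (one_smul ℝ x.1.1) rfl)

theorem rot_dilate (g : SO3) (c : ℝ) (x : OTri m) : g • dilate c x = dilate c (g • x) :=
  Subtype.ext (Prod.ext (funext fun a => rot_smul g c (x.1.1 a)) rfl)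

/-- The moment of inertia on the ambient space. -/
def inertiaAmbient (m : Fin 3 → ℝ) (p : Ambient) : ℝ := ∑ a, m a * ‖p.1 a‖ ^ 2

theorem contDiff_inertiaAmbient : ContDiff ℝ ∞ (inertiaAmbient m) := by
  refine ContDiff.sum fun a _ => contDiff_const.mul ?_
  have h : ContDiff ℝ ∞ (fun p : Ambient => p.1 a) := by fun_prop
  exact h.norm_sq ℝ

variable [hm : Fact (∀ a, 0 < m a)]

theorem inertia_pos (x : OTriStar m) : 0 < inertia x.1 := by
  obtain ⟨a, ha⟩ := Function.ne_iff.mp x.2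
  have h0 : ∀ b ∈ Finset.univ, 0 ≤ m b * ‖x.1.1.1 b‖ ^ 2 := fun b _ =>
    mul_nonneg (hm.out b).le (sq_nonneg _)
  refine Finset.sum_pos' h0 ⟨a, Finset.mem_univ _, mul_pos (hm.out a) ?_⟩
  exact pow_pos (norm_pos_iff.mpr ha) 2

/-- The triangle with `I = 1` that is homothetic to a given one. -/
def OTriStar.normalize (x : OTriStar m) : S5 m :=
  ⟨dilate (√(inertia x.1))⁻¹ x.1, by
    rw [inertia_dilate, inv_pow, Real.sq_sqrt (inertia_pos x).le,
      inv_mul_cancel₀ (inertia_pos x).ne']⟩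

omit hm in
theorem dilate_ne_zero {c : ℝ} (hc : c ≠ 0) (s : S5 m) : (dilate c s.1).1.1 ≠ 0 :=
  smul_ne_zero hc s.ne_zero

/-- A triangle is determined by its homothety class and its moment of inertia. -/
def starHomeo : OTriStar m ≃ₜ S5 m × PosR where
  toFun x := (x.normalize, ⟨inertia x.1, inertia_pos x⟩)
  invFun p := ⟨dilate (√p.2.1) p.1.1, dilate_ne_zero (Real.sqrt_pos.mpr p.2.2).ne' _⟩
  left_inv x := by
    refine Subtype.ext ?_
    change dilate _ (dilate _ x.1) = x.1
    rw [dilate_dilate, mul_inv_cancel₀ (Real.sqrt_pos.mpr (inertia_pos x)).ne', dilate_one]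
  right_inv p := by
    have h0 : 0 < p.2.1 := p.2.2
    have h : inertia (dilate (√p.2.1) p.1.1) = p.2.1 := by
      rw [inertia_dilate, Real.sq_sqrt h0.le, p.1.2, mul_one]
    refine Prod.ext (Subtype.ext ?_) (Subtype.ext h)
    change dilate (√(inertia (dilate (√p.2.1) p.1.1)))⁻¹ (dilate (√p.2.1) p.1.1) = p.1.1
    rw [h, dilate_dilate, inv_mul_cancel₀ (Real.sqrt_pos.mpr h0).ne', dilate_one]
  continuous_toFun := by
    have hv : Continuous (OTriStar.val (m := m)) := isEmbedding_OTriStar.continuous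
    have hI : Continuous (fun x : OTriStar m => inertia x.1) :=
      contDiff_inertiaAmbient.continuous.comp hv
    refine Continuous.prodMk ?_ (hI.subtype_mk _)
    rw [isEmbedding_S5.continuous_iff]
    have h1 : Continuous (fun x : OTriStar m => (√(inertia x.1))⁻¹ • x.val.1) :=
      ((Real.continuous_sqrt.comp hI).inv₀ fun x => (Real.sqrt_pos.mpr (inertia_pos x)).ne').smul
        (continuous_fst.comp hv)
    exact h1.prodMk (continuous_snd.comp hv)
  continuous_invFun := by
    rw [isEmbedding_OTriStar.continuous_iff]
    have hv : Continuous (fun p : S5 m × PosR => p.1.val) := continuous_val.comp continuous_fst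
    have ht : Continuous (fun p : S5 m × PosR => √(p.2 : ℝ)) :=
      Real.continuous_sqrt.comp (continuous_subtype_val.comp continuous_snd)
    have h1 : Continuous (fun p : S5 m × PosR => √(p.2 : ℝ) • p.1.val.1) :=
      ht.smul (continuous_fst.comp hv)
    exact h1.prodMk (continuous_snd.comp hv)

/-- The identification `ℝᵃ × ℝ = ℝᵃ⁺¹`. -/
def lineEquiv (a : ℕ) : (E a × ℝ) ≃L[ℝ] E (a + 1) :=
  ContinuousLinearEquiv.ofFinrankEq (by simp)

instance : ChartedSpace (E 6) (OTriStar m) :=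
  homeoCharted ((𝓡 5).prod 𝓘(ℝ, ℝ)) (lineEquiv 5) starHomeo

instance : IsManifold (𝓡 6) ∞ (OTriStar m) := homeoCharted_isManifold (lineEquiv 5) starHomeo

/-- A triangle is determined by its homothety class and its moment of inertia. -/
def starDiffeo : OTriStar m ≃ₘ⟮𝓡 6, (𝓡 5).prod 𝓘(ℝ, ℝ)⟯ (S5 m × PosR) :=
  homeoCharted_diffeomorph (lineEquiv 5) starHomeo

theorem starDiffeo_fst (x : OTriStar m) : (starDiffeo x).1 = x.normalize := rfl

theorem starDiffeo_snd (x : OTriStar m) : ((starDiffeo x).2 : ℝ) = inertia x.1 := rfl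

/-- Dilation by `√t`, on the ambient space. -/
def sizeAmbient (p : Ambient × ℝ) : Ambient := (√p.2 • p.1.1, p.1.2)

theorem val_starDiffeo (x : OTriStar m) :
    sizeAmbient ((starDiffeo x).1.val, ((starDiffeo x).2 : ℝ)) = x.val :=
  congrArg OTriStar.val (starHomeo.left_inv x)

theorem contDiffAt_sizeAmbient {p : Ambient × ℝ} (hp : 0 < p.2) : ContDiffAt ℝ ∞ sizeAmbient p := by
  have h1 : ContDiffAt ℝ ∞ (fun p : Ambient × ℝ => √p.2) p := contDiffAt_snd.sqrt hp.ne'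
  have h2 : ContDiffAt ℝ ∞ (fun p : Ambient × ℝ => p.1.1) p := by fun_prop
  have h3 : ContDiffAt ℝ ∞ (fun p : Ambient × ℝ => p.1.2) p := by fun_prop
  exact (h1.smul h2).prodMk h3

theorem contMDiff_starVal : ContMDiff (𝓡 6) 𝓘(ℝ, Ambient) ∞ (OTriStar.val (m := m)) := by
  intro x
  have h1 : ContMDiffAt (𝓡 6) (𝓡 5) ∞ (fun x : OTriStar m => (starDiffeo x).1) x :=
    contMDiffAt_fst.comp x (starDiffeo (m := m)).contMDiff.contMDiffAt
  have h2 : ContMDiffAt (𝓡 6) 𝓘(ℝ, Ambient) ∞ (fun x : OTriStar m => (starDiffeo x).1.val) x :=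
    contMDiff_val.contMDiffAt.comp x h1
  have h3 : ContMDiffAt (𝓡 6) 𝓘(ℝ, ℝ) ∞ (fun x : OTriStar m => (starDiffeo x).2) x :=
    contMDiffAt_snd.comp x (starDiffeo (m := m)).contMDiff.contMDiffAt
  have h4 : ContMDiffAt (𝓡 6) 𝓘(ℝ, ℝ) ∞ (fun x : OTriStar m => ((starDiffeo x).2 : ℝ)) x :=
    contMDiff_subtype_val.contMDiffAt.comp x h3
  have h5 := smooth_comp (F := sizeAmbient)
    (h := fun x : OTriStar m => ((starDiffeo x).1.val, ((starDiffeo x).2 : ℝ)))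
    (contDiffAt_sizeAmbient (starDiffeo x).2.2) (h2.prodMk_space h4)
  exact h5.congr_of_eventuallyEq (Filter.Eventually.of_forall fun y => (val_starDiffeo y).symm)

/-- Normalization to moment of inertia one, on the ambient space. -/
def normalizeAmbient (m : Fin 3 → ℝ) (p : Ambient) : Ambient :=
  ((√(inertiaAmbient m p))⁻¹ • p.1, p.2)

omit hm in
theorem contDiffAt_normalizeAmbient {p : Ambient} (hp : 0 < inertiaAmbient m p) :
    ContDiffAt ℝ ∞ (normalizeAmbient m) p := by
  have h1 : ContDiffAt ℝ ∞ (fun p => (√(inertiaAmbient m p))⁻¹) p :=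
    (contDiff_inertiaAmbient.contDiffAt.sqrt hp.ne').inv (Real.sqrt_pos.mpr hp).ne'
  have h2 : ContDiffAt ℝ ∞ (fun p : Ambient => p.1) p := contDiffAt_fst
  have h3 : ContDiffAt ℝ ∞ (fun p : Ambient => p.2) p := contDiffAt_snd
  exact (h1.smul h2).prodMk h3

/-- A retraction normalizes the size of the triangle, retracts to `I = 1`, and restores the size. -/
theorem hasSmoothRetractions_starVal :
    HasSmoothRetractions (𝓡 6) (OTriStar.val (m := m)) := by
  intro x
  obtain ⟨r, hr, hr'⟩ := hasSmoothRetractions_val (starDiffeo x).1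
  obtain ⟨ρ, hρ, hρ'⟩ := hasSmoothRetractions_PosR (starDiffeo x).2
  have h1 : ContMDiffAt 𝓘(ℝ, Ambient) (𝓡 5) ∞ (fun p => r (normalizeAmbient m p)) x.val := by
    have h : ContMDiffAt 𝓘(ℝ, Ambient) (𝓡 5) ∞ r (normalizeAmbient m x.val) := hr
    exact h.comp x.val (contDiffAt_normalizeAmbient (inertia_pos x)).contMDiffAt
  have h2 : ContMDiffAt 𝓘(ℝ, Ambient) 𝓘(ℝ, ℝ) ∞ (fun p => ρ (inertiaAmbient m p)) x.val := by
    have h : ContMDiffAt 𝓘(ℝ, ℝ) 𝓘(ℝ, ℝ) ∞ ρ (inertiaAmbient m x.val) := hρ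
    exact h.comp x.val contDiff_inertiaAmbient.contDiffAt.contMDiffAt
  have h3 : ContMDiffAt 𝓘(ℝ, Ambient) ((𝓡 5).prod 𝓘(ℝ, ℝ)) ∞
      (fun p => (r (normalizeAmbient m p), ρ (inertiaAmbient m p))) x.val := h1.prodMk h2
  have h4 : ContMDiffAt 𝓘(ℝ, Ambient) (𝓡 6) ∞
      (fun p => starDiffeo.symm (r (normalizeAmbient m p), ρ (inertiaAmbient m p))) x.val :=
    (starDiffeo (m := m)).symm.contMDiff.contMDiffAt.comp x.val h3
  have hc : Continuous (starDiffeo (m := m)) := starHomeo.continuous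
  have h5 : ∀ᶠ y : OTriStar m in 𝓝 x, starDiffeo.symm
      (r (normalizeAmbient m y.val), ρ (inertiaAmbient m y.val)) = y := by
    filter_upwards [(continuous_fst.comp hc).continuousAt.eventually hr',
      (continuous_snd.comp hc).continuousAt.eventually hρ'] with y h1 h2
    have e1 : r (normalizeAmbient m y.val) = (starDiffeo y).1 := h1
    have e2 : ρ (inertiaAmbient m y.val) = (starDiffeo y).2 := h2
    rw [e1, e2, Prod.mk.eta, starDiffeo.symm_apply_apply]
  exact ⟨_, h4, h5⟩

theorem isSmoothEmbedding_starVal :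
    IsSmoothEmbedding (𝓡 6) 𝓘(ℝ, Ambient) ∞ (OTriStar.val (m := m)) :=
  ⟨isImmersion_of_retractions contMDiff_starVal hasSmoothRetractions_starVal, isEmbedding_OTriStar⟩

/-! ### Similarity classes -/

omit hm in
theorem continuous_toStar : Continuous (S5.toStar (m := m)) :=
  continuous_subtype_val.subtype_mk _

theorem continuous_normalize : Continuous (OTriStar.normalize (m := m)) :=
  continuous_fst.comp starHomeo.continuous

theorem normalize_toStar (s : S5 m) : s.toStar.normalize = s := by
  refine Subtype.ext ?_
  change dilate (√(inertia s.1))⁻¹ s.1 = s.1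
  rw [s.2, Real.sqrt_one, inv_one, dilate_one]

theorem normalize_dilate {x : OTriStar m} {s : S5 m} {c : ℝ} (hc : 0 < c)
    (h : x.1 = dilate c s.1) : x.normalize = s := by
  refine Subtype.ext ?_
  change dilate (√(inertia x.1))⁻¹ x.1 = s.1
  rw [h, inertia_dilate, s.2, mul_one, Real.sqrt_sq hc.le, dilate_dilate, inv_mul_cancel₀ hc.ne',
    dilate_one]

theorem normalize_rot (g : SO3) (x : OTriStar m) : (g • x).normalize = g • x.normalize := by
  refine Subtype.ext ?_
  change dilate (√(inertia (g • x.1)))⁻¹ (g • x.1) = g • dilate (√(inertia x.1))⁻¹ x.1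
  rw [inertia_rot, rot_dilate]

theorem similar_normalize (x : OTriStar m) : similarity m x.normalize.toStar x := by
  refine ⟨1, √(inertia x.1), Real.sqrt_pos.mpr (inertia_pos x), ?_⟩
  rw [one_smul]
  exact (congrArg Subtype.val (starHomeo.left_inv x)).symm

/-- The shape space is the space of similarity classes. -/
def similarityHomeo : Shape m ≃ₜ SimilarityClass m where
  toFun := Quotient.lift (fun s => Quotient.mk (similarity m) s.toStar) (by
    rintro _ t ⟨g, rfl⟩
    refine Quotient.sound (s := similarity m) ((similarity m).symm ?_)
    exact ⟨g, 1, one_pos, (dilate_one _).symm⟩)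
  invFun := Quotient.lift (fun x => toShape x.normalize) (by
    rintro x y ⟨g, c, hc, h⟩
    have h1 : y.normalize = (g • x).normalize := by
      refine normalize_dilate (c := c * √(inertia (g • x).1))
        (mul_pos hc (Real.sqrt_pos.mpr (inertia_pos _))) ?_
      rw [h, ← dilate_dilate]
      exact congrArg (dilate c) (congrArg Subtype.val (starHomeo.left_inv (g • x))).symm
    rw [h1, normalize_rot, toShape_rot])
  left_inv := by
    rintro ⟨s⟩
    exact congrArg toShape (normalize_toStar s)
  right_inv := by
    rintro ⟨x⟩
    exact Quotient.sound (s := similarity m) (similar_normalize x)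
  continuous_toFun := (Continuous.comp (g := Quotient.mk (similarity m)) continuous_quot_mk
    continuous_toStar).quotient_lift _
  continuous_invFun := (continuous_toShape.comp continuous_normalize).quotient_lift _

end Star

/-! ### Rotations of the sphere -/

section Sphere

variable {EN HN : Type} [NormedAddCommGroup EN] [NormedSpace ℝ EN]
    [TopologicalSpace HN] {J : ModelWithCorners ℝ EN HN} {N : Type} [TopologicalSpace N]
    [ChartedSpace HN N]

/-- The action of a matrix on a vector. -/
def vecAct (p : Mat3 × E 3) : E 3 := WithLp.toLp 2 fun i => ∑ j, p.1 i j * p.2 j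

theorem contDiff_vecAct : ContDiff ℝ ∞ vecAct := by
  have h : ContDiff ℝ ∞ (fun p : Mat3 × E 3 => fun i => ∑ j, p.1 i j * p.2 j) := by fun_prop
  exact contDiff_toLp.comp h

instance : ContinuousSMul SO3 (E 3) where
  continuous_smul := by
    have h : Continuous (fun p : SO3 × E 3 => (entries p.1, p.2)) :=
      (continuous_entries.comp continuous_fst).prodMk continuous_snd
    exact contDiff_vecAct.continuous.comp h

instance : ContinuousSMul SO3 S2 where
  continuous_smul := by
    have h : Continuous (fun p : SO3 × S2 => p.1 • p.2.1) :=
      continuous_fst.smul (continuous_subtype_val.comp continuous_snd)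
    exact h.subtype_mk _

theorem contMDiffAt_rot_S2 {g : N → SO3} {u : N → S2} {y : N} (hg : ContMDiffAt J (𝓡 3) ∞ g y)
    (hu : ContMDiffAt J (𝓡 2) ∞ u y) : ContMDiffAt J (𝓡 2) ∞ (fun x => g x • u x) y := by
  have h1 : ContMDiffAt J 𝓘(ℝ, Mat3) ∞ (fun x => entries (g x)) y :=
    contMDiff_entries.contMDiffAt.comp y hg
  have h2 : ContMDiffAt J 𝓘(ℝ, E 3) ∞ (fun x => (u x).1) y :=
    contMDiff_coe_sphere.contMDiffAt.comp y hu
  exact contMDiffAt_sphere (smooth_comp (F := vecAct) (h := fun x => (entries (g x), (u x).1))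
    contDiff_vecAct.contDiffAt (h1.prodMk_space h2))

theorem exists_cross_ne_zero (u : S2) : ∃ v, cross u.1 v ≠ 0 := by
  by_contra! h
  have h0 : ∀ i j, cross u.1 (e i) j = 0 := fun i j => by rw [h]; rfl
  have h1 : ‖u.1‖ = 1 := by simp
  have h2 := norm_sq_eq u.1
  have a := h0 0 1
  have b := h0 0 2
  have c := h0 1 2
  simp [e_apply] at a b c
  rw [h1, a, b, c] at h2
  norm_num at h2

theorem frame_smul_e2 {v : E 3} {u : S2} (h : cross u.1 v ≠ 0) : frame v u.1 • e 2 = u.1 := by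
  rw [frame_e2 h, unit_of_norm_one (by simp)]

theorem inv_rot_eq {g : SO3} {x y : E 3} (h : x = g • y) : g⁻¹ • x = y := inv_smul_eq_iff.mpr h

/-- A rotation that depends smoothly on `u` and takes `a` to `u`, if `g` takes `a` to `u₀`. -/
def carry (v : E 3) (g : SO3) (u₀ u : S2) : SO3 := frame v u.1 * (frame v u₀.1)⁻¹ * g

theorem carry_self (v : E 3) (g : SO3) (u₀ : S2) : carry v g u₀ u₀ = g := by simp [carry]

theorem carry_smul {v : E 3} {g : SO3} {a u₀ u : S2} (hg : g • a = u₀) (h₀ : cross u₀.1 v ≠ 0)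
    (h : cross u.1 v ≠ 0) : carry v g u₀ u • a = u := by
  rw [carry, mul_smul, hg, mul_smul]
  refine Subtype.ext ?_
  change frame v u.1 • (frame v u₀.1)⁻¹ • u₀.1 = u.1
  rw [inv_rot_eq (frame_smul_e2 h₀).symm, frame_smul_e2 h]

theorem contMDiffAt_frame_right {v : E 3} {u : S2} (h : cross u.1 v ≠ 0) :
    ContMDiffAt (𝓡 2) (𝓡 3) ∞ (fun u : S2 => frame v u.1) u := by
  refine contMDiffAt_SO3 ?_
  have h1 : ContDiffAt ℝ ∞ (fun x : E 3 => frameEntries v x) u.1 := by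
    have h2 : ContDiffAt ℝ ∞ (fun x : E 3 => (v, x)) u.1 := by fun_prop
    have h3 := ContDiffAt.comp u.1 (g := fun p : E 3 × E 3 => frameEntries p.1 p.2)
      (contDiffAt_frameEntries h) h2
    exact h3
  refine (smooth_comp (F := fun x : E 3 => frameEntries v x) (h := fun u : S2 => u.1) h1
    contMDiff_coe_sphere.contMDiffAt).congr_of_eventuallyEq ?_
  have hc : Continuous (fun u : S2 => cross u.1 v) := by
    have : Continuous (fun u : S2 => (u.1, v)) := by fun_prop
    exact contDiff_cross.continuous.comp this
  filter_upwards [(isOpen_ne.preimage hc).mem_nhds h] with w hw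
  exact entries_frame hw

theorem isOpen_cross_ne_zero (v : E 3) : IsOpen {u : S2 | cross u.1 v ≠ 0} := by
  have h : Continuous (fun u : S2 => (u.1, v)) := by fun_prop
  exact isOpen_ne.preimage (contDiff_cross.continuous.comp h)

theorem contMDiffAt_carry {v : E 3} (g : SO3) (u₀ : S2) {u : S2} (h : cross u.1 v ≠ 0) :
    ContMDiffAt (𝓡 2) (𝓡 3) ∞ (carry v g u₀) u := by
  have h1 := (contMDiffAt_frame_right h).mul (contMDiffAt_const (c := (frame v u₀.1)⁻¹))
  exact h1.mul (contMDiffAt_const (c := g))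

/-- The rotation group acts transitively on the sphere. -/
theorem exists_rot_eq (a u : S2) : ∃ g : SO3, g • a = u := by
  obtain ⟨v, hv⟩ := exists_cross_ne_zero u
  obtain ⟨w, hw⟩ := exists_cross_ne_zero a
  refine ⟨frame v u.1 * (frame w a.1)⁻¹, Subtype.ext ?_⟩
  change (frame v u.1 * (frame w a.1)⁻¹) • a.1 = u.1
  rw [rot_mul, inv_rot_eq (frame_smul_e2 hw).symm, frame_smul_e2 hv]

end Sphere

/-! ### The associated bundle -/

section Associated

variable {m : Fin 3 → ℝ}

theorem toAssoc_rot (g : SO3) (s : S5 m) (u : S2) : toAssoc (g • s, g • u) = toAssoc (s, u) :=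
  Quotient.sound ⟨g, rfl⟩

theorem isOpenQuotientMap_toAssoc : IsOpenQuotientMap (toAssoc (m := m)) :=
  MulAction.isOpenQuotientMap_quotientMk

theorem continuous_assocToShape : Continuous (Assoc.toShape (m := m)) :=
  (continuous_toShape.comp continuous_fst).quotient_lift _

variable [hm : Fact (∀ a, 0 < m a)]

/-- The coordinates of a point of the associated bundle with respect to the frame of the triangle,
where this is defined. -/
def assocCoord (i : Bool) : Assoc m → Shape m × S2 :=
  open Classical in
  Quotient.lift (fun p : S5 m × S2 => if p.1.z i ≠ 0 then (toShape p.1, (p.1.frame i)⁻¹ • p.2)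
    else (toShape p.1, ⟨e 2, by simp [norm_e]⟩)) (by
    rintro _ ⟨s, u⟩ ⟨g, rfl⟩
    change (if (g • s).z i ≠ 0 then (toShape (g • s), ((g • s).frame i)⁻¹ • g • u) else _) =
      if s.z i ≠ 0 then (toShape s, (s.frame i)⁻¹ • u) else _
    have h : (g • s).z i ≠ 0 ↔ s.z i ≠ 0 := by rw [S5.rot_z, Ne, rot_eq_zero_iff]
    by_cases hs : s.z i ≠ 0
    · rw [if_pos hs, if_pos (h.mpr hs), S5.frame_rot hs, toShape_rot, mul_inv_rev, mul_smul,
        inv_smul_smul]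
    · rw [if_neg hs, if_neg (h.not.mpr hs)]
      exact Prod.ext (toShape_rot g s) rfl)

omit hm in
theorem assocCoord_toAssoc {i : Bool} {s : S5 m} (h : s.z i ≠ 0) (u : S2) :
    assocCoord i (toAssoc (s, u)) = (toShape s, (s.frame i)⁻¹ • u) := if_pos h

theorem toAssoc_section {i : Bool} {s : S5 m} (h : s.z i ≠ 0) (u : S2) :
    toAssoc (localSection i (toShape s), (s.frame i)⁻¹ • u) = toAssoc (s, u) := by
  rw [← toAssoc_rot (s.frame i), frame_smul_section h, smul_inv_smul]

/-- The local trivialization of the associated bundle. -/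
def trivAssoc (i : Bool) : OpenPartialHomeomorph (Assoc m) (Shape m × S2) where
  toFun := assocCoord i
  invFun p := toAssoc (localSection i p.1, p.2)
  source := Assoc.toShape ⁻¹' dom m i
  target := dom m i ×ˢ univ
  map_source' := by
    rintro ⟨s, u⟩ hs
    have h := assocCoord_toAssoc (toShape_mem_dom.mp hs) u
    refine ⟨?_, trivial⟩
    exact (congrArg Prod.fst h).symm ▸ hs
  map_target' p hp := by
    change toShape (localSection i p.1) ∈ dom m i
    rw [toShape_section hp.1]
    exact hp.1
  left_inv' := by
    rintro ⟨s, u⟩ hs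
    have hz : s.z i ≠ 0 := toShape_mem_dom.mp hs
    change toAssoc (localSection i (assocCoord i (toAssoc (s, u))).1,
      (assocCoord i (toAssoc (s, u))).2) = toAssoc (s, u)
    rw [assocCoord_toAssoc hz]
    exact toAssoc_section hz u
  right_inv' p hp := by
    rw [assocCoord_toAssoc (section_z_ne_zero hp.1), toShape_section hp.1, section_frame hp.1,
      inv_one, one_smul]
  open_source := (isOpen_dom i).preimage continuous_assocToShape
  open_target := (isOpen_dom i).prod isOpen_univ
  continuousOn_toFun := by
    rintro ⟨s, u⟩ hs
    have hz : s.z i ≠ 0 := toShape_mem_dom.mp hs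
    refine ContinuousAt.continuousWithinAt ?_
    have h : ContinuousAt (assocCoord i ∘ toAssoc (m := m)) (s, u) := by
      have h1 : ContinuousAt (fun p : S5 m × S2 => (toShape p.1, (p.1.frame i)⁻¹ • p.2))
          (s, u) := by
        have h2 : ContinuousAt (fun p : S5 m × S2 => p.1.frame i) (s, u) :=
          ContinuousAt.comp (g := fun s : S5 m => s.frame i) (continuousAt_frame hz)
            continuousAt_fst
        exact (continuous_toShape.comp continuous_fst).continuousAt.prodMk
          (h2.inv.smul continuousAt_snd)
      refine h1.congr ?_
      filter_upwards [((isOpen_z_ne_zero i).preimage continuous_fst).mem_nhds hz] with p hp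
      exact (assocCoord_toAssoc hp p.2).symm
    exact isOpenQuotientMap_toAssoc.continuousAt_comp_iff.mp h
  continuousOn_invFun p hp := by
    refine ContinuousAt.continuousWithinAt ?_
    have h : ContinuousAt (fun p : Shape m × S2 => (localSection i p.1, p.2)) p :=
      (ContinuousAt.comp (g := localSection i) (continuousAt_section hp.1) continuousAt_fst).prodMk
        continuousAt_snd
    exact isOpenQuotientMap_toAssoc.continuous.continuousAt.comp h

theorem trivAssoc_source (i : Bool) : (trivAssoc (m := m) i).source = Assoc.toShape ⁻¹' dom m i :=
  rfl

theorem trivAssoc_compat (i j : Bool) : ContMDiffOn ((𝓡 2).prod (𝓡 2)) ((𝓡 2).prod (𝓡 2)) ∞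
    ((trivAssoc (m := m) i).symm ≫ₕ trivAssoc j)
    ((trivAssoc (m := m) i).symm ≫ₕ trivAssoc j).source := by
  intro p hp
  rw [OpenPartialHomeomorph.trans_source] at hp
  have hp1 : p.1 ∈ dom m i := hp.1.1
  have hp2 : toShape (localSection i p.1) ∈ dom m j := hp.2
  rw [toShape_section hp1] at hp2
  have hz : ∀ {b : Shape m}, b ∈ dom m i → b ∈ dom m j → (localSection i b).z j ≠ 0 := by
    intro b h1 h2
    rw [← toShape_mem_dom, toShape_section h1]
    exact h2
  have h0 : ContMDiffAt ((𝓡 2).prod (𝓡 2)) (𝓡 2) ∞ (fun p : Shape m × S2 => p.1) p :=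
    contMDiffAt_fst
  have h0' : ContMDiffAt ((𝓡 2).prod (𝓡 2)) (𝓡 2) ∞ (fun p : Shape m × S2 => p.2) p :=
    contMDiffAt_snd
  have h1 : ContMDiffAt ((𝓡 2).prod (𝓡 2)) 𝓘(ℝ, Ambient) ∞
      (fun p : Shape m × S2 => (localSection i p.1).val) p :=
    (contMDiffAt_val_section hp1).comp p h0
  have h2 : ContMDiffAt ((𝓡 2).prod (𝓡 2)) (𝓡 3) ∞
      (fun p : Shape m × S2 => (localSection i p.1).frame j) p :=
    contMDiffAt_frame_of_val (h := fun p : Shape m × S2 => localSection i p.1) (hz hp1 hp2) h1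
  have h3 : ContMDiffAt ((𝓡 2).prod (𝓡 2)) ((𝓡 2).prod (𝓡 2)) ∞
      (fun p : Shape m × S2 => (p.1, ((localSection i p.1).frame j)⁻¹ • p.2)) p :=
    h0.prodMk (contMDiffAt_rot_S2 h2.inv h0')
  refine (h3.congr_of_eventuallyEq ?_).contMDiffWithinAt
  filter_upwards [((isOpen_dom i).preimage continuous_fst).mem_nhds hp1,
    ((isOpen_dom j).preimage continuous_fst).mem_nhds hp2] with q hq1 hq2
  refine (assocCoord_toAssoc (hz hq1 hq2) q.2).trans ?_
  rw [toShape_section hq1]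

/-- An index of a local trivialization that is defined at the given point. -/
def Assoc.index (a : Assoc m) : Bool := (exists_mem_dom a.toShape).choose

theorem Assoc.index_spec (a : Assoc m) : a ∈ (trivAssoc (m := m) a.index).source :=
  (exists_mem_dom a.toShape).choose_spec

instance : ChartedSpace (E 4) (Assoc m) :=
  pullCharted ((𝓡 2).prod (𝓡 2)) (sumEquiv 2 2) trivAssoc Assoc.index Assoc.index_spec

instance : IsManifold (𝓡 4) ∞ (Assoc m) :=
  pullCharted_isManifold (sumEquiv 2 2) trivAssoc Assoc.index Assoc.index_spec trivAssoc_compat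

theorem contMDiffOn_trivAssoc (i : Bool) :
    ContMDiffOn (𝓡 4) ((𝓡 2).prod (𝓡 2)) ∞ (trivAssoc (m := m) i) (trivAssoc (m := m) i).source ∧
      ContMDiffOn ((𝓡 2).prod (𝓡 2)) (𝓡 4) ∞ (trivAssoc (m := m) i).symm
        (trivAssoc (m := m) i).target :=
  pullCharted_contMDiffOn (sumEquiv 2 2) trivAssoc Assoc.index Assoc.index_spec trivAssoc_compat i

theorem contMDiffAt_assocCoord {i : Bool} {a : Assoc m} (h : a.toShape ∈ dom m i) :
    ContMDiffAt (𝓡 4) ((𝓡 2).prod (𝓡 2)) ∞ (assocCoord (m := m) i) a :=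
  (contMDiffOn_trivAssoc i).1.contMDiffAt ((trivAssoc i).open_source.mem_nhds h)

theorem contMDiffAt_toAssoc_section {i : Bool} {p : Shape m × S2} (h : p.1 ∈ dom m i) :
    ContMDiffAt ((𝓡 2).prod (𝓡 2)) (𝓡 4) ∞
      (fun p : Shape m × S2 => toAssoc (localSection i p.1, p.2)) p :=
  (contMDiffOn_trivAssoc i).2.contMDiffAt ((trivAssoc i).open_target.mem_nhds ⟨h, trivial⟩)

theorem contMDiff_toAssoc : ContMDiff ((𝓡 5).prod (𝓡 2)) (𝓡 4) ∞ (toAssoc (m := m)) := by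
  intro p
  obtain ⟨i, hi⟩ := p.1.exists_z_ne_zero
  have h0 : ContMDiffAt ((𝓡 5).prod (𝓡 2)) (𝓡 5) ∞ (fun p : S5 m × S2 => p.1) p :=
    contMDiffAt_fst
  have h0' : ContMDiffAt ((𝓡 5).prod (𝓡 2)) (𝓡 2) ∞ (fun p : S5 m × S2 => p.2) p :=
    contMDiffAt_snd
  have h1 : ContMDiffAt ((𝓡 5).prod (𝓡 2)) (𝓡 2) ∞ (fun p : S5 m × S2 => toShape p.1) p :=
    contMDiff_toShape.contMDiffAt.comp p h0
  have h2 : ContMDiffAt ((𝓡 5).prod (𝓡 2)) (𝓡 3) ∞ (fun p : S5 m × S2 => p.1.frame i) p :=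
    (contMDiffAt_frame hi).comp p h0
  have h3 : ContMDiffAt ((𝓡 5).prod (𝓡 2)) ((𝓡 2).prod (𝓡 2)) ∞
      (fun p : S5 m × S2 => (toShape p.1, (p.1.frame i)⁻¹ • p.2)) p :=
    h1.prodMk (contMDiffAt_rot_S2 h2.inv h0')
  have h4 : ContMDiffAt ((𝓡 5).prod (𝓡 2)) (𝓡 4) ∞ (fun p : S5 m × S2 =>
      toAssoc (localSection i (toShape p.1), (p.1.frame i)⁻¹ • p.2)) p :=
    ContMDiffAt.comp p (g := fun p : Shape m × S2 => toAssoc (localSection i p.1, p.2))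
      (contMDiffAt_toAssoc_section (toShape_mem_dom.mpr hi)) h3
  refine h4.congr_of_eventuallyEq ?_
  filter_upwards [((isOpen_z_ne_zero i).preimage continuous_fst).mem_nhds hi] with q hq
  exact (toAssoc_section hq q.2).symm

theorem assocCoord_fst {i : Bool} {a : Assoc m} (h : a.toShape ∈ dom m i) :
    (assocCoord i a).1 = a.toShape := by
  obtain ⟨s, u⟩ := a
  exact congrArg Prod.fst (assocCoord_toAssoc (toShape_mem_dom.mp h) u)

theorem toAssoc_assocCoord {i : Bool} {a : Assoc m} (h : a.toShape ∈ dom m i) :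
    toAssoc (localSection i (assocCoord i a).1, (assocCoord i a).2) = a := (trivAssoc i).left_inv h

theorem isSubmersion_toAssoc : IsSubmersion ((𝓡 5).prod (𝓡 2)) (𝓡 4) ∞ (toAssoc (m := m)) := by
  refine isSubmersion_of_sections contMDiff_toAssoc fun ⟨s, u⟩ => ?_
  obtain ⟨i, hi⟩ := s.exists_z_ne_zero
  have hd : (toAssoc (s, u)).toShape ∈ dom m i := toShape_mem_dom.mpr hi
  have hd' : (assocCoord i (toAssoc (s, u))).1 ∈ dom m i := by rw [assocCoord_fst hd]; exact hd
  refine ⟨fun a => (s.frame i • localSection i (assocCoord i a).1, s.frame i • (assocCoord i a).2),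
    ?_, ?_, ?_⟩
  · beta_reduce
    rw [assocCoord_toAssoc hi, frame_smul_section hi, smul_inv_smul]
  · have h1 : ContMDiffAt (𝓡 4) (𝓡 2) ∞ (fun a => (assocCoord (m := m) i a).1) (toAssoc (s, u)) :=
      contMDiffAt_fst.comp _ (contMDiffAt_assocCoord hd)
    have h2 : ContMDiffAt (𝓡 4) (𝓡 2) ∞ (fun a => (assocCoord (m := m) i a).2) (toAssoc (s, u)) :=
      contMDiffAt_snd.comp _ (contMDiffAt_assocCoord hd)
    have hc : ContMDiffAt (𝓡 4) (𝓡 3) ∞ (fun _ : Assoc m => s.frame i) (toAssoc (s, u)) :=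
      contMDiffAt_const
    have h3 : ContMDiffAt (𝓡 4) (𝓡 5) ∞ (fun a => localSection i (assocCoord (m := m) i a).1)
        (toAssoc (s, u)) :=
      ContMDiffAt.comp _ (g := localSection i) (contMDiffAt_section hd') h1
    have h4 : ContMDiffAt (𝓡 4) (𝓡 5) ∞
        (fun a => s.frame i • localSection i (assocCoord (m := m) i a).1)
        (toAssoc (s, u)) := contMDiff_rot.contMDiffAt.comp _ (hc.prodMk h3)
    exact h4.prodMk (contMDiffAt_rot_S2 hc h2)
  · filter_upwards [((isOpen_dom i).preimage continuous_assocToShape).mem_nhds hd] with a ha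
    rw [toAssoc_rot]
    exact toAssoc_assocCoord ha

end Associated

/-! ### Reduction by the rotations about an axis -/

section Reduced

variable {m : Fin 3 → ℝ} {J₀ : E 3}

theorem toSJ_rot (g : axisRot J₀) (s : S5 m) : toSJ J₀ (g.1 • s) = toSJ J₀ s :=
  Quotient.sound ⟨g, rfl⟩

theorem isOpenQuotientMap_toSJ : IsOpenQuotientMap (toSJ (m := m) J₀) :=
  MulAction.isOpenQuotientMap_quotientMk

/-- The rotations about the axis are those that fix its unit vector. -/
theorem mem_axisRot_iff (hJ : J₀ ≠ 0) {g : SO3} :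
    g ∈ axisRot J₀ ↔ g • axis J₀ hJ = axis J₀ hJ := by
  have h0 : ‖J₀‖⁻¹ ≠ 0 := inv_ne_zero (norm_ne_zero_iff.mpr hJ)
  rw [MulAction.mem_stabilizer_iff, Subtype.ext_iff]
  change g • J₀ = J₀ ↔ g • (‖J₀‖⁻¹ • J₀) = ‖J₀‖⁻¹ • J₀
  rw [rot_smul]
  exact (smul_right_injective _ h0).eq_iff.symm

/-- The class of `h⁻¹ s` only depends on the class of `(s, u)` in the associated bundle if `h` takes
the axis to `u`. -/
theorem toSJ_inv_rot (hJ : J₀ ≠ 0) {g h k : SO3} {u : S2} (hh : h • axis J₀ hJ = u)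
    (hk : k • axis J₀ hJ = g • u) (s : S5 m) : toSJ J₀ (k⁻¹ • g • s) = toSJ J₀ (h⁻¹ • s) := by
  have h1 : k⁻¹ * g * h ∈ axisRot J₀ := by
    rw [mem_axisRot_iff hJ, mul_smul, mul_smul, hh, ← hk, inv_smul_smul]
  rw [← toSJ_rot ⟨_, h1⟩ (h⁻¹ • s)]
  change toSJ J₀ (k⁻¹ • g • s) = toSJ J₀ ((k⁻¹ * g * h) • h⁻¹ • s)
  rw [mul_smul, mul_smul, smul_inv_smul]

/-- The class of `h⁻¹ s`, where `h` takes the axis to `u`. -/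
def untwist (hJ : J₀ ≠ 0) (p : S5 m × S2) : SJ m J₀ :=
  toSJ J₀ ((exists_rot_eq (axis J₀ hJ) p.2).choose⁻¹ • p.1)

theorem untwist_eq (hJ : J₀ ≠ 0) {s : S5 m} {u : S2} {h : SO3} (hh : h • axis J₀ hJ = u) :
    untwist hJ (s, u) = toSJ J₀ (h⁻¹ • s) := by
  have h1 := toSJ_inv_rot hJ (g := 1) hh
    ((exists_rot_eq (axis J₀ hJ) u).choose_spec.trans (one_smul SO3 u).symm) s
  rw [one_smul] at h1
  exact h1

theorem untwist_rot (hJ : J₀ ≠ 0) (g : SO3) (s : S5 m) (u : S2) :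
    untwist hJ (g • s, g • u) = untwist hJ (s, u) := by
  obtain ⟨h, hh⟩ := exists_rot_eq (axis J₀ hJ) u
  obtain ⟨k, hk⟩ := exists_rot_eq (axis J₀ hJ) (g • u)
  rw [untwist_eq hJ hh, untwist_eq hJ hk, toSJ_inv_rot hJ hh hk]

theorem continuous_untwist (hJ : J₀ ≠ 0) : Continuous (untwist (m := m) hJ) := by
  rw [continuous_iff_continuousAt]
  rintro ⟨s, u⟩
  obtain ⟨h, hh⟩ := exists_rot_eq (axis J₀ hJ) u
  obtain ⟨v, hv⟩ := exists_cross_ne_zero u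
  have h1 : ContinuousAt (fun p : S5 m × S2 => carry v h u p.2) (s, u) :=
    ContinuousAt.comp (g := carry v h u) (contMDiffAt_carry h u hv).continuousAt continuousAt_snd
  have h2 : ContinuousAt (fun p : S5 m × S2 => (carry v h u p.2)⁻¹ • p.1) (s, u) :=
    h1.inv.smul continuousAt_fst
  have h3 := (isOpenQuotientMap_toSJ (J₀ := J₀)).continuous.continuousAt.comp h2
  refine h3.congr ?_
  filter_upwards [((isOpen_cross_ne_zero v).preimage continuous_snd).mem_nhds hv] with p hp
  exact (untwist_eq hJ (carry_smul hh hv hp)).symm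

/-- The reduced space is the bundle associated to the sphere `S² = G / G(J₀)`. -/
def thetaHomeo (m : Fin 3 → ℝ) (hJ : J₀ ≠ 0) : SJ m J₀ ≃ₜ Assoc m where
  toFun := Quotient.lift (fun s => toAssoc (s, axis J₀ hJ)) (by
    rintro _ s ⟨g, rfl⟩
    have h := toAssoc_rot g.1 s (axis J₀ hJ)
    rw [(mem_axisRot_iff hJ).mp g.2] at h
    exact h)
  invFun := Quotient.lift (untwist hJ) (by
    rintro _ ⟨s, u⟩ ⟨g, rfl⟩
    exact untwist_rot hJ g s u)
  left_inv := by
    rintro ⟨s⟩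
    have h := untwist_eq hJ (s := s) (one_smul SO3 (axis J₀ hJ))
    rw [inv_one, one_smul] at h
    exact h
  right_inv := by
    rintro ⟨s, u⟩
    obtain ⟨h, hh⟩ := exists_rot_eq (axis J₀ hJ) u
    change Quotient.lift _ _ (untwist hJ (s, u)) = toAssoc (s, u)
    rw [untwist_eq hJ hh]
    change toAssoc (h⁻¹ • s, axis J₀ hJ) = toAssoc (s, u)
    rw [← toAssoc_rot h, smul_inv_smul, hh]
  continuous_toFun := by
    have h : Continuous (fun s : S5 m => (s, axis J₀ hJ)) := by fun_prop
    exact (isOpenQuotientMap_toAssoc.continuous.comp h).quotient_lift _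
  continuous_invFun := (continuous_untwist hJ).quotient_lift _

variable [hm : Fact (∀ a, 0 < m a)] [hJ : Fact (J₀ ≠ 0)]

instance : ChartedSpace (E 4) (SJ m J₀) :=
  homeoCharted (𝓡 4) (.refl ℝ (E 4)) (thetaHomeo m hJ.out)

instance : IsManifold (𝓡 4) ∞ (SJ m J₀) :=
  homeoCharted_isManifold (.refl ℝ (E 4)) (thetaHomeo m hJ.out)

variable (m J₀) in
/-- The reduced space is the bundle associated to the sphere `S² = G / G(J₀)`. -/
def thetaDiffeo : SJ m J₀ ≃ₘ⟮𝓡 4, 𝓡 4⟯ Assoc m :=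
  homeoCharted_diffeomorph (.refl ℝ (E 4)) (thetaHomeo m hJ.out)

theorem thetaDiffeo_toSJ (s : S5 m) :
    thetaDiffeo m J₀ (toSJ J₀ s) = toAssoc (s, axis J₀ hJ.out) := rfl

theorem thetaDiffeo_toShape (x : SJ m J₀) : (thetaDiffeo m J₀ x).toShape = x.toShape := by
  obtain ⟨s⟩ := x
  rfl

theorem contMDiff_toSJ : ContMDiff (𝓡 5) (𝓡 4) ∞ (toSJ (m := m) J₀) := by
  intro s
  have h1 : ContMDiffAt (𝓡 5) ((𝓡 5).prod (𝓡 2)) ∞ (fun s : S5 m => (s, axis J₀ hJ.out)) s :=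
    contMDiffAt_id.prodMk contMDiffAt_const
  have h2 := contMDiff_toAssoc.contMDiffAt.comp s h1
  have h3 := (thetaDiffeo m J₀).symm.contMDiff.contMDiffAt.comp s h2
  refine h3.congr_of_eventuallyEq (Filter.Eventually.of_forall fun t => ?_)
  exact ((thetaDiffeo m J₀).symm_apply_apply (toSJ J₀ t)).symm

/-- A local section through the class of `s` comes from a local section of `S̃⁵ × S² → S̃⁵ ×_G S²`,
whose triangle is turned so that the point of the sphere becomes the axis. -/
theorem exists_section_toSJ (s : S5 m) : ∃ σ : SJ m J₀ → S5 m, σ (toSJ J₀ s) = s ∧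
    ContMDiffAt (𝓡 4) (𝓡 5) ∞ σ (toSJ J₀ s) ∧ ∀ᶠ x in 𝓝 (toSJ J₀ s), toSJ J₀ (σ x) = x := by
  obtain ⟨i, hi⟩ := s.exists_z_ne_zero
  set x₀ := toSJ J₀ s
  set C : SJ m J₀ → Shape m × S2 := fun x => assocCoord i (thetaDiffeo m J₀ x)
  have hd : (thetaDiffeo m J₀ x₀).toShape ∈ dom m i := toShape_mem_dom.mpr hi
  have hC : ContMDiffAt (𝓡 4) ((𝓡 2).prod (𝓡 2)) ∞ C x₀ :=
    (contMDiffAt_assocCoord hd).comp x₀ (thetaDiffeo m J₀).contMDiff.contMDiffAt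
  have hx₀ : C x₀ = (toShape s, (s.frame i)⁻¹ • axis J₀ hJ.out) := assocCoord_toAssoc hi _
  have hb : (C x₀).1 ∈ dom m i := by rw [hx₀]; exact toShape_mem_dom.mpr hi
  have hg : (s.frame i)⁻¹ • axis J₀ hJ.out = (C x₀).2 := by rw [hx₀]
  obtain ⟨v, hv⟩ := exists_cross_ne_zero (C x₀).2
  have h1 : ContMDiffAt (𝓡 4) (𝓡 2) ∞ (fun x => (C x).1) x₀ := contMDiffAt_fst.comp _ hC
  have h2 : ContMDiffAt (𝓡 4) (𝓡 2) ∞ (fun x => (C x).2) x₀ := contMDiffAt_snd.comp _ hC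
  have h3 : ContMDiffAt (𝓡 4) (𝓡 3) ∞ (fun x => carry v (s.frame i)⁻¹ (C x₀).2 (C x).2) x₀ :=
    ContMDiffAt.comp x₀ (g := carry v (s.frame i)⁻¹ (C x₀).2) (contMDiffAt_carry _ _ hv) h2
  have h4 : ContMDiffAt (𝓡 4) (𝓡 5) ∞ (fun x => localSection i (C x).1) x₀ :=
    ContMDiffAt.comp x₀ (g := localSection i) (contMDiffAt_section hb) h1
  have h5 : ContMDiffAt (𝓡 4) (𝓡 5) ∞
      (fun x => (carry v (s.frame i)⁻¹ (C x₀).2 (C x).2)⁻¹ • localSection i (C x).1) x₀ :=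
    contMDiff_rot.contMDiffAt.comp x₀ (h3.inv.prodMk h4)
  refine ⟨_, ?_, h5, ?_⟩
  · rw [carry_self, inv_inv, hx₀]
    exact frame_smul_section hi
  · have o1 := (continuous_assocToShape.comp (thetaHomeo m hJ.out).continuous).continuousAt
      (x := x₀) |>.eventually ((isOpen_dom i).mem_nhds hd)
    have o2 := h2.continuousAt.eventually ((isOpen_cross_ne_zero v).mem_nhds hv)
    filter_upwards [o1, o2] with x hx1 hx2
    refine (thetaDiffeo m J₀).injective ?_
    change thetaDiffeo m J₀ (toSJ J₀ _) = thetaDiffeo m J₀ x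
    rw [thetaDiffeo_toSJ, ← toAssoc_rot (carry v (s.frame i)⁻¹ (C x₀).2 (C x).2), smul_inv_smul,
      carry_smul hg hv hx2]
    exact toAssoc_assocCoord hx1

theorem isSubmersion_toSJ : IsSubmersion (𝓡 5) (𝓡 4) ∞ (toSJ (m := m) J₀) :=
  isSubmersion_of_sections contMDiff_toSJ exists_section_toSJ

omit hJ in
theorem isSubmersion_toShape : IsSubmersion (𝓡 5) (𝓡 2) ∞ (toShape (m := m)) := by
  refine isSubmersion_of_sections contMDiff_toShape fun s => ?_
  obtain ⟨i, hi⟩ := s.exists_z_ne_zero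
  have hd : toShape s ∈ dom m i := toShape_mem_dom.mpr hi
  have hc : ContMDiffAt (𝓡 2) (𝓡 3) ∞ (fun _ : Shape m => s.frame i) (toShape s) :=
    contMDiffAt_const
  have h1 : ContMDiffAt (𝓡 2) (𝓡 5) ∞ (fun b => s.frame i • localSection i b) (toShape s) :=
    contMDiff_rot.contMDiffAt.comp _ (hc.prodMk (contMDiffAt_section hd))
  refine ⟨_, frame_smul_section hi, h1, ?_⟩
  filter_upwards [(isOpen_dom i).mem_nhds hd] with b hb
  rw [toShape_rot, toShape_section hb]

/-! ### The reduced configuration space -/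

/-- Two quotient maps with the same fibers have homeomorphic targets. -/
theorem exists_homeomorph_of_isQuotientMap {X Y Z : Type} [TopologicalSpace X]
    [TopologicalSpace Y] [TopologicalSpace Z] {f : X → Y} {g : X → Z} (hf : IsQuotientMap f)
    (hg : IsQuotientMap g) (h : ∀ x y, f x = f y ↔ g x = g y) :
    ∃ φ : Y ≃ₜ Z, ∀ x, φ (f x) = g x := by
  have h1 : ∀ x, g (Function.surjInv hf.surjective (f x)) = g x := fun x =>
    (h _ _).mp (Function.surjInv_eq hf.surjective (f x))
  have h2 : ∀ x, f (Function.surjInv hg.surjective (g x)) = f x := fun x =>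
    (h _ _).mpr (Function.surjInv_eq hg.surjective (g x))
  refine ⟨⟨⟨fun y => g (Function.surjInv hf.surjective y),
    fun z => f (Function.surjInv hg.surjective z), fun y => ?_, fun z => ?_⟩, ?_, ?_⟩, h1⟩
  · obtain ⟨x, rfl⟩ := hf.surjective y
    beta_reduce
    rw [h1, h2]
  · obtain ⟨x, rfl⟩ := hg.surjective z
    beta_reduce
    rw [h2, h1]
  · exact hf.continuous_iff.mpr (hg.continuous.congr fun x => (h1 x).symm)
  · exact hg.continuous_iff.mpr (hf.continuous.congr fun x => (h2 x).symm)

omit hm in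
instance : ContinuousSMul SO3 (OTri m) where
  continuous_smul := by
    refine Continuous.subtype_mk ?_ _
    have h : Continuous (fun p : SO3 × OTri m => (entries p.1, p.2.1)) :=
      (continuous_entries.comp continuous_fst).prodMk (continuous_subtype_val.comp continuous_snd)
    exact contDiff_matAct.continuous.comp h

omit hm hJ in
theorem isOpenQuotientMap_toQJ : IsOpenQuotientMap (toQJ (m := m) J₀) :=
  MulAction.isOpenQuotientMap_quotientMk

omit hm hJ in
theorem isOpen_ne_collision : IsOpen {x : OTri m | x.1.1 ≠ 0} :=
  isOpen_ne.preimage (continuous_fst.comp continuous_subtype_val)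

omit hm hJ in
theorem isOpenQuotientMap_toQJStar : IsOpenQuotientMap (toQJStar (m := m) J₀) where
  surjective := by
    rintro ⟨q, hq⟩
    obtain ⟨x, rfl⟩ := isOpenQuotientMap_toQJ.surjective q
    exact ⟨⟨x, fun hx => hq ⟨x, hx, rfl⟩⟩, rfl⟩
  continuous := (isOpenQuotientMap_toQJ.continuous.comp continuous_subtype_val).subtype_mk _
  isOpenMap U hU := by
    have h : toQJStar J₀ '' U = Subtype.val ⁻¹' (toQJ J₀ '' (Subtype.val '' U)) := by
      ext q
      constructor
      · rintro ⟨x, hx, rfl⟩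
        exact ⟨x.1, ⟨x, hx, rfl⟩, rfl⟩
      · rintro ⟨_, ⟨x, hx, rfl⟩, hq⟩
        exact ⟨x, hx, Subtype.ext hq⟩
    rw [h]
    exact (isOpenQuotientMap_toQJ.isOpenMap _
      (isOpen_ne_collision.isOpenMap_subtype_val _ hU)).preimage continuous_subtype_val

/-- The homothety class, up to rotations about the axis, and the moment of inertia. -/
def sizeMap (J₀ : E 3) (x : OTriStar m) : SJ m J₀ × PosR :=
  (toSJ J₀ (starDiffeo x).1, (starDiffeo x).2)

omit hJ in
theorem isOpenQuotientMap_sizeMap : IsOpenQuotientMap (sizeMap (m := m) J₀) :=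
  (isOpenQuotientMap_toSJ.prodMap IsOpenQuotientMap.id).comp starHomeo.isOpenQuotientMap

omit hJ in
theorem toQJStar_eq_iff (x y : OTriStar m) :
    toQJStar J₀ x = toQJStar J₀ y ↔ sizeMap J₀ x = sizeMap J₀ y := by
  constructor
  · intro h
    obtain ⟨g, hg⟩ := Quotient.exact (congrArg Subtype.val h)
    have hg' : x = g.1 • y := Subtype.ext hg.symm
    rw [hg']
    refine Prod.ext ?_ (Subtype.ext (inertia_rot g.1 y.1))
    change toSJ J₀ (g.1 • y).normalize = toSJ J₀ y.normalize
    rw [normalize_rot, toSJ_rot]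
  · intro h
    obtain ⟨g, hg⟩ := Quotient.exact (congrArg Prod.fst h)
    have h1 : (g.1 • y).normalize = x.normalize := by rw [normalize_rot]; exact hg
    have h2 : inertia (g.1 • y).1 = inertia x.1 := by
      refine (inertia_rot g.1 y.1).trans ?_
      exact (congrArg (fun p : SJ m J₀ × PosR => (p.2 : ℝ)) h).symm
    have h3 : g.1 • y = x := starHomeo.injective (Prod.ext h1 (Subtype.ext h2))
    refine Subtype.ext (Quotient.sound ⟨g, ?_⟩)
    exact congrArg Subtype.val h3

variable (m J₀) in
/-- The reduced configuration space without the triple collision is a product. -/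
def phiHomeo : QJStar m J₀ ≃ₜ SJ m J₀ × PosR :=
  (exists_homeomorph_of_isQuotientMap isOpenQuotientMap_toQJStar.isQuotientMap
    isOpenQuotientMap_sizeMap.isQuotientMap toQJStar_eq_iff).choose

omit hJ in
theorem phiHomeo_toQJStar (x : OTriStar m) : phiHomeo m J₀ (toQJStar J₀ x) = sizeMap J₀ x :=
  (exists_homeomorph_of_isQuotientMap isOpenQuotientMap_toQJStar.isQuotientMap
    isOpenQuotientMap_sizeMap.isQuotientMap toQJStar_eq_iff).choose_spec x

instance : ChartedSpace (E 5) (QJStar m J₀) :=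
  homeoCharted ((𝓡 4).prod 𝓘(ℝ, ℝ)) (lineEquiv 4) (phiHomeo m J₀)

instance : IsManifold (𝓡 5) ∞ (QJStar m J₀) :=
  homeoCharted_isManifold (lineEquiv 4) (phiHomeo m J₀)

variable (m J₀) in
/-- The reduced configuration space without the triple collision is a product. -/
def phiDiffeo : QJStar m J₀ ≃ₘ⟮𝓡 5, (𝓡 4).prod 𝓘(ℝ, ℝ)⟯ (SJ m J₀ × PosR) :=
  homeoCharted_diffeomorph (lineEquiv 4) (phiHomeo m J₀)

theorem phiDiffeo_toQJStar (x : OTriStar m) : phiDiffeo m J₀ (toQJStar J₀ x) =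
    (toSJ J₀ (starDiffeo x).1, (starDiffeo x).2) := phiHomeo_toQJStar x

theorem contMDiff_toQJStar : ContMDiff (𝓡 6) (𝓡 5) ∞ (toQJStar (m := m) J₀) := by
  intro x
  have h0 : ContMDiffAt (𝓡 6) ((𝓡 5).prod 𝓘(ℝ, ℝ)) ∞ (starDiffeo (m := m)) x :=
    (starDiffeo (m := m)).contMDiff.contMDiffAt
  have h1 : ContMDiffAt (𝓡 6) (𝓡 5) ∞ (fun x : OTriStar m => (starDiffeo x).1) x :=
    contMDiffAt_fst.comp x h0
  have h2 : ContMDiffAt (𝓡 6) 𝓘(ℝ, ℝ) ∞ (fun x : OTriStar m => (starDiffeo x).2) x :=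
    contMDiffAt_snd.comp x h0
  have h3 : ContMDiffAt (𝓡 6) (𝓡 4) ∞ (fun x : OTriStar m => toSJ J₀ (starDiffeo x).1) x :=
    contMDiff_toSJ.contMDiffAt.comp x h1
  have h4 := (phiDiffeo m J₀).symm.contMDiff.contMDiffAt.comp x (h3.prodMk h2)
  refine h4.congr_of_eventuallyEq (Filter.Eventually.of_forall fun y => ?_)
  change _ = (phiDiffeo m J₀).symm (toSJ J₀ (starDiffeo y).1, (starDiffeo y).2)
  rw [← phiDiffeo_toQJStar, (phiDiffeo m J₀).symm_apply_apply]

theorem isSubmersion_toQJStar : IsSubmersion (𝓡 6) (𝓡 5) ∞ (toQJStar (m := m) J₀) := by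
  refine isSubmersion_of_sections contMDiff_toQJStar fun x => ?_
  obtain ⟨σ, hσx, hσ, hσ'⟩ := exists_section_toSJ (J₀ := J₀) (starDiffeo x).1
  set q₀ := toQJStar J₀ x
  have h0 : ContMDiffAt (𝓡 5) ((𝓡 4).prod 𝓘(ℝ, ℝ)) ∞ (phiDiffeo m J₀) q₀ :=
    (phiDiffeo m J₀).contMDiff.contMDiffAt
  have hq : phiDiffeo m J₀ q₀ = (toSJ J₀ (starDiffeo x).1, (starDiffeo x).2) :=
    phiDiffeo_toQJStar x
  have h1 : ContMDiffAt (𝓡 5) (𝓡 4) ∞ (fun q => (phiDiffeo m J₀ q).1) q₀ :=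
    contMDiffAt_fst.comp q₀ h0
  have h2 : ContMDiffAt (𝓡 5) 𝓘(ℝ, ℝ) ∞ (fun q => (phiDiffeo m J₀ q).2) q₀ :=
    contMDiffAt_snd.comp q₀ h0
  have hσ1 : ContMDiffAt (𝓡 4) (𝓡 5) ∞ σ (phiDiffeo m J₀ q₀).1 := by rw [hq]; exact hσ
  have h3 : ContMDiffAt (𝓡 5) (𝓡 5) ∞ (fun q => σ (phiDiffeo m J₀ q).1) q₀ :=
    ContMDiffAt.comp q₀ (g := σ) hσ1 h1
  have h4 : ContMDiffAt (𝓡 5) (𝓡 6) ∞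
      (fun q => starDiffeo.symm (σ (phiDiffeo m J₀ q).1, (phiDiffeo m J₀ q).2)) q₀ :=
    (starDiffeo (m := m)).symm.contMDiff.contMDiffAt.comp q₀ (h3.prodMk h2)
  refine ⟨_, ?_, h4, ?_⟩
  · rw [hq, hσx, Prod.mk.eta, starDiffeo.symm_apply_apply]
  · have h5 : Filter.Tendsto (fun q => (phiDiffeo m J₀ q).1) (𝓝 q₀)
        (𝓝 (toSJ J₀ (starDiffeo x).1)) := by
      have := h1.continuousAt.tendsto
      rwa [hq] at this
    filter_upwards [h5.eventually hσ'] with q hq'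
    refine (phiDiffeo m J₀).injective ?_
    change phiDiffeo m J₀ (toQJStar J₀ _) = phiDiffeo m J₀ q
    rw [phiDiffeo_toQJStar, starDiffeo.apply_symm_apply, hq', Prod.mk.eta]

/-! ### The bundles -/

omit hJ in
theorem isSmoothPrincipalBundle_toShape :
    IsSmoothPrincipalBundle (𝓡 5) (𝓡 2) (𝓡 3) SO3 (toShape (m := m)) := by
  refine ⟨⟨contMDiff_rot⟩, fun b => ?_⟩
  obtain ⟨i, hi⟩ := exists_mem_dom b
  refine ⟨⟨trivS5 i, dom m i, isOpen_dom i, ?_, rfl, fun _ _ => rfl⟩, hi, contMDiffOn_trivS5 i, ?_⟩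
  · ext s
    exact toShape_mem_dom.symm
  · intro s hs g
    have hz : s.z i ≠ 0 := hs
    refine ⟨?_, Prod.ext (toShape_rot g s) (S5.frame_rot hz g)⟩
    change (g • s).z i ≠ 0
    rwa [S5.rot_z, Ne, rot_eq_zero_iff]

theorem isSmoothFiberBundle_toShape :
    IsSmoothFiberBundle (𝓡 4) (𝓡 2) (𝓡 2) S2 (SJ.toShape (m := m) (J₀ := J₀)) := by
  intro b
  obtain ⟨i, hi⟩ := exists_mem_dom b
  set e := (thetaHomeo m hJ.out).toOpenPartialHomeomorph ≫ₕ trivAssoc i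
  have he : e.source = SJ.toShape ⁻¹' dom m i := by
    ext x
    simp only [e, mfld_simps, mem_preimage, trivAssoc_source]
    have : (thetaHomeo m hJ.out x).toShape = x.toShape := thetaDiffeo_toShape x
    rw [this]
  have he' : e.target = dom m i ×ˢ univ := by
    simp only [e, mfld_simps]
    rfl
  refine ⟨⟨e, dom m i, isOpen_dom i, he, he', ?_⟩, hi, ?_, ?_⟩
  · intro x hx
    rw [he] at hx
    have h : (thetaDiffeo m J₀ x).toShape ∈ dom m i := by rw [thetaDiffeo_toShape]; exact hx
    exact (assocCoord_fst h).trans (thetaDiffeo_toShape x)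
  · change ContMDiffOn _ _ _ e e.source
    rw [he]
    intro x hx
    have h : (thetaDiffeo m J₀ x).toShape ∈ dom m i := by rw [thetaDiffeo_toShape]; exact hx
    have h1 := (contMDiffAt_assocCoord h).comp x (thetaDiffeo m J₀).contMDiff.contMDiffAt
    exact h1.contMDiffWithinAt
  · change ContMDiffOn _ _ _ e.symm e.target
    rw [he']
    intro p hp
    have h1 := (thetaDiffeo m J₀).symm.contMDiff.contMDiffAt.comp p
      (contMDiffAt_toAssoc_section hp.1)
    exact h1.contMDiffWithinAt

end Reduced

/-! ### The bundle of frames of `γ ⊕ ε` -/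

section Frames

variable {m : Fin 3 → ℝ}

/-- The two Jacobi vectors, in the order of the coordinates of `ℂ²`. -/
def jacobiIndex : Fin 2 → Bool := ![true, false]

/-- The vector `x + i n × x` of `ℂ³`. For `x` orthogonal to `n`, it is a multiple of `a + i b`, for
any oriented orthonormal basis `(a, b)` of the plane orthogonal to `n`. -/
def complexify (n x : E 3) (k : Fin 3) : ℂ := (x k : ℂ) + (cross n x k : ℂ) * Complex.I

/-- The triple of vectors of `ℂ² ⊕ ℝ` that is defined by an oriented triangle. -/
def triple (m : Fin 3 → ℝ) (p : Ambient) : Triples := fun k =>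
  (fun l => complexify p.2 (jacobi m p (jacobiIndex l)) k, p.2 k)

theorem contDiff_triple : ContDiff ℝ ∞ (triple m) := by
  rw [contDiff_pi]
  intro k
  have h2 : ContDiff ℝ ∞ (fun p : Ambient => p.2 k) := by fun_prop
  refine ContDiff.prodMk ?_ h2
  rw [contDiff_pi]
  intro l
  have h1 : ContDiff ℝ ∞ (fun p => jacobi m p (jacobiIndex l)) := contDiff_jacobi m _
  have h3 : ContDiff ℝ ∞ (fun p : Ambient => (p.2, jacobi m p (jacobiIndex l))) :=
    contDiff_snd.prodMk h1
  have h4 : ContDiff ℝ ∞ (fun p : Ambient => cross p.2 (jacobi m p (jacobiIndex l))) :=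
    contDiff_cross.comp h3
  have h5 : ContDiff ℝ ∞ (fun p : Ambient => jacobi m p (jacobiIndex l) k) :=
    contDiff_euclidean.mp h1 k
  have h6 : ContDiff ℝ ∞ (fun p : Ambient => cross p.2 (jacobi m p (jacobiIndex l)) k) :=
    contDiff_euclidean.mp h4 k
  have h7 := Complex.ofRealCLM.contDiff.comp h5
  have h8 := Complex.ofRealCLM.contDiff.comp h6
  exact h7.add (h8.mul contDiff_const)

/-- The triangle that is determined by a triple of vectors of `ℂ² ⊕ ℝ`. -/
def untriple (m : Fin 3 → ℝ) (t : Triples) : Ambient :=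
  (unjacobi m fun i => WithLp.toLp 2 fun k => ((t k).1 (if i then 0 else 1)).re,
    WithLp.toLp 2 fun k => (t k).2)

theorem contDiff_untriple : ContDiff ℝ ∞ (untriple m) := by
  have h1 : ContDiff ℝ ∞ (fun t : Triples => fun i : Bool =>
      (WithLp.toLp 2 fun k => ((t k).1 (if i then 0 else 1)).re : E 3)) := by
    rw [contDiff_pi]
    intro i
    refine contDiff_toLp.comp ?_
    rw [contDiff_pi]
    intro k
    have h : ContDiff ℝ ∞ (fun t : Triples => (t k).1 (if i then 0 else 1)) := by fun_prop
    exact Complex.reCLM.contDiff.comp h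
  have h2 : ContDiff ℝ ∞ (fun t : Triples => (WithLp.toLp 2 fun k => (t k).2 : E 3)) := by
    refine contDiff_toLp.comp ?_
    fun_prop
  have h3 := (contDiff_unjacobi m).comp h1
  exact h3.prodMk h2

theorem complexify_re (n x : E 3) (k : Fin 3) : (complexify n x k).re = x k := by
  simp [complexify]

/-- The triple of vectors of `ℂ² ⊕ ℝ` that is defined by an oriented triangle. -/
def frameMap (s : S5 m) : Triples := triple m s.val

theorem frameMap_apply (s : S5 m) (k : Fin 3) :
    frameMap s k = (fun l => complexify s.n (s.z (jacobiIndex l)) k, s.n k) := rfl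

theorem complexify_rot (g : SO3) (n x : E 3) (k : Fin 3) :
    complexify (g • n) (g • x) k = ∑ j, g.1 k j • complexify n x j := by
  have h : ∀ j, entries g k j = g.1 k j := fun j => rfl
  rw [complexify, ← rot_cross, rot_apply, rot_apply, Fin.sum_univ_three]
  simp only [complexify, Complex.real_smul, h]
  push_cast
  ring

theorem frameMap_rot (g : SO3) (s : S5 m) (i : Fin 3) :
    frameMap (g • s) i = ∑ j, g.1 i j • frameMap s j := by
  simp only [frameMap_apply, S5.rot_z, S5.rot_n]
  refine Prod.ext (funext fun l => ?_) ?_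
  · rw [Prod.fst_sum, Finset.sum_apply]
    exact complexify_rot g _ _ i
  · rw [Prod.snd_sum, rot_apply, Fin.sum_univ_three]
    rfl

/-- The conjugates of the complex numbers `x₀ + i x₁` that represent the Jacobi vectors of a
triangle in the horizontal plane. -/
def conjCoord (s : S5 m) (l : Fin 2) : ℂ :=
  (s.z (jacobiIndex l) 0 : ℂ) - (s.z (jacobiIndex l) 1 : ℂ) * Complex.I

/-- The triple of a rotated triangle in the horizontal plane. -/
theorem frameMap_horizontal {s : S5 m} (hn : s.n = e 2) (g : SO3) (i : Fin 3) :
    frameMap (g • s) i =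
      (((g.1 i 0 : ℂ) + (g.1 i 1 : ℂ) * Complex.I) • conjCoord s, g.1 i 2) := by
  have hz : ∀ j, s.z j 2 = 0 := fun j => by
    have h := s.inner_z_n j
    rw [hn, inner_eq] at h
    simpa [e_apply] using h
  rw [frameMap_rot, Fin.sum_univ_three]
  simp only [frameMap_apply, hn]
  refine Prod.ext (funext fun l => ?_) ?_
  · simp [complexify, conjCoord, e_apply, hz]
    linear_combination (g.1 i 1 * s.z (jacobiIndex l) 1 : ℂ) * Complex.I_sq
  · simp [e_apply]

variable [hm : Fact (∀ a, 0 < m a)]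

theorem untriple_frameMap (s : S5 m) : untriple m (frameMap s) = s.val := by
  have h : (fun i => WithLp.toLp 2 fun k => ((frameMap s k).1 (if i then 0 else 1)).re :
      Bool → E 3) = s.z := by
    funext i
    ext k
    cases i
    · exact complexify_re _ _ _
    · exact complexify_re _ _ _
  refine Prod.ext ?_ rfl
  rw [← s.unjacobi_z, ← h]
  rfl

/-- The linear map `untriple` on the ambient space recovers the triangle, so that retractions for
`S̃⁵` give retractions for the frames. -/
theorem isSmoothEmbedding_frameMap :
    IsSmoothEmbedding (𝓡 5) 𝓘(ℝ, Triples) ∞ (frameMap (m := m)) := by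
  have h1 : ContMDiff (𝓡 5) 𝓘(ℝ, Triples) ∞ (frameMap (m := m)) := fun s =>
    smooth_comp (F := triple m) (h := S5.val) contDiff_triple.contDiffAt contMDiff_val.contMDiffAt
  have h2 : untriple m ∘ frameMap (m := m) = S5.val := funext untriple_frameMap
  refine ⟨isImmersion_of_retractions h1 fun s => ?_, ?_⟩
  · obtain ⟨r, hr, hr'⟩ := hasSmoothRetractions_val s
    refine ⟨fun t => r (untriple m t), ?_, ?_⟩
    · have h : ContMDiffAt 𝓘(ℝ, Ambient) (𝓡 5) ∞ r (untriple m (frameMap s)) := by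
        rw [untriple_frameMap]; exact hr
      exact h.comp _ contDiff_untriple.contMDiff.contMDiffAt
    · filter_upwards [hr'] with t ht
      rw [untriple_frameMap, ht]
  · refine IsEmbedding.of_comp h1.continuous (contDiff_untriple (m := m)).continuous ?_
    rw [h2]
    exact isEmbedding_S5

/-- Every oriented triangle is a rotation of one in the horizontal plane, whose triple is the
standard frame of the fiber of `γ ⊕ ε` at the line that the complex Jacobi coordinates span. -/
theorem range_frameMap : Set.range (frameMap (m := m)) = frameBundle := by
  have hsq : ∀ a b : ℝ, ‖(a : ℂ) - (b : ℂ) * Complex.I‖ ^ 2 = a ^ 2 + b ^ 2 := fun a b => by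
    rw [← Complex.normSq_eq_norm_sq, Complex.normSq_apply]
    simp
    ring
  ext t
  constructor
  · rintro ⟨s, rfl⟩
    obtain ⟨i, hi⟩ := s.exists_z_ne_zero
    have hs := frame_smul_section hi
    have hn : (localSection i (toShape s)).n = e 2 := sec_n _ _
    refine ⟨conjCoord (localSection i (toShape s)), s.frame i, ?_, fun k => ?_⟩
    rotate_left
    · rw [← frameMap_horizontal hn, hs]
    · have h := (localSection i (toShape s)).norm_z
      have h0 : ∀ j, (localSection i (toShape s)).z j 2 = 0 := fun j => by
        have h := (localSection i (toShape s)).inner_z_n j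
        rw [hn, inner_eq] at h
        simpa [e_apply] using h
      rw [norm_sq_eq, norm_sq_eq, h0, h0] at h
      rw [Fin.sum_univ_two, conjCoord, conjCoord, hsq, hsq]
      simp only [jacobiIndex, Matrix.cons_val_zero, Matrix.cons_val_one]
      linarith
  · rintro ⟨v, A, hv, ht⟩
    set z : Bool → E 3 := fun i => !₂[(v (if i then 0 else 1)).re, -(v (if i then 0 else 1)).im, 0]
    have hn : ∀ i, inner ℝ (z i) (e 2) = 0 := fun i => by
      rw [inner_eq]; simp [z, e_apply]
    have hz : ‖z true‖ ^ 2 + ‖z false‖ ^ 2 = 1 := by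
      rw [Fin.sum_univ_two, ← Complex.normSq_eq_norm_sq, ← Complex.normSq_eq_norm_sq,
        Complex.normSq_apply, Complex.normSq_apply] at hv
      rw [norm_sq_eq, norm_sq_eq]
      simp [z]
      linarith
    set s := S5.ofJacobi m z (e 2) (norm_e 2) hn hz
    refine ⟨A • s, funext fun k => ?_⟩
    rw [frameMap_horizontal (s := s) rfl, ht]
    suffices h : conjCoord s = v by rw [h]
    funext l
    have hl : s.z (jacobiIndex l) = z (jacobiIndex l) := S5.ofJacobi_z _ _ _ _ _ _
    rw [conjCoord, hl]
    fin_cases l <;> simp [z, jacobiIndex]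

end Frames

/-! ### The double cover of the rotation group -/

open scoped Quaternion

/-- The group of unit quaternions. -/
abbrev UnitQuat : Type := Metric.sphere (0 : ℍ[ℝ]) 1

/-- The matrix of `x ↦ q x q̄` on the imaginary quaternions. -/
def quatEntries (q : ℍ[ℝ]) : Mat3 := fun i j =>
  (!![q.re ^ 2 + q.imI ^ 2 - q.imJ ^ 2 - q.imK ^ 2, 2 * (q.imI * q.imJ - q.re * q.imK),
      2 * (q.imI * q.imK + q.re * q.imJ);
    2 * (q.imI * q.imJ + q.re * q.imK), q.re ^ 2 - q.imI ^ 2 + q.imJ ^ 2 - q.imK ^ 2,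
      2 * (q.imJ * q.imK - q.re * q.imI);
    2 * (q.imI * q.imK - q.re * q.imJ), 2 * (q.imJ * q.imK + q.re * q.imI),
      q.re ^ 2 - q.imI ^ 2 - q.imJ ^ 2 + q.imK ^ 2] : Matrix (Fin 3) (Fin 3) ℝ) i j

theorem quat_norm_sq (q : ℍ[ℝ]) : q.re ^ 2 + q.imI ^ 2 + q.imJ ^ 2 + q.imK ^ 2 = ‖q‖ ^ 2 := by
  rw [← Quaternion.normSq_def', pow_two, Quaternion.normSq_eq_norm_mul_self]

theorem unitQuat_sq (q : UnitQuat) :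
    q.1.re ^ 2 + q.1.imI ^ 2 + q.1.imJ ^ 2 + q.1.imK ^ 2 = 1 := by
  rw [quat_norm_sq, mem_sphere_zero_iff_norm.mp q.2, one_pow]

/-- The rotation defined by a unit quaternion. -/
def quatRot (q : UnitQuat) : SO3 :=
  SO3.ofEntries (quatEntries q.1)
    (by
      have h := unitQuat_sq q
      generalize q.1 = p at h
      intro i j
      fin_cases i <;> fin_cases j <;> simp [quatEntries, Fin.sum_univ_three]
      · linear_combination (p.re ^ 2 + p.imI ^ 2 + p.imJ ^ 2 + p.imK ^ 2 + 1) * h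
      · ring
      · ring
      · ring
      · linear_combination (p.re ^ 2 + p.imI ^ 2 + p.imJ ^ 2 + p.imK ^ 2 + 1) * h
      · ring
      · ring
      · ring
      · linear_combination (p.re ^ 2 + p.imI ^ 2 + p.imJ ^ 2 + p.imK ^ 2 + 1) * h)
    (by
      have h := unitQuat_sq q
      generalize q.1 = p at h
      simp [quatEntries]
      have h3 : (p.re ^ 2 + p.imI ^ 2 + p.imJ ^ 2 + p.imK ^ 2) ^ 3 = 1 := by rw [h, one_pow]
      refine Eq.trans ?_ h3
      ring)

theorem entries_quatRot (q : UnitQuat) : entries (quatRot q) = quatEntries q.1 :=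
  entries_ofEntries ..

theorem quatEntries_mul (p q : ℍ[ℝ]) :
    quatEntries (p * q) = matMul (quatEntries p) (quatEntries q) := by
  funext i j
  fin_cases i <;> fin_cases j <;> simp [quatEntries, matMul, Fin.sum_univ_three] <;> ring

/-- The double cover of the rotation group by the unit quaternions. -/
def quatHom : UnitQuat →* SO3 where
  toFun := quatRot
  map_one' := by
    apply entries_injective
    rw [entries_quatRot]
    funext i j
    rw [entries_one]
    fin_cases i <;> fin_cases j <;> simp [quatEntries]
  map_mul' p q := by
    apply entries_injective
    rw [entries_mul', entries_quatRot, entries_quatRot, entries_quatRot, ← quatEntries_mul]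
    rfl

theorem entries_quatHom (q : UnitQuat) : entries (quatHom q) = quatEntries q.1 := entries_quatRot q

/-- The quaternion `a + b i + c j + d k`. -/
def quatMk (a b c d : ℝ) : ℍ[ℝ] := ⟨a, b, c, d⟩

@[simp] theorem quatMk_re (a b c d : ℝ) : (quatMk a b c d).re = a := rfl

@[simp] theorem quatMk_imI (a b c d : ℝ) : (quatMk a b c d).imI = b := rfl

@[simp] theorem quatMk_imJ (a b c d : ℝ) : (quatMk a b c d).imJ = c := rfl

@[simp] theorem quatMk_imK (a b c d : ℝ) : (quatMk a b c d).imK = d := rfl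

/-- The unit quaternion `a + b i + c j + d k`. -/
def quatOf (a b c d : ℝ) (h : a ^ 2 + b ^ 2 + c ^ 2 + d ^ 2 = 1) : UnitQuat :=
  ⟨quatMk a b c d, by
    rw [mem_sphere_zero_iff_norm, ← pow_eq_one_iff_of_nonneg (norm_nonneg _) two_ne_zero,
      ← quat_norm_sq]
    exact h⟩

theorem rodrigues_mem_range (r : E 3) : rodrigues r ∈ quatHom.range := by
  set D := 1 + (r 0 ^ 2 + r 1 ^ 2 + r 2 ^ 2) with hD
  have hD0 : 0 < D := by positivity
  have hs : (√D)⁻¹ ^ 2 = D⁻¹ := by rw [inv_pow, Real.sq_sqrt hD0.le]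
  refine ⟨quatOf (√D)⁻¹ ((√D)⁻¹ * r 0) ((√D)⁻¹ * r 1) ((√D)⁻¹ * r 2) ?_, ?_⟩
  · rw [mul_pow, mul_pow, mul_pow, hs]
    field_simp
    rw [hD]; ring
  · apply entries_injective
    rw [entries_quatHom]
    funext i j
    rw [rodrigues, entries_ofEntries]
    fin_cases i <;> fin_cases j <;> simp [quatEntries, rodriguesEntries, quatOf, ← hD] <;>
      rw [← hs] <;> ring

/-- By the Rodrigues formula the image contains all rotations that are not half-turns; a rotation
outside of the image remains outside of it after composition with the half-turns about the
coordinate axes, which is absurd. -/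
theorem surjective_quatHom : Function.Surjective quatHom := by
  have key : ∀ g : SO3, 1 + tr (entries g) ≠ 0 → g ∈ quatHom.range := fun g hg => by
    rw [← rodrigues_cayley g hg]
    exact rodrigues_mem_range _
  intro g
  change g ∈ quatHom.range
  by_contra h
  -- the half-turns about the coordinate axes
  have hd : ∀ q : UnitQuat, 1 + tr (entries (g * quatHom q)) = 0 := fun q => by
    by_contra hq
    have := mul_mem (key _ hq) (inv_mem (MonoidHom.mem_range.mpr ⟨q, rfl⟩))
    rw [mul_inv_cancel_right] at this
    exact h this
  have h0 := hd (quatOf 1 0 0 0 (by norm_num))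
  have h1 := hd (quatOf 0 1 0 0 (by norm_num))
  have h2 := hd (quatOf 0 0 1 0 (by norm_num))
  have h3 := hd (quatOf 0 0 0 1 (by norm_num))
  simp only [tr, entries_mul, Fin.sum_univ_three, entries_quatHom] at h0 h1 h2 h3
  simp [quatEntries, quatOf] at h0 h1 h2 h3
  linarith

theorem continuous_quatHom : Continuous quatHom := by
  rw [isEmbedding_entries.continuous_iff]
  have h : entries ∘ quatHom = fun q : UnitQuat => quatEntries q.1 := funext entries_quatHom
  rw [h]
  have hr : Continuous (fun q : UnitQuat => q.1.re) :=
    Quaternion.continuous_re.comp continuous_subtype_val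
  have hi : Continuous (fun q : UnitQuat => q.1.imI) :=
    Quaternion.continuous_imI.comp continuous_subtype_val
  have hj : Continuous (fun q : UnitQuat => q.1.imJ) :=
    Quaternion.continuous_imJ.comp continuous_subtype_val
  have hk : Continuous (fun q : UnitQuat => q.1.imK) :=
    Quaternion.continuous_imK.comp continuous_subtype_val
  refine continuous_pi fun i => continuous_pi fun j => ?_
  fin_cases i <;> fin_cases j <;> simp [quatEntries] <;> fun_prop

theorem finite_ker_quatHom : (quatHom.ker : Set UnitQuat).Finite := by
  refine Set.Finite.subset (Set.toFinite {1, -1}) ?_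
  intro q hq
  have h : entries (quatHom q) = entries 1 := congrArg entries hq
  rw [entries_quatHom] at h
  have h0 := congrFun (congrFun h 0) 0
  have h1 := congrFun (congrFun h 1) 1
  have h2 := congrFun (congrFun h 2) 2
  have hn := unitQuat_sq q
  rw [entries_one] at h0 h1 h2
  simp [quatEntries] at h0 h1 h2
  have hi : q.1.imI = 0 := by nlinarith
  have hj : q.1.imJ = 0 := by nlinarith
  have hk : q.1.imK = 0 := by nlinarith
  have hr : (q.1.re - 1) * (q.1.re + 1) = 0 := by rw [hi, hj, hk] at hn; linarith
  rcases mul_eq_zero.mp hr with h | h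
  · left
    exact Subtype.ext (Quaternion.ext _ _ (by simpa using sub_eq_zero.mp h) hi hj hk)
  · right
    refine Subtype.ext (Quaternion.ext _ _ ?_ ?_ ?_ ?_)
    · change q.1.re = -1
      linarith
    · change q.1.imI = -0
      rw [hi, neg_zero]
    · change q.1.imJ = -0
      rw [hj, neg_zero]
    · change q.1.imK = -0
      rw [hk, neg_zero]

theorem isCoveringMap_quatHom : IsCoveringMap quatHom := by
  have h : IsQuotientMap quatHom :=
    continuous_quatHom.isClosedMap.isQuotientMap continuous_quatHom surjective_quatHom
  exact (h.isQuotientCoveringMap_of_isDiscrete_ker_monoidHom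
    finite_ker_quatHom.isDiscrete).isCoveringMap

/-- The full turn about the third axis is not null-homotopic: the lift of the loop of rotations to
the unit quaternions ends at `-1`. -/
theorem not_exists_disc {K : ℂ → SO3} (hK : Continuous K)
    (h : ∀ θ : ℝ, entries (K (Complex.exp (θ * Complex.I))) =
      ![![Real.cos θ, -Real.sin θ, 0], ![Real.sin θ, Real.cos θ, 0], ![0, 0, 1]]) : False := by
  set q : ℝ → UnitQuat := fun θ => quatOf (Real.cos (θ / 2)) 0 0 (Real.sin (θ / 2)) (by
    have := Real.cos_sq_add_sin_sq (θ / 2)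
    linarith)
  have hqc : Continuous q := by
    refine Continuous.subtype_mk ?_ _
    have h1 : (fun θ : ℝ => quatMk (Real.cos (θ / 2)) 0 0 (Real.sin (θ / 2))) = fun θ =>
        Real.cos (θ / 2) • (1 : ℍ[ℝ]) + Real.sin (θ / 2) • quatMk 0 0 0 1 := by
      funext θ
      ext <;> simp
    rw [h1]
    fun_prop
  have hq : ∀ θ, quatHom (q θ) = K (Complex.exp (θ * Complex.I)) := fun θ => by
    apply entries_injective
    rw [h, entries_quatHom]
    have hc : Real.cos θ = Real.cos (θ / 2) ^ 2 - Real.sin (θ / 2) ^ 2 := by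
      rw [← Real.cos_two_mul', mul_div_cancel₀ _ two_ne_zero]
    have hs : Real.sin θ = 2 * Real.sin (θ / 2) * Real.cos (θ / 2) := by
      rw [← Real.sin_two_mul, mul_div_cancel₀ _ two_ne_zero]
    have h1 := Real.cos_sq_add_sin_sq (θ / 2)
    funext i j
    rw [hc, hs]
    fin_cases i <;> fin_cases j <;> simp [quatEntries, q, quatOf] <;> linarith
  obtain ⟨L, ⟨hL0, hL⟩, -⟩ := isCoveringMap_quatHom.existsUnique_continuousMap_lifts ⟨K, hK⟩
    1 (q 0) (by rw [hq]; simp)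
  have hE : Continuous (fun θ : ℝ => Complex.exp (θ * Complex.I)) := by fun_prop
  have h1 : (fun θ : ℝ => L (Complex.exp (θ * Complex.I))) = q := by
    refine isCoveringMap_quatHom.eq_of_comp_eq (L.continuous.comp hE) hqc ?_ 0 (by simpa using hL0)
    funext θ
    exact (congrFun hL _).trans (hq θ).symm
  have h2 := congrFun h1 (2 * Real.pi)
  have h3 : L 1 = q (2 * Real.pi) := by simpa using h2
  rw [hL0] at h3
  have h4 := congrArg (fun p : UnitQuat => p.1.re) h3
  simp [q, quatOf] at h4
  norm_num at h4

/-! ### Nontriviality -/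

section Nontrivial

/-- A complex number, as a vector in the horizontal plane. -/
def planeVec (a : ℂ) : E 3 := !₂[a.re, a.im, 0]

theorem norm_planeVec_sq (a : ℂ) : ‖planeVec a‖ ^ 2 = Complex.normSq a := by
  rw [norm_sq_eq, Complex.normSq_apply]
  simp [planeVec]
  ring

theorem inner_planeVec (a : ℂ) : inner ℝ (planeVec a) (e 2) = 0 := by
  rw [inner_eq]
  simp [planeVec, e_apply]

theorem continuous_planeVec : Continuous planeVec := by
  have h : Continuous (fun a : ℂ => ![a.re, a.im, 0]) := by
    refine continuous_pi fun i => ?_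
    fin_cases i
    · exact Complex.continuous_re
    · exact Complex.continuous_im
    · exact continuous_const
  exact contDiff_toLp.continuous.comp h

/-- The rotation by the angle `θ` about the third axis. -/
def rotZ (θ : ℝ) : SO3 :=
  SO3.ofEntries ![![Real.cos θ, -Real.sin θ, 0], ![Real.sin θ, Real.cos θ, 0], ![0, 0, 1]]
    (by
      have h := Real.cos_sq_add_sin_sq θ
      intro i j
      fin_cases i <;> fin_cases j <;> simp [Fin.sum_univ_three] <;> linarith)
    (by
      have h := Real.cos_sq_add_sin_sq θ
      simp
      linarith)

theorem rotZ_e2 (θ : ℝ) : rotZ θ • e 2 = e 2 := by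
  refine ext3 ?_ ?_ ?_ <;> simp [rot_apply, rotZ, e_apply]

theorem rotZ_planeVec (θ : ℝ) (a : ℂ) :
    rotZ θ • planeVec a = planeVec (Complex.exp (θ * Complex.I) * a) := by
  have h : ∀ x : ℝ, (Complex.exp (x * Complex.I)).re = Real.cos x := Complex.exp_ofReal_mul_I_re
  have h' : ∀ x : ℝ, (Complex.exp (x * Complex.I)).im = Real.sin x := Complex.exp_ofReal_mul_I_im
  refine ext3 ?_ ?_ ?_ <;> simp [rot_apply, rotZ, planeVec, h, h'] <;> ring

variable {m : Fin 3 → ℝ} [hm : Fact (∀ a, 0 < m a)]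

/-- The triangle in the horizontal plane with given Jacobi vectors. -/
def planar (m : Fin 3 → ℝ) [Fact (∀ a, 0 < m a)] (a b : ℂ)
    (h : Complex.normSq a + Complex.normSq b = 1) : S5 m :=
  S5.ofJacobi m (fun i => planeVec (if i then a else b)) (e 2) (norm_e 2)
    (fun _ => inner_planeVec _) (by rw [norm_planeVec_sq, norm_planeVec_sq]; exact h)

theorem planar_z {a b : ℂ} (h) (i : Bool) : (planar m a b h).z i = planeVec (if i then a else b) :=
  S5.ofJacobi_z _ _ _ _ _ _

theorem rotZ_planar (θ : ℝ) {a b a' b' : ℂ} (h h') (ha : a' = Complex.exp (θ * Complex.I) * a)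
    (hb : b' = Complex.exp (θ * Complex.I) * b) :
    rotZ θ • planar m a b h = planar m a' b' h' := by
  refine S5.ext_z (fun i => ?_) (rotZ_e2 θ)
  rw [S5.rot_z, planar_z, planar_z, rotZ_planeVec]
  cases i <;> simp [ha, hb]

theorem continuous_planar {X : Type} [TopologicalSpace X] {a b : X → ℂ} (ha : Continuous a)
    (hb : Continuous b) (h : ∀ x, Complex.normSq (a x) + Complex.normSq (b x) = 1) :
    Continuous (fun x => planar m (a x) (b x) (h x)) := by
  rw [isEmbedding_S5.continuous_iff]
  have h1 : Continuous (fun x => fun i : Bool => planeVec (if i then a x else b x)) := by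
    refine continuous_pi fun i => continuous_planeVec.comp ?_
    cases i
    · exact hb
    · exact ha
  have h2 := (contDiff_unjacobi m).continuous.comp h1
  have h3 : Continuous (fun _ : X => e 2) := continuous_const
  exact h2.prodMk h3

/-- There is no continuous equivariant map from the oriented triangles to the rotations. Over the
two discs of similarity classes of planar triangles with `‖x‖ ≥ ‖y‖` and `‖x‖ ≤ ‖y‖`, the bundle has
sections that differ by a full turn along the common boundary. -/
theorem not_exists_equivariant {F : S5 m → SO3} (hF : Continuous F)
    (h : ∀ (g : SO3) (s : S5 m), F (g • s) = g * F s) : False := by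
  set N : ℂ → ℝ := fun c => √(1 + Complex.normSq c)
  have hN : ∀ c, 0 < N c := fun c =>
    Real.sqrt_pos.mpr (add_pos_of_pos_of_nonneg one_pos (Complex.normSq_nonneg c))
  have hN2 : ∀ c, N c * N c = 1 + Complex.normSq c := fun c =>
    Real.mul_self_sqrt (add_nonneg zero_le_one (Complex.normSq_nonneg c))
  have hNc : Continuous N :=
    Real.continuous_sqrt.comp (continuous_const.add Complex.continuous_normSq)
  have hNC : Continuous (fun c => (N c : ℂ)) := Complex.continuous_ofReal.comp hNc
  have hN0 : ∀ c, (N c : ℂ) ≠ 0 := fun c => Complex.ofReal_ne_zero.mpr (hN c).ne'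
  have h1 : ∀ c, Complex.normSq (1 / (N c : ℂ)) + Complex.normSq (c / (N c : ℂ)) = 1 := fun c => by
    rw [Complex.normSq_div, Complex.normSq_div, Complex.normSq_ofReal, hN2, Complex.normSq_one]
    have := Complex.normSq_nonneg c
    field_simp
  have h2 : ∀ c,
      Complex.normSq ((starRingEnd ℂ) c / (N c : ℂ)) + Complex.normSq (1 / (N c : ℂ)) = 1 :=
    fun c => by
      rw [Complex.normSq_div, Complex.normSq_conj, ← Complex.normSq_div, add_comm]
      exact h1 c
  -- Jacobi vectors proportional to `(1, c)` and to `(conj c, 1)`: sections over two discs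
  set P : ℂ → S5 m := fun c => planar m _ _ (h1 c)
  set M : ℂ → S5 m := fun c => planar m _ _ (h2 c)
  have hP : Continuous P := continuous_planar (continuous_const.div hNC hN0)
    (continuous_id.div hNC hN0) h1
  have hM : Continuous M := continuous_planar (Complex.continuous_conj.div hNC hN0)
    (continuous_const.div hNC hN0) h2
  refine not_exists_disc (K := fun c => F (P c) * (F (M c))⁻¹)
    ((hF.comp hP).mul (hF.comp hM).inv) fun θ => ?_
  set c := Complex.exp (θ * Complex.I)
  have hc : c * (starRingEnd ℂ) c = 1 := by
    rw [Complex.mul_conj, Complex.normSq_eq_norm_sq, Complex.norm_exp_ofReal_mul_I]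
    simp
  have hPM : P c = rotZ θ • M c := by
    refine (rotZ_planar θ _ _ ?_ ?_).symm
    · rw [← mul_div_assoc, hc]
    · rw [mul_one_div]
  rw [hPM, h, mul_inv_cancel_right]
  rfl

theorem not_isTrivialPrincipalBundle :
    ¬ IsTrivialPrincipalBundle SO3 (toShape (m := m)) := by
  rintro ⟨φ, hφ⟩
  exact not_exists_equivariant (F := fun s => (φ s).2) (continuous_snd.comp φ.continuous)
    fun g s => congrArg Prod.snd ((hφ s).2 g)

/-- The rotations act freely on the triangles, so that a point of the fiber of the associated bundle
over the shape of `s` is a point of the sphere. -/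
theorem toAssoc_right_cancel {s : S5 m} {u v : S2} (h : toAssoc (s, u) = toAssoc (s, v)) :
    u = v := by
  obtain ⟨g, hg⟩ := Quotient.exact h
  have h1 : g • s = s := congrArg Prod.fst hg
  have h2 : g • v = u := congrArg Prod.snd hg
  have h3 : g = 1 := S5.rot_left_cancel (h1.trans (one_smul SO3 s).symm)
  rw [← h2, h3, one_smul]

theorem toAssoc_frame_smul {i : Bool} {s : S5 m} (h : s.z i ≠ 0) {a : Assoc m}
    (ha : a.toShape = toShape s) : toAssoc (s, s.frame i • (assocCoord i a).2) = a := by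
  have hd : a.toShape ∈ dom m i := by rw [ha]; exact toShape_mem_dom.mpr h
  rw [← toAssoc_section h, inv_smul_smul, ← ha, ← assocCoord_fst hd]
  exact toAssoc_assocCoord hd

/-- A section of the associated bundle is an equivariant map to the sphere. -/
theorem exists_equivariant_of_section {a : Shape m → Assoc m} (ha : Continuous a)
    (h : ∀ b, (a b).toShape = b) : ∃ u : S5 m → S2, Continuous u ∧
      (∀ s, toAssoc (s, u s) = a (toShape s)) ∧ ∀ (g : SO3) (s : S5 m), u (g • s) = g • u s := by
  have h0 : ∀ s : S5 m, ∃ v, toAssoc (s, v) = a (toShape s) := fun s => by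
    obtain ⟨i, hi⟩ := s.exists_z_ne_zero
    exact ⟨_, toAssoc_frame_smul hi (h _)⟩
  choose u hu using h0
  refine ⟨u, ?_, hu, fun g s => ?_⟩
  · rw [continuous_iff_continuousAt]
    intro s
    obtain ⟨i, hi⟩ := s.exists_z_ne_zero
    have hd : (a (toShape s)).toShape ∈ dom m i := by rw [h]; exact toShape_mem_dom.mpr hi
    have h1 : ContinuousAt (fun t : S5 m => assocCoord i (a (toShape t))) s :=
      ContinuousAt.comp (g := assocCoord i) (f := fun t : S5 m => a (toShape t))
        (contMDiffAt_assocCoord hd).continuousAt (ha.comp continuous_toShape).continuousAt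
    have h2 : ContinuousAt (fun t : S5 m => t.frame i • (assocCoord i (a (toShape t))).2) s :=
      (continuousAt_frame hi).smul (continuousAt_snd.comp h1)
    refine h2.congr ?_
    filter_upwards [(isOpen_z_ne_zero i).mem_nhds hi] with t ht
    exact toAssoc_right_cancel ((toAssoc_frame_smul ht (h _)).trans (hu t).symm)
  · refine toAssoc_right_cancel (s := g • s) ?_
    rw [hu, toAssoc_rot, hu, toShape_rot]

/-- Three distinct points of a sphere are not collinear. -/
theorem cross_sub_ne_zero {a b c : S2} (hab : b ≠ a) (hac : c ≠ a) (hbc : c ≠ b) :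
    cross (b.1 - a.1) (c.1 - a.1) ≠ 0 := by
  intro h0
  set p := b.1 - a.1 with hp
  set q := c.1 - a.1 with hq
  have na : ‖a.1‖ = 1 := by simp
  have nb : ‖b.1‖ = 1 := by simp
  have nc : ‖c.1‖ = 1 := by simp
  have hP : 0 < ‖p‖ ^ 2 :=
    pow_pos (norm_pos_iff.mpr (sub_ne_zero.mpr fun h => hab (Subtype.ext h))) 2
  have hQ : 0 < ‖q‖ ^ 2 :=
    pow_pos (norm_pos_iff.mpr (sub_ne_zero.mpr fun h => hac (Subtype.ext h))) 2
  have hR : 0 < ‖q - p‖ ^ 2 := by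
    refine pow_pos (norm_pos_iff.mpr ?_) 2
    rw [hp, hq, sub_sub_sub_cancel_right]
    exact sub_ne_zero.mpr fun h => hbc (Subtype.ext h)
  have e1 : ‖p‖ ^ 2 + 2 * inner ℝ a.1 p = 0 := by
    have h : b.1 = a.1 + p := by rw [hp, add_sub_cancel]
    have h' := norm_add_sq_real a.1 p
    rw [← h, na, nb] at h'
    linarith
  have e2 : ‖q‖ ^ 2 + 2 * inner ℝ a.1 q = 0 := by
    have h : c.1 = a.1 + q := by rw [hq, add_sub_cancel]
    have h' := norm_add_sq_real a.1 q
    rw [← h, na, nc] at h'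
    linarith
  have e3 := norm_cross_sq p q
  rw [h0, norm_zero] at e3
  have e4 : ‖q - p‖ ^ 2 = ‖q‖ ^ 2 - 2 * inner ℝ p q + ‖p‖ ^ 2 := by
    rw [norm_sub_sq_real, real_inner_comm]
  have e5 : (‖p‖ ^ 2) • q - (inner ℝ p q) • p = 0 := by
    rw [← norm_eq_zero, ← sq_eq_zero_iff, norm_sub_sq_real, norm_smul, norm_smul, inner_smul_left,
      inner_smul_right, real_inner_comm p q]
    simp only [Real.norm_eq_abs, mul_pow, sq_abs, conj_trivial]
    linear_combination (-‖p‖ ^ 2) * e3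
  have e6 : ‖p‖ ^ 2 * inner ℝ a.1 q = inner ℝ p q * inner ℝ a.1 p := by
    have h := congrArg (fun x => inner ℝ a.1 x) e5
    simp only [inner_sub_right, inner_smul_right, inner_zero_right] at h
    linarith
  have e7 : ‖q‖ ^ 2 = inner ℝ p q := by
    refine mul_left_cancel₀ hP.ne' ?_
    linear_combination ‖p‖ ^ 2 * e2 - inner ℝ p q * e1 - 2 * e6
  have e8 : ‖q‖ ^ 2 * ‖q - p‖ ^ 2 = 0 := by
    rw [e4]
    rw [← e7] at e3 ⊢
    linear_combination -e3
  exact (mul_pos hQ hR).ne' e8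

/-- A trivialization of the sphere bundle would give three disjoint sections, hence a moving
frame. -/
theorem not_isTrivialFiberBundle {J₀ : E 3} [hJ : Fact (J₀ ≠ 0)] :
    ¬ IsTrivialFiberBundle S2 (SJ.toShape (m := m) (J₀ := J₀)) := by
  rintro ⟨φ, hφ⟩
  have hsec : ∀ k : Fin 3, ∃ u : S5 m → S2, Continuous u ∧
      (∀ s, toAssoc (s, u s) =
        thetaHomeo m hJ.out (φ.symm (toShape s, ⟨e k, by simp [norm_e]⟩))) ∧
      ∀ (g : SO3) (s : S5 m), u (g • s) = g • u s := fun k => by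
    refine exists_equivariant_of_section
      (a := fun b => thetaHomeo m hJ.out (φ.symm (b, ⟨e k, by simp [norm_e]⟩))) ?_ fun b => ?_
    · refine (thetaHomeo m hJ.out).continuous.comp (φ.symm.continuous.comp ?_)
      fun_prop
    · refine (thetaDiffeo_toShape _).trans ?_
      rw [← hφ, φ.apply_symm_apply]
  choose u huc hu hug using hsec
  have hne : ∀ (s : S5 m) {k l : Fin 3}, k ≠ l → u k s ≠ u l s := by
    intro s k l hkl h
    have h1 := hu k s
    rw [h, hu l s] at h1
    have h2 := congrArg (fun p : Shape m × S2 => p.2.1 l)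
      (φ.symm.injective ((thetaHomeo m hJ.out).injective h1))
    simp [e_apply, hkl.symm] at h2
  have hcr : ∀ s : S5 m, cross ((u 1 s).1 - (u 0 s).1) ((u 2 s).1 - (u 0 s).1) ≠ 0 := fun s =>
    cross_sub_ne_zero (hne s (by decide)) (hne s (by decide)) (hne s (by decide))
  have hsub : ∀ (g : SO3) (x y : E 3), g • x - g • y = g • (x - y) := fun g x y => by
    rw [sub_eq_iff_eq_add, ← rot_add, sub_add_cancel]
  refine not_exists_equivariant
    (F := fun s : S5 m => frame ((u 2 s).1 - (u 0 s).1) ((u 1 s).1 - (u 0 s).1)) ?_ fun g s => ?_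
  · rw [isEmbedding_entries.continuous_iff, continuous_iff_continuousAt]
    intro s
    have h1 : Continuous (fun s : S5 m => ((u 2 s).1 - (u 0 s).1, (u 1 s).1 - (u 0 s).1)) := by
      fun_prop
    have h2 := ContinuousAt.comp (x := s) (g := fun p : E 3 × E 3 => frameEntries p.1 p.2)
      (f := fun s : S5 m => ((u 2 s).1 - (u 0 s).1, (u 1 s).1 - (u 0 s).1))
      (contDiffAt_frameEntries (hcr s)).continuousAt h1.continuousAt
    refine h2.congr (Filter.Eventually.of_forall fun t => ?_)
    exact (entries_frame (hcr t)).symm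
  · rw [← frame_rot g (hcr s), hug, hug, hug, ← hsub, ← hsub]
    rfl

end Nontrivial

end ThreeBody

end

open ThreeBody Manifold in
theorem theorem1 (m : Fin 3 → ℝ) (hm : ∀ a, 0 < m a) (J₀ : E 3) (hJ : J₀ ≠ 0) :
    -- smooth manifold structures on all the spaces involved, of the stated dimensions
    ∃ (_ : ChartedSpace (E 3) SO3) (_ : LieGroup (𝓡 3) ∞ SO3)
      (_ : ChartedSpace (E 6) (OTriStar m)) (_ : IsManifold (𝓡 6) ∞ (OTriStar m))
      (_ : ChartedSpace (E 5) (S5 m)) (_ : IsManifold (𝓡 5) ∞ (S5 m))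
      (_ : ChartedSpace (E 2) (Shape m)) (_ : IsManifold (𝓡 2) ∞ (Shape m))
      (_ : ChartedSpace (E 4) (SJ m J₀)) (_ : IsManifold (𝓡 4) ∞ (SJ m J₀))
      (_ : ChartedSpace (E 4) (Assoc m)) (_ : IsManifold (𝓡 4) ∞ (Assoc m))
      (_ : ChartedSpace (E 5) (QJStar m J₀)) (_ : IsManifold (𝓡 5) ∞ (QJStar m J₀)),
      -- which are the standard ones: submanifolds of Euclidean spaces, and quotient manifolds
      IsSmoothEmbedding (𝓡 3) 𝓘(ℝ, Fin 3 → Fin 3 → ℝ) ∞ (fun (g : SO3) i j => g.1 i j) ∧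
      IsSmoothEmbedding (𝓡 6) 𝓘(ℝ, Ambient) ∞ (fun x : OTriStar m => x.1.1) ∧
      IsSmoothEmbedding (𝓡 5) 𝓘(ℝ, Ambient) ∞ (fun s : S5 m => s.1.1) ∧
      IsSubmersion (𝓡 5) (𝓡 2) ∞ (toShape (m := m)) ∧
      IsSubmersion (𝓡 5) (𝓡 4) ∞ (toSJ (m := m) J₀) ∧
      IsSubmersion ((𝓡 5).prod (𝓡 2)) (𝓡 4) ∞ (toAssoc (m := m)) ∧
      IsSubmersion (𝓡 6) (𝓡 5) ∞ (toQJStar (m := m) J₀) ∧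
      -- `S` is the space of similarity classes of oriented triangles, and is a two-sphere
      (∃ h : Shape m ≃ₜ SimilarityClass m,
        ∀ s : S5 m, h (toShape s) = Quotient.mk (similarity m) s.toStar) ∧
      Nonempty (Shape m ≃ₘ⟮𝓡 2, 𝓡 2⟯ S2) ∧
      -- `S̃⁵ → S` is a principal `SO(3)`-bundle; it is not trivial, and it is isomorphic to the
      -- bundle of oriented orthonormal frames of `γ ⊕ ε → ℂP¹`
      IsSmoothPrincipalBundle (𝓡 5) (𝓡 2) (𝓡 3) SO3 (toShape (m := m)) ∧
      ¬ IsTrivialPrincipalBundle SO3 (toShape (m := m)) ∧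
      (∃ Ψ : S5 m → Triples, IsSmoothEmbedding (𝓡 5) 𝓘(ℝ, Triples) ∞ Ψ ∧
        Set.range Ψ = frameBundle ∧
        ∀ (g : SO3) (s : S5 m) (i : Fin 3), Ψ (g • s) i = ∑ j, g.1 i j • Ψ s j) ∧
      -- `S_{J₀} → S` is the associated two-sphere bundle; it is not trivial
      (∃ Θ : SJ m J₀ ≃ₘ⟮𝓡 4, 𝓡 4⟯ Assoc m,
        (∀ s : S5 m, Θ (toSJ J₀ s) = toAssoc (s, axis J₀ hJ)) ∧
        ∀ x : SJ m J₀, (Θ x).toShape = x.toShape) ∧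
      IsSmoothFiberBundle (𝓡 4) (𝓡 2) (𝓡 2) S2 (SJ.toShape (m := m) (J₀ := J₀)) ∧
      ¬ IsTrivialFiberBundle S2 (SJ.toShape (m := m) (J₀ := J₀)) ∧
      -- `Q_{J₀}` minus the triple collision is `S_{J₀} × (0, ∞)`, with second coordinate `I`
      ∃ Φ : QJStar m J₀ ≃ₘ⟮𝓡 5, (𝓡 4).prod 𝓘(ℝ, ℝ)⟯
          (SJ m J₀ × (⟨Set.Ioi 0, isOpen_Ioi⟩ : TopologicalSpace.Opens ℝ)),
        (∀ x : OTriStar m, ((Φ (toQJStar J₀ x)).2 : ℝ) = inertia x.1) ∧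
        ∀ (s : S5 m) (c : ℝ) (x : OTriStar m), 0 < c → x.1 = dilate c s.1 →
          (Φ (toQJStar J₀ x)).1 = toSJ J₀ s := by
  have : Fact (∀ a, 0 < m a) := ⟨hm⟩
  have : Fact (J₀ ≠ 0) := ⟨hJ⟩
  exact ⟨inferInstance, inferInstance, inferInstance, inferInstance, inferInstance, inferInstance,
    inferInstance, inferInstance, inferInstance, inferInstance, inferInstance, inferInstance,
    inferInstance, inferInstance,
    isSmoothEmbedding_entries, isSmoothEmbedding_starVal, isSmoothEmbedding_val,
    isSubmersion_toShape, isSubmersion_toSJ, isSubmersion_toAssoc, isSubmersion_toQJStar,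
    ⟨similarityHomeo, fun _ => rfl⟩, ⟨shapeDiffeo⟩,
    isSmoothPrincipalBundle_toShape, not_isTrivialPrincipalBundle,
    ⟨frameMap, isSmoothEmbedding_frameMap, range_frameMap, frameMap_rot⟩,
    ⟨thetaDiffeo m J₀, thetaDiffeo_toSJ, thetaDiffeo_toShape⟩,
    isSmoothFiberBundle_toShape, not_isTrivialFiberBundle,
    phiDiffeo m J₀, fun x => by rw [phiDiffeo_toQJStar, starDiffeo_snd],
    fun s c x hc hx => by rw [phiDiffeo_toQJStar, starDiffeo_fst, normalize_dilate hc hx]⟩
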